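/- For $\sigma\ge 0$ let $H^\sigma=H^\sigma(\mathbb R)$ be the Sobolev space of real-valued functions with norm $\|f\|_{H^\sigma}=\big(\int_{\mathbb R}(1+\xi^2)^\sigma|\widehat f(\xi)|^2\,d\xi\big)^{1/2}$. Let $s>1/2$, $u_0\in H^{s+6}$, $v_0\in H^{s+7}$. For $0<\epsilon\le\delta$ consider the improved Boussinesq (IB) equation $$u_{tt}-u_{xx}-\delta^2u_{xxtt}-\epsilon(u^2)_{xx}=0,\qquad u(x,0)=u_0(x),\quad u_t(x,0)=(v_0(x))_x,$$ and the two uncoupled Camassa–Holm (CH) equations $$w^+_t+w^+_x+\epsilon w^+w^+_x-\tfrac34\delta^2w^+_{xxx}-\tfrac54\delta^2w^+_{xxt}-\tfrac34\epsilon\delta^2\big(2w^+_xw^+_{xx}+w^+w^+_{xxx}\big)=0,$$ $$w^-_t-w^-_x-\epsilon w^-w^-_x+\tfrac34\delta^2w^-_{xxx}-\tfrac54\delta^2w^-_{xxt}+\tfrac34\epsilon\delta^2\big(2w^-_xw^-_{xx}+w^-w^-_{xxx}\big)=0,$$ with initial data $w^+(x,0)=\tfrac12(u_0-v_0)(x)$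 and $w^-(x,0)=\tfrac12(u_0+v_0)(x)$. **Theorem 4.1.** There is a constant $C>0$, depending only on $s,u_0,v_0$, such that for every $t^*>0$ there exists $\delta^*\in(0,1]$ with the following property. For all $\epsilon,\delta$ with $0<\epsilon\le\delta\le\delta^*$, the IB problem has a solution $u^{\epsilon,\delta}\in C^2([0,t^*],H^{s+6})$, the two CH problems have solutions $(w^\pm)^{\epsilon,\delta}\in C([0,t^*],H^{s+5})\cap C^1([0,t^*],H^{s+4})$, and any solutions $u^{\epsilon,\delta}\in C^2([0,t^*],H^{s})$ of the IB problem and $(w^\pm)^{\epsilon,\delta}\in C([0,t^*],H^{s+5})\cap C^1([0,t^*],H^{s+4})$ of the CH problems satisfy $$\|u^{\epsilon,\delta}(t)-(w^+)^{\epsilon,\delta}(t)-(w^-)^{\epsilon,\delta}(t)\|_{H^s}\le C\big((\epsilon+\delta^2)+(\epsilon+\delta^4)t\big)\qquad\text{for all }t\in[0,t^*].$$ Here the time derivatives are derivatives of curves in the Sobolev spaces, and at every time $t\in[0,t^*]$ the IB equation holds in the sense of distributions in $x$ and the CH equations hold almost everywhere in $x$. -/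

import Mathlib

open MeasureTheory Filter Topology Set
open scoped ENNReal FourierTransform SchwartzMap

noncomputable section

/-- The norm of the real Sobolev space `H^σ(ℝ)`, for an order `σ ≥ 0`, with values in `[0, ∞]`:
`‖f‖_{H^σ} = (∫ (1 + ξ²)^σ |f̂(ξ)|² dξ)^{1/2}`, where `f̂` is the `L²` Fourier transform, and
`‖f‖_{H^σ} = ∞` if `f` is not in `L²(ℝ)`.
Mathlib's Fourier transform is `𝓕 f (η) = ∫ exp(-2πixη) f(x) dx`, so the frequency is `ξ = 2πη`;
after this substitution the formula is the usual one for the unitary normalization of `f̂`. -/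
def hsENorm (σ : ℝ) (f : ℝ → ℝ) : ℝ≥0∞ :=
  ⨅ hf : MemLp (fun x => (f x : ℂ)) 2 (volume : Measure ℝ),
    (∫⁻ η : ℝ, ENNReal.ofReal ((1 + (2 * Real.pi * η) ^ 2) ^ σ) *
      ‖(𝓕 (hf.toLp (fun x => (f x : ℂ))) : Lp ℂ 2 (volume : Measure ℝ)) η‖ₑ ^ 2) ^ (1 / 2 : ℝ)

/-- `f ∈ H^σ(ℝ)` (real-valued functions, modulo equality almost everywhere), for `σ ≥ 0`. -/
def MemHs (σ : ℝ) (f : ℝ → ℝ) : Prop :=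
  hsENorm σ f < ∞

/-- `w ∈ C([0,T], H^σ(ℝ))`, where `w t` is the function `x ↦ w(x,t)`. -/
def ContInHs (σ T : ℝ) (w : ℝ → ℝ → ℝ) : Prop :=
  ∀ t ∈ Icc 0 T, MemHs σ (w t) ∧
    Tendsto (fun τ => hsENorm σ (fun x => w τ x - w t x)) (𝓝[Icc 0 T] t) (𝓝 0)

/-- The curve `w` is differentiable on `[0,T]` with respect to the norm of `H^σ(ℝ)`, with
derivative `w' t` at the time `t` (one-sided at the two end points). -/
def HasDerivInHs (σ T : ℝ) (w w' : ℝ → ℝ → ℝ) : Prop :=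
  ∀ t ∈ Icc 0 T,
    Tendsto (fun τ => hsENorm σ (fun x => (w τ x - w t x) / (τ - t) - w' t x))
      (𝓝[Icc 0 T \ {t}] t) (𝓝 0)

/-- `f` and `g` are in `L²(ℝ)` and `g` is the derivative of `f` in the sense of distributions. -/
def IsWeakDeriv (f g : ℝ → ℝ) : Prop :=
  MemLp f 2 (volume : Measure ℝ) ∧ MemLp g 2 (volume : Measure ℝ) ∧
    ∀ φ : 𝓢(ℝ, ℝ), ∫ x, f x * deriv φ x = - ∫ x, g x * φ x

/-- `u ∈ C²([0,T], H^σ(ℝ))` solves the improved Boussinesq equation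
`u_tt - u_xx - δ² u_xxtt - ε (u²)_xx = 0` on `[0,T]` with initial data `u(·,0) = u₀` and
`u_t(·,0) = (v₀)_x`. The time derivatives are those of the curve `t ↦ u(·,t)` in `H^σ(ℝ)`; the
equation holds in the sense of (tempered) distributions in `x`, at every time `t ∈ [0,T]`. -/
def IsIBSolution (σ ε δ T : ℝ) (u₀ v₀ : ℝ → ℝ) (u : ℝ → ℝ → ℝ) : Prop :=
  ∃ ut utt : ℝ → ℝ → ℝ,
    ContInHs σ T u ∧ ContInHs σ T ut ∧ ContInHs σ T utt ∧
    HasDerivInHs σ T u ut ∧ HasDerivInHs σ T ut utt ∧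
    u 0 =ᵐ[volume] u₀ ∧ IsWeakDeriv v₀ (ut 0) ∧
    ∀ t ∈ Icc 0 T, ∀ φ : 𝓢(ℝ, ℝ),
      (∫ x, utt t x * φ x) - (∫ x, u t x * iteratedDeriv 2 φ x)
        - δ ^ 2 * (∫ x, utt t x * iteratedDeriv 2 φ x)
        - ε * (∫ x, u t x ^ 2 * iteratedDeriv 2 φ x) = 0

/-- `w ∈ C([0,T], H^σ(ℝ)) ∩ C¹([0,T], H^{σ-1}(ℝ))` solves, on `[0,T]` and with `w(·,0) = w₀`, the
Camassa-Holm equation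
`w_t + κ w_x + κ ε w w_x - κ (3/4) δ² w_xxx - (5/4) δ² w_xxt
  - κ (3/4) ε δ² (2 w_x w_xx + w w_xxx) = 0`.
For `κ = 1` this is the equation of the right-going wave, for `κ = -1` that of the left-going one.
It holds for almost every `x`, at every time `t ∈ [0,T]`; the derivatives in `x` are weak ones
(they are functions in `L²(ℝ)` for the orders `σ ≥ 3`). -/
def IsCHSolution (κ σ ε δ T : ℝ) (w₀ : ℝ → ℝ) (w : ℝ → ℝ → ℝ) : Prop :=
  ∃ wt : ℝ → ℝ → ℝ,
    ContInHs σ T w ∧ ContInHs (σ - 1) T wt ∧ HasDerivInHs (σ - 1) T w wt ∧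
    w 0 =ᵐ[volume] w₀ ∧
    ∀ t ∈ Icc 0 T, ∃ wx wxx wxxx wtx wtxx : ℝ → ℝ,
      IsWeakDeriv (w t) wx ∧ IsWeakDeriv wx wxx ∧ IsWeakDeriv wxx wxxx ∧
      IsWeakDeriv (wt t) wtx ∧ IsWeakDeriv wtx wtxx ∧
      ∀ᵐ x, wt t x + κ * wx x + κ * ε * (w t x * wx x) - κ * (3 / 4) * δ ^ 2 * wxxx x
        - (5 / 4) * δ ^ 2 * wtxx x
        - κ * (3 / 4) * ε * δ ^ 2 * (2 * wx x * wxx x + w t x * wxxx x) = 0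

end

/-! On the Fourier side the IB equation reads `û_tt = -ω² (û + ε (u²)^)` with `ω(ξ) = ξ / √(1 +
δ²ξ²)`. The Riemann coordinates `P`, `Q`, given by `û = (P + Q)/2` and `û_t = iω (P - Q)/2`, satisfy
`P_t = iω (P + ε (u²)^)` and `Q_t = -iω (Q + ε (u²)^)`. Solved for the time derivative, the CH
equations read `W_t = -iκΩ W - κ ε B(W, W)` with `Ω = ξ (1 + 3/4 δ²ξ²) / (1 + 5/4 δ²ξ²)` and a
quadratic term `B` that loses one derivative. So `P/2` is compared with `w⁻` and `Q/2` with `w⁺`.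

There are three errors. The data differ by `±(√(1 + δ²ξ²) - 1) v̂₀ / 2`, which is `O(δ²)` in `H^s`.
The dispersion relations differ by `O(δ⁴ |ξ|⁵)` (`abs_ibOm_sub_chOm_le`), which contributes `δ⁴ t`
for solutions bounded in `H^{s+5}`. The quadratic terms need not be matched: each is `O(ε)` in `H^s`
and contributes `ε t`. As `iω` is skew-adjoint, the difference grows linearly, without an
exponential factor (`comparison`).

The constant must not depend on `t*`, so the bound in `H^{s+5}` must not grow with `t*`. This is the
role of `exists_solution_of_tame`: the growth rate of the `H^{s+6}` norm is controlled by the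
`H^{s+5}` norm, while the latter grows at most at the rate `ε` times the square of the former. The
`H^{s+6}` norm may grow exponentially in `t*`, but for small `δ*` the `H^{s+5}` norm increases by at
most `1`.

For the IB equation, an ordinary differential equation in `H^σ`, the first of these estimates
follows from `ε |ω| ≤ ε/δ ≤ 1`. For the CH equations it follows by symmetrizing the trilinear form
over the plane `ξ₁ + ξ₂ + ξ₃ = 0` (`energy_chKer`). The CH solutions are limits of Galerkin
approximations: bounded in `H^{s+6}`, Cauchy in `L²` by `ch_stability`, convergent in `H^{s+5}` by
interpolation (`exists_ch`).

Uniqueness (`ib_unique`, `ch_unique`) carries the estimate from the constructed solutions to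
arbitrary ones, and `ib_equation_iff`, `ch_equation_iff` translate between real functions and their
transforms. -/

noncomputable section

namespace LongWave

/-! ### Sobolev weights -/

/-- The frequency `ξ = 2πη`. -/
def freq (η : ℝ) : ℝ := 2 * Real.pi * η

/-- The Sobolev weight `(1 + ξ²)^{σ/2}`. -/
def wt (σ η : ℝ) : ℝ := (1 + freq η ^ 2) ^ (σ / 2)

lemma freq_add (x y : ℝ) : freq (x + y) = freq x + freq y := by simp only [freq]; ring

lemma freq_neg (x : ℝ) : freq (-x) = -freq x := by simp only [freq]; ring

@[fun_prop] lemma continuous_freq : Continuous freq := by unfold freq; fun_prop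

lemma one_le_jap (η : ℝ) : 1 ≤ 1 + freq η ^ 2 := by nlinarith [sq_nonneg (freq η)]

lemma jap_pos (η : ℝ) : 0 < 1 + freq η ^ 2 := by positivity

lemma wt_pos (σ η : ℝ) : 0 < wt σ η := Real.rpow_pos_of_pos (jap_pos η) _

lemma wt_nonneg (σ η : ℝ) : 0 ≤ wt σ η := (wt_pos σ η).le

@[simp] lemma wt_zero (η : ℝ) : wt 0 η = 1 := by simp [wt]

lemma wt_add (σ τ η : ℝ) : wt (σ + τ) η = wt σ η * wt τ η := by
  rw [wt, wt, wt, ← Real.rpow_add (jap_pos η)]; congr 1; ring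

lemma wt_neg (σ η : ℝ) : wt (-σ) η = (wt σ η)⁻¹ := by
  rw [wt, wt, ← Real.rpow_neg (jap_pos η).le]; congr 1; ring

lemma wt_neg_arg (σ η : ℝ) : wt σ (-η) = wt σ η := by simp [wt, freq_neg]

lemma wt_mono {σ τ : ℝ} (h : σ ≤ τ) (η : ℝ) : wt σ η ≤ wt τ η :=
  Real.rpow_le_rpow_of_exponent_le (one_le_jap η) (by linarith)

lemma one_le_wt {σ : ℝ} (h : 0 ≤ σ) (η : ℝ) : 1 ≤ wt σ η := by
  simpa using wt_mono h η

lemma wt_le_one {σ : ℝ} (h : σ ≤ 0) (η : ℝ) : wt σ η ≤ 1 := by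
  simpa using wt_mono h η

lemma wt_two (η : ℝ) : wt 2 η = 1 + freq η ^ 2 := by simp [wt]

lemma wt_sq (σ η : ℝ) : wt σ η ^ 2 = (1 + freq η ^ 2) ^ σ := by
  rw [wt, ← Real.rpow_natCast, ← Real.rpow_mul (jap_pos η).le]; congr 1; push_cast; ring

lemma wt_one_sq (η : ℝ) : wt 1 η ^ 2 = 1 + freq η ^ 2 := by simp [wt_sq]

@[fun_prop] lemma continuous_wt (σ : ℝ) : Continuous (wt σ) := by
  unfold wt
  exact Continuous.rpow_const (by fun_prop) fun η => Or.inl (jap_pos η).ne'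

lemma abs_freq_le (η : ℝ) : |freq η| ≤ wt 1 η :=
  abs_le_of_sq_le_sq (by rw [wt_one_sq]; linarith) (wt_nonneg 1 η)

lemma wt_le_of_jap_le {σ C x y : ℝ} (hσ : 0 ≤ σ) (hC : 0 ≤ C)
    (h : 1 + freq x ^ 2 ≤ C ^ 2 * (1 + freq y ^ 2)) : wt σ x ≤ C ^ σ * wt σ y := by
  rw [wt, wt]
  calc (1 + freq x ^ 2) ^ (σ / 2) ≤ (C ^ 2 * (1 + freq y ^ 2)) ^ (σ / 2) :=
        Real.rpow_le_rpow (jap_pos x).le h (by linarith)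
    _ = C ^ σ * (1 + freq y ^ 2) ^ (σ / 2) := by
        rw [Real.mul_rpow (by positivity) (jap_pos y).le, ← Real.rpow_natCast C 2,
          ← Real.rpow_mul hC]
        congr 2; push_cast; ring

/-- The larger of two frequencies is at least half of their sum in modulus. The sum of weights on
the right is the source of the tame form of the product estimates. -/
lemma wt_add_arg_le {σ : ℝ} (hσ : 0 ≤ σ) (x y : ℝ) :
    wt σ (x + y) ≤ 2 ^ σ * (wt σ x + wt σ y) := by
  rcases le_total (freq x ^ 2) (freq y ^ 2) with h | h
  · refine (wt_le_of_jap_le (y := y) hσ zero_le_two ?_).trans ?_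
    · rw [freq_add]; nlinarith [sq_nonneg (freq x - freq y)]
    · gcongr; linarith [wt_nonneg σ x]
  · refine (wt_le_of_jap_le (y := x) hσ zero_le_two ?_).trans ?_
    · rw [freq_add]; nlinarith [sq_nonneg (freq x - freq y)]
    · gcongr; linarith [wt_nonneg σ y]

/-- The condition `1/2 < s` makes `(1 + ξ²)^{-s}` integrable on the line; the embedding of `H^s`
into the functions with integrable transform rests on it. -/
lemma memLp_wt_neg {s : ℝ} (hs : 1 / 2 < s) : MemLp (wt (-s)) 2 volume := by
  rw [memLp_two_iff_integrable_sq (continuous_wt _).aestronglyMeasurable]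
  have h := (integrable_rpow_neg_one_add_norm_sq (E := ℝ) (μ := volume) (r := 2 * s)
    (by simp; linarith)).comp_mul_left' (R := 2 * Real.pi) (by positivity)
  refine h.congr (Eventually.of_forall fun η => ?_)
  simp only [wt_sq, freq, Real.norm_eq_abs, sq_abs]
  congr 1; ring

/-! ### Young's inequality -/

lemma lintegral_mul_sq_le {f g : ℝ → ℝ≥0∞} (hf : AEMeasurable f) (hg : AEMeasurable g) :
    (∫⁻ x, f x * g x) ^ 2 ≤ (∫⁻ x, f x ^ 2) * ∫⁻ x, g x ^ 2 := by
  have h := ENNReal.lintegral_mul_le_Lp_mul_Lq volume Real.HolderConjugate.two_two hf hg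
  have h2 := pow_le_pow_left' h 2
  rw [mul_pow] at h2
  have e : ∀ a : ℝ≥0∞, (a ^ (1 / (2 : ℝ))) ^ 2 = a := fun a => by
    rw [← ENNReal.rpow_natCast, ← ENNReal.rpow_mul]; norm_num
  simp only [e, ENNReal.rpow_two] at h2
  exact h2

/-- Cauchy-Schwarz for the measure with density `f`, which is split into two square roots. -/
lemma lintegral_mul_sq_le_weighted {f g : ℝ → ℝ≥0∞} (hf : AEMeasurable f) (hg : AEMeasurable g) :
    (∫⁻ x, f x * g x) ^ 2 ≤ (∫⁻ x, f x) * ∫⁻ x, f x * g x ^ 2 := by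
  have e : ∀ a : ℝ≥0∞, a ^ (1 / 2 : ℝ) * a ^ (1 / 2 : ℝ) = a := fun a => by
    rw [← ENNReal.rpow_add_of_nonneg _ _ (by norm_num) (by norm_num)]; norm_num
  have h := lintegral_mul_sq_le (f := fun x => f x ^ (1 / 2 : ℝ))
    (g := fun x => f x ^ (1 / 2 : ℝ) * g x) (by fun_prop) (by fun_prop)
  have e2 : ∀ a b : ℝ≥0∞, (a ^ (1 / 2 : ℝ) * b) ^ 2 = a * b ^ 2 := fun a b => by
    rw [mul_pow, sq (a ^ _), e]
  have e3 : ∀ a : ℝ≥0∞, (a ^ (1 / 2 : ℝ)) ^ 2 = a := fun a => by rw [sq, e]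
  simpa only [← mul_assoc, e, e2, e3] using h

/-- Cauchy-Schwarz with the first factor as weight, then Tonelli. Values in `[0, ∞]` make
integrability hypotheses unnecessary. -/
lemma lintegral_conv_sq_le {f g : ℝ → ℝ≥0∞} (hf : AEMeasurable f) (hg : AEMeasurable g) :
    ∫⁻ ξ, (∫⁻ η, f (ξ - η) * g η) ^ 2 ≤ (∫⁻ x, f x) ^ 2 * ∫⁻ x, g x ^ 2 := by
  have hfs : AEMeasurable (fun z : ℝ × ℝ => f (z.1 - z.2)) (volume.prod volume) :=
    hf.comp_quasiMeasurePreserving (quasiMeasurePreserving_sub_of_right_invariant volume volume)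
  have hf' : ∀ ξ : ℝ, AEMeasurable (fun η => f (ξ - η)) := fun ξ =>
    hf.comp_quasiMeasurePreserving (quasiMeasurePreserving_sub_left volume ξ)
  calc ∫⁻ ξ, (∫⁻ η, f (ξ - η) * g η) ^ 2
      ≤ ∫⁻ ξ, (∫⁻ η, f (ξ - η)) * ∫⁻ η, f (ξ - η) * g η ^ 2 :=
        lintegral_mono fun ξ => lintegral_mul_sq_le_weighted (hf' ξ) hg
    _ = ∫⁻ ξ, (∫⁻ x, f x) * ∫⁻ η, f (ξ - η) * g η ^ 2 := by
        refine lintegral_congr fun ξ => ?_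
        rw [lintegral_sub_left_eq_self]
    _ = (∫⁻ x, f x) * ∫⁻ ξ, ∫⁻ η, f (ξ - η) * g η ^ 2 := by
        rw [lintegral_const_mul'']
        exact AEMeasurable.lintegral_prod_right' (f := fun z : ℝ × ℝ => f (z.1 - z.2) * g z.2 ^ 2)
          (hfs.mul ((hg.comp_quasiMeasurePreserving
            Measure.quasiMeasurePreserving_snd).pow_const 2))
    _ = (∫⁻ x, f x) * ∫⁻ η, ∫⁻ ξ, f (ξ - η) * g η ^ 2 := by
        rw [lintegral_lintegral_swap]
        exact (hfs.mul ((hg.comp_quasiMeasurePreserving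
            Measure.quasiMeasurePreserving_snd).pow_const 2))
    _ = (∫⁻ x, f x) * ∫⁻ η, (∫⁻ x, f x) * g η ^ 2 := by
        congr 1
        refine lintegral_congr fun η => ?_
        rw [lintegral_mul_const'', lintegral_sub_right_eq_self]
        exact hf.comp_quasiMeasurePreserving
          (measurePreserving_sub_right volume η).quasiMeasurePreserving
    _ = (∫⁻ x, f x) ^ 2 * ∫⁻ x, g x ^ 2 := by
        rw [lintegral_const_mul'' _ (hg.pow_const 2), sq, mul_assoc]

/-! ### Functions with square-integrable weighted modulus -/

/-- The Hilbert space `L²(ℝ; ℂ)`. -/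
abbrev E := Lp ℂ 2 (volume : Measure ℝ)

/-- `F` is the Fourier transform of an element of `H^σ`. -/
def InH (σ : ℝ) (F : ℝ → ℂ) : Prop := MemLp (fun η => (wt σ η : ℂ) * F η) 2 volume

open Classical in
/-- The class of `F` in `L²`, and `0` if `F` is not in `L²`. -/
def toE (F : ℝ → ℂ) : E := if h : MemLp F 2 volume then h.toLp F else 0

/-- The function `F` multiplied with the Sobolev weight of order `σ`, as an element of `L²`. -/
def lift (σ : ℝ) (F : ℝ → ℂ) : E := toE fun η => (wt σ η : ℂ) * F η

lemma coeFn_toE {F : ℝ → ℂ} (h : MemLp F 2 volume) : toE F =ᵐ[volume] F := by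
  rw [toE, dif_pos h]; exact h.coeFn_toLp

lemma enorm_toE {F : ℝ → ℂ} (h : MemLp F 2 volume) : ‖toE F‖ₑ = eLpNorm F 2 volume := by
  rw [toE, dif_pos h, Lp.enorm_toLp]

lemma norm_toE {F : ℝ → ℂ} (h : MemLp F 2 volume) : ‖toE F‖ = (eLpNorm F 2 volume).toReal := by
  rw [toE, dif_pos h, Lp.norm_toLp]

lemma toE_congr {F G : ℝ → ℂ} (h : F =ᵐ[volume] G) : toE F = toE G := by
  by_cases hF : MemLp F 2 volume
  · rw [toE, toE, dif_pos hF, dif_pos (hF.ae_eq h)]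
    exact MemLp.toLp_congr _ _ h
  · rw [toE, toE, dif_neg hF, dif_neg fun hG => hF (hG.ae_eq h.symm)]

lemma toE_coe (f : E) : toE f = f := by
  rw [toE, dif_pos (Lp.memLp f), Lp.toLp_coeFn]

lemma toE_eq_iff {F : ℝ → ℂ} (h : MemLp F 2 volume) {f : E} : toE F = f ↔ F =ᵐ[volume] f := by
  constructor
  · rintro rfl; exact (coeFn_toE h).symm
  · intro h'; rw [toE_congr h', toE_coe]

lemma toE_add {F G : ℝ → ℂ} (hF : MemLp F 2 volume) (hG : MemLp G 2 volume) :
    toE (fun η => F η + G η) = toE F + toE G := by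
  rw [toE, toE, toE, dif_pos hF, dif_pos hG,
    dif_pos (show MemLp (fun η => F η + G η) 2 volume from hF.add hG)]
  exact MemLp.toLp_add hF hG

lemma toE_sub {F G : ℝ → ℂ} (hF : MemLp F 2 volume) (hG : MemLp G 2 volume) :
    toE (fun η => F η - G η) = toE F - toE G := by
  rw [toE, toE, toE, dif_pos hF, dif_pos hG,
    dif_pos (show MemLp (fun η => F η - G η) 2 volume from hF.sub hG)]
  exact MemLp.toLp_sub hF hG

lemma toE_const_mul {F : ℝ → ℂ} (c : ℂ) (hF : MemLp F 2 volume) :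
    toE (fun η => c * F η) = c • toE F := by
  rw [toE, toE, dif_pos hF, dif_pos (hF.const_mul c)]
  exact MemLp.toLp_const_smul c hF

/-- If `F` is not in `L²`, its class is the default value `0` and the bound is trivial; so nothing
about `F` has to be known in advance. -/
lemma norm_toE_le {F G : ℝ → ℂ} {C : ℝ} (hC : 0 ≤ C) (hG : MemLp G 2 volume)
    (h : ∀ᵐ η, ‖F η‖ ≤ C * ‖G η‖) : ‖toE F‖ ≤ C * ‖toE G‖ := by
  by_cases hF : MemLp F 2 volume
  · rw [norm_toE hF, norm_toE hG]
    have := eLpNorm_le_mul_eLpNorm_of_ae_le_mul h 2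
    have h2 := ENNReal.toReal_mono (ENNReal.mul_ne_top ENNReal.ofReal_ne_top hG.2.ne) this
    rwa [ENNReal.toReal_mul, ENNReal.toReal_ofReal hC] at h2
  · rw [toE, dif_neg hF, norm_zero]; positivity

lemma InH.aesm {σ : ℝ} {F : ℝ → ℂ} (h : InH σ F) : AEStronglyMeasurable F volume := by
  have h1 : AEStronglyMeasurable (fun η => (wt (-σ) η : ℂ) * ((wt σ η : ℂ) * F η)) volume :=
    AEStronglyMeasurable.mul
      (Complex.continuous_ofReal.comp (continuous_wt _)).aestronglyMeasurable h.1
  refine h1.congr (Eventually.of_forall fun η => ?_)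
  have : (wt σ η : ℂ) ≠ 0 := by exact_mod_cast (wt_pos σ η).ne'
  simp only [wt_neg, Complex.ofReal_inv]
  field_simp

lemma aesm_wt_mul {F : ℝ → ℂ} (σ : ℝ) (h : AEStronglyMeasurable F volume) :
    AEStronglyMeasurable (fun η => (wt σ η : ℂ) * F η) volume :=
  AEStronglyMeasurable.mul
      (Complex.continuous_ofReal.comp (continuous_wt _)).aestronglyMeasurable h

lemma norm_wt_mul (σ : ℝ) (F : ℝ → ℂ) (η : ℝ) : ‖(wt σ η : ℂ) * F η‖ = wt σ η * ‖F η‖ := by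
  rw [norm_mul, Complex.norm_real, Real.norm_of_nonneg (wt_nonneg σ η)]

lemma InH.of_le {σ τ C : ℝ} {F G : ℝ → ℂ} (hG : InH τ G) (hF : AEStronglyMeasurable F volume)
    (h : ∀ᵐ η, wt σ η * ‖F η‖ ≤ C * (wt τ η * ‖G η‖)) : InH σ F := by
  refine MemLp.of_le_mul (c := C) hG (aesm_wt_mul σ hF) ?_
  filter_upwards [h] with η hη
  rw [norm_wt_mul, norm_wt_mul]
  exact hη

lemma norm_lift_le {σ τ C : ℝ} {F G : ℝ → ℂ} (hC : 0 ≤ C) (hG : InH τ G)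
    (h : ∀ᵐ η, wt σ η * ‖F η‖ ≤ C * (wt τ η * ‖G η‖)) : ‖lift σ F‖ ≤ C * ‖lift τ G‖ := by
  refine norm_toE_le hC hG ?_
  filter_upwards [h] with η hη
  rw [norm_wt_mul, norm_wt_mul]
  exact hη

lemma InH.mono {σ τ : ℝ} {F : ℝ → ℂ} (hF : InH τ F) (h : σ ≤ τ) : InH σ F :=
  hF.of_le (C := 1) hF.aesm (Eventually.of_forall fun η => by
    rw [one_mul]; exact mul_le_mul_of_nonneg_right (wt_mono h η) (norm_nonneg _))

lemma norm_lift_mono {σ τ : ℝ} {F : ℝ → ℂ} (hF : InH τ F) (h : σ ≤ τ) :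
    ‖lift σ F‖ ≤ ‖lift τ F‖ := by
  simpa using norm_lift_le (C := 1) zero_le_one hF (Eventually.of_forall fun η => by
    rw [one_mul]; exact mul_le_mul_of_nonneg_right (wt_mono h η) (norm_nonneg _))

lemma InH.add {σ : ℝ} {F G : ℝ → ℂ} (hF : InH σ F) (hG : InH σ G) :
    InH σ (fun η => F η + G η) :=
  (MemLp.add hF hG).ae_eq (Eventually.of_forall fun η => by simp; ring)

lemma InH.sub {σ : ℝ} {F G : ℝ → ℂ} (hF : InH σ F) (hG : InH σ G) :
    InH σ (fun η => F η - G η) :=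
  (MemLp.sub hF hG).ae_eq (Eventually.of_forall fun η => by simp; ring)

lemma InH.const_mul {σ : ℝ} {F : ℝ → ℂ} (hF : InH σ F) (c : ℂ) : InH σ (fun η => c * F η) :=
  (MemLp.const_mul hF c).ae_eq (Eventually.of_forall fun η => by simp; ring)

lemma InH.congr {σ : ℝ} {F G : ℝ → ℂ} (hF : InH σ F) (h : F =ᵐ[volume] G) : InH σ G :=
  hF.ae_eq (by filter_upwards [h] with η hη; rw [hη])

lemma lift_congr {σ : ℝ} {F G : ℝ → ℂ} (h : F =ᵐ[volume] G) : lift σ F = lift σ G :=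
  toE_congr (by filter_upwards [h] with η hη; rw [hη])

lemma lift_add {σ : ℝ} {F G : ℝ → ℂ} (hF : InH σ F) (hG : InH σ G) :
    lift σ (fun η => F η + G η) = lift σ F + lift σ G := by
  rw [lift, lift, lift, ← toE_add hF hG]; congr 1; ext η; ring

lemma lift_sub {σ : ℝ} {F G : ℝ → ℂ} (hF : InH σ F) (hG : InH σ G) :
    lift σ (fun η => F η - G η) = lift σ F - lift σ G := by
  rw [lift, lift, lift, ← toE_sub hF hG]; congr 1; ext η; ring

lemma lift_const_mul {σ : ℝ} {F : ℝ → ℂ} (c : ℂ) (hF : InH σ F) :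
    lift σ (fun η => c * F η) = c • lift σ F := by
  rw [lift, lift, ← toE_const_mul c hF]; congr 1; ext η; ring

lemma coeFn_lift {σ : ℝ} {F : ℝ → ℂ} (h : InH σ F) :
    lift σ F =ᵐ[volume] fun η => (wt σ η : ℂ) * F η := coeFn_toE h

/-- The function of which `f` is the lift at level `σ`. -/
def unlift (σ : ℝ) (f : E) : ℝ → ℂ := fun η => (wt (-σ) η : ℂ) * f η

lemma wt_mul_unlift (σ : ℝ) (f : E) (η : ℝ) : (wt σ η : ℂ) * unlift σ f η = f η := by
  have : (wt σ η : ℂ) ≠ 0 := by exact_mod_cast (wt_pos σ η).ne'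
  simp only [unlift, wt_neg, Complex.ofReal_inv]
  field_simp

lemma inH_unlift (σ : ℝ) (f : E) : InH σ (unlift σ f) := by
  simp only [InH, wt_mul_unlift]; exact Lp.memLp f

lemma lift_unlift (σ : ℝ) (f : E) : lift σ (unlift σ f) = f := by
  simp only [lift, wt_mul_unlift]; exact toE_coe f

lemma unlift_lift {σ : ℝ} {F : ℝ → ℂ} (h : InH σ F) : unlift σ (lift σ F) =ᵐ[volume] F := by
  filter_upwards [coeFn_lift h] with η hη
  have : (wt σ η : ℂ) ≠ 0 := by exact_mod_cast (wt_pos σ η).ne'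
  simp only [unlift, hη, wt_neg, Complex.ofReal_inv]
  field_simp

lemma lift_inj {σ : ℝ} {F G : ℝ → ℂ} (hF : InH σ F) (hG : InH σ G) (h : lift σ F = lift σ G) :
    F =ᵐ[volume] G := by
  filter_upwards [unlift_lift hF, unlift_lift hG] with η h1 h2
  rw [← h1, ← h2, h]

/-! ### Fourier multipliers -/

lemma memLp_mul_of_bdd {a : ℝ → ℂ} (ha : Measurable a) {C : ℝ} (hC : ∀ η, ‖a η‖ ≤ C) {F : ℝ → ℂ}
    (hF : MemLp F 2 volume) : MemLp (fun η => a η * F η) 2 volume :=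
  hF.of_le_mul (c := C) (ha.aestronglyMeasurable.mul hF.1) (Eventually.of_forall fun η => by
    rw [norm_mul]; exact mul_le_mul_of_nonneg_right (hC η) (norm_nonneg _))

/-- Multiplication with a bounded function, as a bounded operator on `L²`. -/
def mulE (a : ℝ → ℂ) (ha : Measurable a) (C : ℝ) (hC : ∀ η, ‖a η‖ ≤ C) : E →L[ℂ] E :=
  LinearMap.mkContinuous
    { toFun := fun f => toE fun η => a η * f η
      map_add' := fun f g => by
        rw [← toE_add (memLp_mul_of_bdd ha hC (Lp.memLp f)) (memLp_mul_of_bdd ha hC (Lp.memLp g))]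
        refine toE_congr ?_
        filter_upwards [Lp.coeFn_add f g] with η hη
        rw [hη, Pi.add_apply, mul_add]
      map_smul' := fun c f => by
        rw [RingHom.id_apply, ← toE_const_mul c (memLp_mul_of_bdd ha hC (Lp.memLp f))]
        refine toE_congr ?_
        filter_upwards [Lp.coeFn_smul c f] with η hη
        rw [hη, Pi.smul_apply, smul_eq_mul]; ring }
    C fun f => by
      have hC0 : 0 ≤ C := (norm_nonneg _).trans (hC 0)
      have := norm_toE_le (F := fun η => a η * f η) hC0 (Lp.memLp f)
        (Eventually.of_forall fun η => by
          rw [norm_mul]; exact mul_le_mul_of_nonneg_right (hC η) (norm_nonneg _))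
      rwa [toE_coe] at this

section
variable {a : ℝ → ℂ} (ha : Measurable a) {C : ℝ} (hC : ∀ η, ‖a η‖ ≤ C)

lemma coeFn_mulE (f : E) : mulE a ha C hC f =ᵐ[volume] fun η => a η * f η :=
  coeFn_toE (memLp_mul_of_bdd ha hC (Lp.memLp f))

lemma mulE_toE {F : ℝ → ℂ} (hF : MemLp F 2 volume) :
    mulE a ha C hC (toE F) = toE fun η => a η * F η := by
  refine toE_congr ?_
  filter_upwards [coeFn_toE hF] with η hη
  rw [hη]

lemma norm_mulE_le (f : E) : ‖mulE a ha C hC f‖ ≤ C * ‖f‖ :=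
  LinearMap.mkContinuous_norm_le' _ _ |> fun h => by
    refine (ContinuousLinearMap.le_opNorm _ f).trans ?_
    refine (mul_le_mul_of_nonneg_right h (norm_nonneg _)).trans ?_
    rw [max_eq_left ((norm_nonneg _).trans (hC 0))]

end

lemma norm_wt_sub_le {σ τ : ℝ} (h : σ ≤ τ) (η : ℝ) : ‖(wt (σ - τ) η : ℂ)‖ ≤ 1 := by
  rw [Complex.norm_real, Real.norm_of_nonneg (wt_nonneg _ η)]
  exact wt_le_one (by linarith) η

/-- The inclusion of `H^τ` into `H^σ` for `σ ≤ τ`, in terms of lifts. -/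
def lower (σ τ : ℝ) (h : σ ≤ τ) : E →L[ℂ] E :=
  mulE (fun η => (wt (σ - τ) η : ℂ))
    (Complex.measurable_ofReal.comp (continuous_wt _).measurable) 1 (norm_wt_sub_le h)

lemma lower_lift {σ τ : ℝ} (h : σ ≤ τ) {F : ℝ → ℂ} (hF : InH τ F) :
    lower σ τ h (lift τ F) = lift σ F := by
  rw [lower, lift, mulE_toE _ _ hF]
  rw [lift]; congr 1; ext η
  rw [← mul_assoc, ← Complex.ofReal_mul, ← wt_add, sub_add_cancel]

lemma lower_eq_lift_unlift {σ τ : ℝ} (h : σ ≤ τ) (f : E) :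
    lower σ τ h f = lift σ (unlift τ f) := by
  rw [← lower_lift h (inH_unlift τ f), lift_unlift]

/-! ### Weighted `L¹` norms -/

/-- The weighted `L¹` norm `∫ (1+ξ²)^{j/2} |F|`. -/
def l1 (j : ℝ) (F : ℝ → ℂ) : ℝ := ∫ η, wt j η * ‖F η‖

/-- The constant of the embedding of `H^s` into the functions with integrable Fourier transform. -/
def embC (s : ℝ) : ℝ := (eLpNorm (wt (-s)) 2 volume).toReal

lemma embC_nonneg (s : ℝ) : 0 ≤ embC s := ENNReal.toReal_nonneg

lemma l1_nonneg (j : ℝ) (F : ℝ → ℂ) : 0 ≤ l1 j F :=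
  integral_nonneg fun η => mul_nonneg (wt_nonneg j η) (norm_nonneg _)

lemma InH.integrable {s j : ℝ} (hs : 1 / 2 < s) {F : ℝ → ℂ} (hF : InH (s + j) F) :
    Integrable (fun η => (wt j η : ℂ) * F η) := by
  have := MemLp.integrable_mul (memLp_wt_neg hs).ofReal hF (𝕜 := ℂ)
  refine this.congr (Eventually.of_forall fun η => ?_)
  have : (wt s η : ℂ) ≠ 0 := by exact_mod_cast (wt_pos s η).ne'
  simp only [Pi.mul_apply, wt_add, wt_neg, Complex.ofReal_mul, Complex.ofReal_inv,
    RCLike.ofReal_eq_complex_ofReal]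
  field_simp

/-- Cauchy-Schwarz after writing `wt j = wt (-s) * wt (s + j)`: the Sobolev embedding on the Fourier
side. -/
lemma l1_le {s j : ℝ} (hs : 1 / 2 < s) {F : ℝ → ℂ} (hF : InH (s + j) F) :
    l1 j F ≤ embC s * ‖lift (s + j) F‖ := by
  have h1 : l1 j F = ∫ η, wt (-s) η * ‖(wt (s + j) η : ℂ) * F η‖ := by
    refine integral_congr_ae (Eventually.of_forall fun η => ?_)
    have := (wt_pos s η).ne'
    simp only [norm_wt_mul]
    rw [wt_add, wt_neg]
    field_simp
  have h2 := integral_mul_norm_le_Lp_mul_Lq (μ := volume) (f := wt (-s))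
    (g := fun η => ‖(wt (s + j) η : ℂ) * F η‖) Real.HolderConjugate.two_two
    (by simpa using memLp_wt_neg hs) (by simpa using MemLp.norm hF)
  rw [h1, lift, norm_toE hF, embC]
  have e1 := (memLp_wt_neg hs).eLpNorm_eq_integral_rpow_norm (by norm_num) (by norm_num)
  have e2 := hF.eLpNorm_eq_integral_rpow_norm (by norm_num) (by norm_num)
  rw [e1, e2, ENNReal.toReal_ofReal (by positivity), ENNReal.toReal_ofReal (by positivity)]
  simp only [norm_norm] at h2
  convert! h2 using 2
  · ext η; rw [Real.norm_of_nonneg (wt_nonneg _ η)]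
  · norm_num
  · norm_num

/-! ### Bilinear Fourier operators -/

/-- The bilinear Fourier operator with the kernel `k`. -/
def bil (k : ℝ → ℝ → ℂ) (F G : ℝ → ℂ) (ξ : ℝ) : ℂ := ∫ η, k (ξ - η) η * F (ξ - η) * G η

lemma lintegral_conv_comm (f g : ℝ → ℝ≥0∞) (ξ : ℝ) :
    ∫⁻ η, f (ξ - η) * g η = ∫⁻ η, g (ξ - η) * f η := by
  rw [← lintegral_sub_left_eq_self _ ξ]
  refine lintegral_congr fun η => ?_
  rw [sub_sub_cancel, mul_comm]

lemma eLpNorm_conv_le {f g : ℝ → ℝ≥0∞} (hf : AEMeasurable f) (hg : AEMeasurable g) :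
    eLpNorm (fun ξ : ℝ => ∫⁻ η, f (ξ - η) * g η) 2 volume ≤ (∫⁻ x, f x) * eLpNorm g 2 volume := by
  rw [eLpNorm_eq_lintegral_rpow_enorm_toReal (by norm_num) (by norm_num),
    eLpNorm_eq_lintegral_rpow_enorm_toReal (by norm_num) (by norm_num)]
  simp only [enorm_eq_self, ENNReal.toReal_ofNat, ENNReal.rpow_two]
  have h := ENNReal.rpow_le_rpow (lintegral_conv_sq_le hf hg) (z := 1 / 2) (by norm_num)
  rw [ENNReal.mul_rpow_of_nonneg _ _ (by norm_num)] at h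
  have e : ∀ a : ℝ≥0∞, (a ^ 2) ^ (1 / 2 : ℝ) = a := fun a => by
    rw [← ENNReal.rpow_two, ← ENNReal.rpow_mul]; norm_num
  rwa [e] at h

lemma aemeasurable_conv {f g : ℝ → ℝ≥0∞} (hf : AEMeasurable f) (hg : AEMeasurable g) :
    AEMeasurable (fun ξ : ℝ => ∫⁻ η, f (ξ - η) * g η) :=
  AEMeasurable.lintegral_prod_right' (f := fun z : ℝ × ℝ => f (z.1 - z.2) * g z.2)
    ((hf.comp_quasiMeasurePreserving
      (quasiMeasurePreserving_sub_of_right_invariant volume volume)).mul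
      (hg.comp_quasiMeasurePreserving Measure.quasiMeasurePreserving_snd))

section Bound

variable {k : ℝ → ℝ → ℂ} (hk : Measurable (Function.uncurry k)) {F G : ℝ → ℂ}
  (hF : AEStronglyMeasurable F volume) (hG : AEStronglyMeasurable G volume)

include hk hF hG in
lemma aesm_bil_integrand : AEStronglyMeasurable
    (fun z : ℝ × ℝ => k (z.1 - z.2) z.2 * F (z.1 - z.2) * G z.2) (volume.prod volume) := by
  refine AEStronglyMeasurable.mul (AEStronglyMeasurable.mul ?_ ?_) ?_
  · exact (hk.comp (by fun_prop : Measurable fun z : ℝ × ℝ =>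
      (z.1 - z.2, z.2))).aestronglyMeasurable
  · exact hF.comp_quasiMeasurePreserving
      (quasiMeasurePreserving_sub_of_right_invariant volume volume)
  · exact hG.comp_quasiMeasurePreserving Measure.quasiMeasurePreserving_snd

include hk hF hG in
lemma aesm_bil : AEStronglyMeasurable (bil k F G) volume :=
  (aesm_bil_integrand hk hF hG).integral_prod_right'

/-- The conclusion of Young's inequality for the operator with the kernel `k`. -/
structure BilBound (k : ℝ → ℝ → ℂ) (τ : ℝ) (F G : ℝ → ℂ) (N : ℝ) : Prop where
  mem : InH τ (bil k F G)
  norm_le : ‖lift τ (bil k F G)‖ ≤ N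
  integrable : ∀ᵐ ξ, Integrable fun η => k (ξ - η) η * F (ξ - η) * G η

include hk hF hG in
-- Domination by two product functions reduces the operator to two ordinary convolutions, each with
-- one factor in `L¹` and the other in `L²`.
lemma bilBound_aux {τ : ℝ} {F₁ G₁ F₂ G₂ : ℝ → ℝ}
    (hF₁ : Integrable F₁) (hG₁ : MemLp G₁ 2 volume) (hF₂ : MemLp F₂ 2 volume)
    (hG₂ : Integrable G₂)
    (h : ∀ x y, ‖k x y‖ * wt τ (x + y) * (‖F x‖ * ‖G y‖) ≤ ‖F₁ x‖ * ‖G₁ y‖ + ‖F₂ x‖ * ‖G₂ y‖) :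
    BilBound k τ F G ((∫ x, ‖F₁ x‖) * (eLpNorm G₁ 2 volume).toReal +
      (eLpNorm F₂ 2 volume).toReal * ∫ x, ‖G₂ x‖) := by
  set a₁ : ℝ → ℝ≥0∞ := fun ξ => ∫⁻ η, ‖F₁ (ξ - η)‖ₑ * ‖G₁ η‖ₑ with ha₁
  set a₂ : ℝ → ℝ≥0∞ := fun ξ => ∫⁻ η, ‖F₂ (ξ - η)‖ₑ * ‖G₂ η‖ₑ with ha₂
  have m₁ : AEMeasurable a₁ := aemeasurable_conv hF₁.1.enorm hG₁.1.enorm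
  have m₂ : AEMeasurable a₂ := aemeasurable_conv hF₂.1.enorm hG₂.1.enorm
  have n₁ : eLpNorm a₁ 2 volume ≤ (∫⁻ x, ‖F₁ x‖ₑ) * eLpNorm G₁ 2 volume := by
    have := eLpNorm_conv_le hF₁.1.enorm hG₁.1.enorm
    rwa [eLpNorm_enorm] at this
  have n₂ : eLpNorm a₂ 2 volume ≤ eLpNorm F₂ 2 volume * ∫⁻ x, ‖G₂ x‖ₑ := by
    have := eLpNorm_conv_le hG₂.1.enorm hF₂.1.enorm
    rw [eLpNorm_enorm] at this
    rw [mul_comm]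
    convert! this using 2
    ext ξ
    exact lintegral_conv_comm (fun x => ‖F₂ x‖ₑ) (fun x => ‖G₂ x‖ₑ) ξ
  have bd₁ : (∫⁻ x, ‖F₁ x‖ₑ) * eLpNorm G₁ 2 volume < ∞ := ENNReal.mul_lt_top hF₁.2 hG₁.2
  have bd₂ : eLpNorm F₂ 2 volume * ∫⁻ x, ‖G₂ x‖ₑ < ∞ := ENNReal.mul_lt_top hF₂.2 hG₂.2
  have hpt : ∀ x y, ‖k x y * F x * G y‖ₑ * ‖wt τ (x + y)‖ₑ ≤
      ‖F₁ x‖ₑ * ‖G₁ y‖ₑ + ‖F₂ x‖ₑ * ‖G₂ y‖ₑ := fun x y => by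
    simp only [← ofReal_norm, ← ENNReal.ofReal_mul (norm_nonneg _)]
    rw [← ENNReal.ofReal_add (by positivity) (by positivity)]
    refine ENNReal.ofReal_le_ofReal (le_trans (le_of_eq ?_) (h x y))
    rw [norm_mul, norm_mul, Real.norm_of_nonneg (wt_nonneg _ _)]; ring
  have hint : ∀ ξ, (∫⁻ η, ‖k (ξ - η) η * F (ξ - η) * G η‖ₑ) * ‖wt τ ξ‖ₑ ≤ a₁ ξ + a₂ ξ :=
      fun ξ => by
    rw [← lintegral_mul_const' _ _ enorm_ne_top]
    have hm : AEMeasurable fun η => ‖F₁ (ξ - η)‖ₑ * ‖G₁ η‖ₑ :=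
      (hF₁.1.enorm.comp_quasiMeasurePreserving (quasiMeasurePreserving_sub_left volume ξ)).mul
        hG₁.1.enorm
    rw [ha₁, ha₂]
    dsimp only
    rw [← lintegral_add_left' hm]
    refine lintegral_mono fun η => ?_
    have := hpt (ξ - η) η
    rwa [sub_add_cancel] at this
  have hle : ∀ ξ, ‖(wt τ ξ : ℂ) * bil k F G ξ‖ₑ ≤ ‖(a₁ + a₂) ξ‖ₑ := fun ξ => by
    rw [enorm_mul, mul_comm, enorm_eq_self, Pi.add_apply]
    refine le_trans ?_ (hint ξ)
    have : ‖(wt τ ξ : ℂ)‖ₑ = ‖wt τ ξ‖ₑ := by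
      rw [← ofReal_norm, ← ofReal_norm, Complex.norm_real]
    rw [this]
    gcongr
    exact enorm_integral_le_lintegral_enorm _
  have hno : eLpNorm (fun ξ => (wt τ ξ : ℂ) * bil k F G ξ) 2 volume ≤
      (∫⁻ x, ‖F₁ x‖ₑ) * eLpNorm G₁ 2 volume + eLpNorm F₂ 2 volume * ∫⁻ x, ‖G₂ x‖ₑ :=
    (eLpNorm_mono_enorm hle).trans ((eLpNorm_add_le m₁.aestronglyMeasurable
      m₂.aestronglyMeasurable (by norm_num)).trans (add_le_add n₁ n₂))
  have hmem : InH τ (bil k F G) := ⟨aesm_wt_mul τ (aesm_bil hk hF hG),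
    hno.trans_lt (ENNReal.add_lt_top.2 ⟨bd₁, bd₂⟩)⟩
  refine ⟨hmem, ?_, ?_⟩
  · rw [lift, norm_toE hmem]
    refine (ENNReal.toReal_mono (ENNReal.add_lt_top.2 ⟨bd₁, bd₂⟩).ne hno).trans ?_
    rw [ENNReal.toReal_add bd₁.ne bd₂.ne, ENNReal.toReal_mul, ENNReal.toReal_mul,
      integral_norm_eq_lintegral_enorm hF₁.1, integral_norm_eq_lintegral_enorm hG₂.1]
  -- The majorant is in `L²`, hence finite almost everywhere, and the weight does not vanish; so the
  -- integrand is integrable at almost every `ξ`.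
  · have fin : ∀ᵐ ξ, a₁ ξ + a₂ ξ < ∞ := by
      have h1 : ∫⁻ ξ, ‖(a₁ + a₂) ξ‖ₑ ^ (2 : ℝ) < ∞ := by
        have := (eLpNorm_add_le m₁.aestronglyMeasurable m₂.aestronglyMeasurable
          (p := 2) (μ := volume) (by norm_num)).trans_lt
          ((add_le_add n₁ n₂).trans_lt (ENNReal.add_lt_top.2 ⟨bd₁, bd₂⟩))
        exact (eLpNorm_lt_top_iff_lintegral_rpow_enorm_lt_top (by norm_num) (by norm_num)).1 this
      filter_upwards [ae_lt_top' ((m₁.add m₂).enorm.pow_const _) h1.ne] with ξ hξ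
      rw [enorm_eq_self] at hξ
      by_contra hcon
      rw [not_lt, top_le_iff] at hcon
      rw [Pi.add_apply, hcon] at hξ
      simp at hξ
    have hsm := AEStronglyMeasurable.prodMk_left (aesm_bil_integrand hk hF hG)
    filter_upwards [fin, hsm] with ξ h1 h2
    refine ⟨h2, ?_⟩
    have h3 := (hint ξ).trans_lt h1
    by_contra hcon
    rw [HasFiniteIntegral, not_lt, top_le_iff] at hcon
    rw [hcon, ENNReal.top_mul] at h3
    · exact lt_irrefl _ h3
    · simpa using (wt_pos τ ξ).ne'

end Bound

lemma eLpNorm_wt_norm {σ : ℝ} {F : ℝ → ℂ} (hF : InH σ F) :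
    (eLpNorm (fun x => wt σ x * ‖F x‖) 2 volume).toReal = ‖lift σ F‖ := by
  rw [lift, norm_toE hF, ← eLpNorm_norm fun η => (wt σ η : ℂ) * F η]
  simp only [norm_wt_mul]

lemma InH.memLp_wt_norm {σ : ℝ} {F : ℝ → ℂ} (hF : InH σ F) :
    MemLp (fun x => wt σ x * ‖F x‖) 2 volume := by
  simpa only [norm_wt_mul] using MemLp.norm hF

/-- `F` is the Fourier transform of a function with integrable derivative of order `j`. -/
def InL1 (j : ℝ) (F : ℝ → ℂ) : Prop := Integrable fun η => (wt j η : ℂ) * F η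

lemma InL1.integrable_norm {j : ℝ} {F : ℝ → ℂ} (hF : InL1 j F) :
    Integrable fun x => wt j x * ‖F x‖ := by
  simpa only [norm_wt_mul] using Integrable.norm hF

lemma InH.inL1 {s j : ℝ} (hs : 1 / 2 < s) {F : ℝ → ℂ} (hF : InH (s + j) F) : InL1 j F :=
  hF.integrable hs

lemma norm_wt_norm (j x : ℝ) (z : ℂ) : ‖wt j x * ‖z‖‖ = wt j x * ‖z‖ :=
  Real.norm_of_nonneg (mul_nonneg (wt_nonneg _ _) (norm_nonneg _))

/-- Young's inequality for kernels of tame growth. -/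
lemma bilBound {k : ℝ → ℝ → ℂ} (hk : Measurable (Function.uncurry k)) {F G : ℝ → ℂ}
    {τ j σ A : ℝ} (hA : 0 ≤ A)
    (h : ∀ x y, ‖k x y‖ * wt τ (x + y) ≤ A * (wt j x * wt σ y + wt σ x * wt j y))
    (hF : InH σ F) (hG : InH σ G) (hF₁ : InL1 j F) (hG₁ : InL1 j G) :
    BilBound k τ F G (A * (l1 j F * ‖lift σ G‖ + ‖lift σ F‖ * l1 j G)) := by
  have := bilBound_aux hk hF.aesm hG.aesm (τ := τ)
    (hF₁.integrable_norm.const_mul A) hG.memLp_wt_norm hF.memLp_wt_norm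
    (hG₁.integrable_norm.const_mul A) (fun x y => by
      simp only [norm_mul, norm_norm, Real.norm_of_nonneg hA, Real.norm_of_nonneg (wt_nonneg _ _)]
      calc _ ≤ A * (wt j x * wt σ y + wt σ x * wt j y) * (‖F x‖ * ‖G y‖) := by
            exact mul_le_mul_of_nonneg_right (h x y) (by positivity)
        _ = _ := by ring)
  refine ⟨this.mem, this.norm_le.trans_eq ?_, this.integrable⟩
  rw [eLpNorm_wt_norm hF, eLpNorm_wt_norm hG]
  simp only [norm_mul A, Real.norm_of_nonneg hA, norm_wt_norm, integral_const_mul, l1]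
  ring

/-- Young's inequality for kernels bounded by a function of the first variable. -/
lemma bilBound_left {k : ℝ → ℝ → ℂ} (hk : Measurable (Function.uncurry k)) {F G : ℝ → ℂ}
    {τ j σ A : ℝ} (hA : 0 ≤ A) (h : ∀ x y, ‖k x y‖ * wt τ (x + y) ≤ A * (wt j x * wt σ y))
    (hF₁ : InL1 j F) (hG : InH σ G) (hF : AEStronglyMeasurable F volume) :
    BilBound k τ F G (A * (l1 j F * ‖lift σ G‖)) := by
  have := bilBound_aux hk hF hG.aesm (τ := τ) (F₂ := 0) (G₂ := 0)
    (hF₁.integrable_norm.const_mul A) hG.memLp_wt_norm MemLp.zero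
    (integrable_zero _ _ _) (fun x y => by
      simp only [norm_mul, norm_norm, Real.norm_of_nonneg hA, Real.norm_of_nonneg (wt_nonneg _ _)]
      calc _ ≤ A * (wt j x * wt σ y) * (‖F x‖ * ‖G y‖) := by
            exact mul_le_mul_of_nonneg_right (h x y) (by positivity)
        _ ≤ _ := by simp; linarith)
  refine ⟨this.mem, this.norm_le.trans_eq ?_, this.integrable⟩
  rw [eLpNorm_wt_norm hG]
  simp only [norm_mul A, Real.norm_of_nonneg hA, norm_wt_norm, integral_const_mul, l1]
  simp
  ring

lemma bil_comm {k : ℝ → ℝ → ℂ} (hk : ∀ x y, k x y = k y x) (F G : ℝ → ℂ) :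
    bil k F G = bil k G F := by
  ext ξ
  rw [bil, bil, ← integral_sub_left_eq_self _ volume ξ]
  refine integral_congr_ae (Eventually.of_forall fun η => ?_)
  dsimp only
  rw [sub_sub_cancel, hk]; ring

lemma bil_congr {k : ℝ → ℝ → ℂ} {F F' G G' : ℝ → ℂ} (hF : F =ᵐ[volume] F')
    (hG : G =ᵐ[volume] G') : bil k F G = bil k F' G' := by
  ext ξ
  refine integral_congr_ae ?_
  filter_upwards [hG, (quasiMeasurePreserving_sub_left volume ξ).ae hF] with η h1 h2
  rw [h1, h2]

/-- The mixed terms cancel by symmetry of the kernel. All Lipschitz and stability estimates for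
quadratic terms come from this factorization. -/
lemma bil_sub_bil {k : ℝ → ℝ → ℂ} (hk : ∀ x y, k x y = k y x) {F G : ℝ → ℂ}
    (h₁ : ∀ᵐ ξ, Integrable fun η => k (ξ - η) η * F (ξ - η) * F η)
    (h₂ : ∀ᵐ ξ, Integrable fun η => k (ξ - η) η * F (ξ - η) * G η)
    (h₃ : ∀ᵐ ξ, Integrable fun η => k (ξ - η) η * G (ξ - η) * F η)
    (h₄ : ∀ᵐ ξ, Integrable fun η => k (ξ - η) η * G (ξ - η) * G η) :
    (fun ξ => bil k F F ξ - bil k G G ξ) =ᵐ[volume]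
      bil k (fun η => F η + G η) (fun η => F η - G η) := by
  filter_upwards [h₁, h₂, h₃, h₄] with ξ i₁ i₂ i₃ i₄
  have e : bil k F G ξ = bil k G F ξ := by rw [bil_comm hk]
  have : bil k (fun η => F η + G η) (fun η => F η - G η) ξ =
      bil k F F ξ - bil k F G ξ + bil k G F ξ - bil k G G ξ := by
    simp only [bil]
    rw [← integral_sub i₁ i₂]
    have e₁ := integral_add (i₁.sub i₂) i₃
    have e₂ := integral_sub ((i₁.sub i₂).add i₃) i₄
    simp only [Pi.add_apply, Pi.sub_apply] at e₁ e₂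
    rw [← e₁, ← e₂]
    refine integral_congr_ae (Eventually.of_forall fun η => ?_)
    ring
  rw [this, e]; ring

/-! ### Trilinear forms -/

/-- A pair `(x, y)` stands for the point `(x, y, z)` of the plane `x + y + z = 0`; this map
exchanges `y` and `z`. -/
lemma measurePreserving_reflect :
    MeasurePreserving (fun z : ℝ × ℝ => (z.1, -z.1 - z.2)) (volume.prod volume)
      (volume.prod volume) :=
  (MeasurePreserving.id volume).skew_product (g := fun x y : ℝ => -x - y)
    (by fun_prop : Measurable fun z : ℝ × ℝ => -z.1 - z.2)
    (Eventually.of_forall fun x => Measure.map_sub_left_eq_self volume (-x))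

/-- The cyclic permutation `(x, y, z) ↦ (y, z, x)` of the plane `x + y + z = 0`. -/
lemma measurePreserving_rotate :
    MeasurePreserving (fun z : ℝ × ℝ => (z.2, -z.1 - z.2)) (volume.prod volume)
      (volume.prod volume) := by
  have h := measurePreserving_reflect.comp
    (Measure.measurePreserving_swap (μ := (volume : Measure ℝ)) (ν := (volume : Measure ℝ)))
  convert! h using 1
  ext z <;> simp only [Function.comp_apply, Prod.fst_swap, Prod.snd_swap]
  ring

lemma integral_comp_measurePreserving {f : ℝ × ℝ → ℝ × ℝ}
    (hf : MeasurePreserving f (volume.prod volume) (volume.prod volume)) {Φ : ℝ × ℝ → ℂ}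
    (hΦ : Integrable Φ (volume.prod volume)) :
    ∫ z, Φ (f z) ∂(volume.prod volume) = ∫ z, Φ z ∂(volume.prod volume) := by
  rw [← integral_map hf.measurable.aemeasurable (by rw [hf.map_eq]; exact hΦ.1), hf.map_eq]

lemma integral_comp_measurePreserving_real {f : ℝ × ℝ → ℝ × ℝ}
    (hf : MeasurePreserving f (volume.prod volume) (volume.prod volume)) {Φ : ℝ × ℝ → ℝ}
    (hΦ : Integrable Φ (volume.prod volume)) :
    ∫ z, Φ (f z) ∂(volume.prod volume) = ∫ z, Φ z ∂(volume.prod volume) := by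
  rw [← integral_map hf.measurable.aemeasurable (by rw [hf.map_eq]; exact hΦ.1), hf.map_eq]

lemma quasiMeasurePreserving_add' :
    Measure.QuasiMeasurePreserving (fun z : ℝ × ℝ => z.1 + z.2) (volume.prod volume) volume :=
  Measure.quasiMeasurePreserving_snd.comp
    (measurePreserving_prod_add (volume : Measure ℝ) volume).quasiMeasurePreserving

/-- Cauchy-Schwarz in the second variable for each value of the first, with a bound that does not
depend on that value. -/
lemma tri_lintegral_le {f g h : ℝ → ℝ≥0∞} (hf : AEMeasurable f) (hg : AEMeasurable g)
    (hh : AEMeasurable h) :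
    ∫⁻ z : ℝ × ℝ, f z.1 * (g z.2 * h (z.1 + z.2)) ∂(volume.prod volume) ≤
      (∫⁻ x, f x) * ((∫⁻ x, g x ^ 2) ^ (1 / 2 : ℝ) * (∫⁻ x, h x ^ 2) ^ (1 / 2 : ℝ)) := by
  have m1 : AEMeasurable (fun z : ℝ × ℝ => f z.1) (volume.prod volume) :=
    hf.comp_quasiMeasurePreserving Measure.quasiMeasurePreserving_fst
  have m2 : AEMeasurable (fun z : ℝ × ℝ => g z.2) (volume.prod volume) :=
    hg.comp_quasiMeasurePreserving Measure.quasiMeasurePreserving_snd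
  have m3 : AEMeasurable (fun z : ℝ × ℝ => h (z.1 + z.2)) (volume.prod volume) :=
    hh.comp_quasiMeasurePreserving quasiMeasurePreserving_add'
  have key : ∀ x, ∫⁻ y, g y * h (x + y) ≤
      (∫⁻ x, g x ^ 2) ^ (1 / 2 : ℝ) * (∫⁻ x, h x ^ 2) ^ (1 / 2 : ℝ) := fun x => by
    have mh : AEMeasurable fun y => h (x + y) :=
      hh.comp_quasiMeasurePreserving (measurePreserving_add_left volume x).quasiMeasurePreserving
    have h1 := ENNReal.lintegral_mul_le_Lp_mul_Lq volume Real.HolderConjugate.two_two hg mh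
    simp only [ENNReal.rpow_two] at h1
    refine h1.trans (le_of_eq ?_)
    congr 2
    exact lintegral_add_left_eq_self (fun y => h y ^ 2) x
  rw [lintegral_prod (fun z : ℝ × ℝ => f z.1 * (g z.2 * h (z.1 + z.2))) (m1.mul (m2.mul m3))]
  calc _ ≤ ∫⁻ x, f x * ((∫⁻ x, g x ^ 2) ^ (1 / 2 : ℝ) * (∫⁻ x, h x ^ 2) ^ (1 / 2 : ℝ)) := by
        refine lintegral_mono fun x => ?_
        have mh : AEMeasurable fun y => h (x + y) :=
          hh.comp_quasiMeasurePreserving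
            (measurePreserving_add_left volume x).quasiMeasurePreserving
        refine (lintegral_const_mul'' (f x) (hg.mul mh)).le.trans ?_
        gcongr
        exact key x
    _ = _ := lintegral_mul_const'' _ hf

lemma eLpNorm_two_eq (g : ℝ → ℝ) :
    eLpNorm g 2 volume = (∫⁻ x, ‖g x‖ₑ ^ 2) ^ (1 / 2 : ℝ) := by
  rw [eLpNorm_eq_lintegral_rpow_enorm_toReal (by norm_num) (by norm_num)]
  simp only [ENNReal.toReal_ofNat, ENNReal.rpow_two]

lemma tri_integrable {f g h : ℝ → ℝ} (hf : Integrable f) (hg : MemLp g 2 volume)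
    (hh : MemLp h 2 volume) :
    Integrable (fun z : ℝ × ℝ => f z.1 * (g z.2 * h (z.1 + z.2))) (volume.prod volume) ∧
    ∫ z : ℝ × ℝ, ‖f z.1 * (g z.2 * h (z.1 + z.2))‖ ∂(volume.prod volume) ≤
      (∫ x, ‖f x‖) * ((eLpNorm g 2 volume).toReal * (eLpNorm h 2 volume).toReal) := by
  have meas : AEStronglyMeasurable (fun z : ℝ × ℝ => f z.1 * (g z.2 * h (z.1 + z.2)))
      (volume.prod volume) :=
    (hf.1.comp_quasiMeasurePreserving Measure.quasiMeasurePreserving_fst).mul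
      ((hg.1.comp_quasiMeasurePreserving Measure.quasiMeasurePreserving_snd).mul
      (hh.1.comp_quasiMeasurePreserving quasiMeasurePreserving_add'))
  have key := tri_lintegral_le hf.1.enorm hg.1.enorm hh.1.enorm
  rw [← eLpNorm_two_eq, ← eLpNorm_two_eq] at key
  simp only [← enorm_mul] at key
  have fin : (∫⁻ x, ‖f x‖ₑ) * (eLpNorm g 2 volume * eLpNorm h 2 volume) < ∞ :=
    ENNReal.mul_lt_top hf.2 (ENNReal.mul_lt_top hg.2 hh.2)
  refine ⟨⟨meas, key.trans_lt fin⟩, ?_⟩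
  rw [integral_norm_eq_lintegral_enorm meas, integral_norm_eq_lintegral_enorm hf.1,
    ← ENNReal.toReal_mul, ← ENNReal.toReal_mul]
  exact ENNReal.toReal_mono fin.ne key

/-- The trilinear majorant with weights of order `j, σ, τ`. -/
def triMaj (j σ τ : ℝ) (F G H : ℝ → ℂ) (z : ℝ × ℝ) : ℝ :=
  (wt j z.1 * ‖F z.1‖) * ((wt σ z.2 * ‖G z.2‖) * (wt τ (z.1 + z.2) * ‖H (z.1 + z.2)‖))

lemma triMaj_nonneg (j σ τ : ℝ) (F G H : ℝ → ℂ) (z : ℝ × ℝ) : 0 ≤ triMaj j σ τ F G H z := by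
  have := wt_nonneg
  unfold triMaj
  have := this j z.1; have := wt_nonneg σ z.2; have := wt_nonneg τ (z.1 + z.2)
  positivity

lemma triMaj_integrable {j σ τ : ℝ} {F G H : ℝ → ℂ} (hF : InL1 j F) (hG : InH σ G)
    (hH : InH τ H) : Integrable (triMaj j σ τ F G H) (volume.prod volume) :=
  (tri_integrable hF.integrable_norm hG.memLp_wt_norm hH.memLp_wt_norm).1

lemma integral_triMaj_le {j σ τ : ℝ} {F G H : ℝ → ℂ} (hF : InL1 j F) (hG : InH σ G)
    (hH : InH τ H) : ∫ z, triMaj j σ τ F G H z ∂(volume.prod volume) ≤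
      l1 j F * (‖lift σ G‖ * ‖lift τ H‖) := by
  have h := (tri_integrable hF.integrable_norm hG.memLp_wt_norm hH.memLp_wt_norm).2
  rw [eLpNorm_wt_norm hG, eLpNorm_wt_norm hH] at h
  simp only [norm_wt_norm] at h
  refine le_trans (le_of_eq (integral_congr_ae (Eventually.of_forall fun z => ?_))) h
  exact (Real.norm_of_nonneg (triMaj_nonneg j σ τ F G H z)).symm

lemma aesm_tri {F G H : ℝ → ℂ} (hF : AEStronglyMeasurable F volume)
    (hG : AEStronglyMeasurable G volume) (hH : AEStronglyMeasurable H volume) :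
    AEStronglyMeasurable (fun z : ℝ × ℝ => F z.1 * G z.2 * H (z.1 + z.2))
      (volume.prod volume) :=
  ((hF.comp_quasiMeasurePreserving Measure.quasiMeasurePreserving_fst).mul
    (hG.comp_quasiMeasurePreserving Measure.quasiMeasurePreserving_snd)).mul
    (hH.comp_quasiMeasurePreserving quasiMeasurePreserving_add')

/-- `F` is the Fourier transform of a real function. -/
def Herm (F : ℝ → ℂ) : Prop := ∀ η, F (-η) = starRingEnd ℂ (F η)

lemma Herm.norm {F : ℝ → ℂ} (h : Herm F) (η : ℝ) : ‖F (-η)‖ = ‖F η‖ := by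
  rw [h, RCLike.norm_conj]

/-- The substitution `x = ξ - η`, `y = η` brings the inner product into a form in which the
symmetries of the three frequencies `x`, `y`, `-x - y` can be used. -/
lemma inner_lift_bil {k : ℝ → ℝ → ℂ} {τ : ℝ} {F G H : ℝ → ℂ} (hH : InH τ H)
    (hB : InH τ (bil k F G))
    (hint : Integrable (fun z : ℝ × ℝ => ((wt τ (z.1 + z.2) ^ 2 : ℝ) : ℂ) * k z.1 z.2 *
      (F z.1 * G z.2 * starRingEnd ℂ (H (z.1 + z.2)))) (volume.prod volume)) :
    inner ℂ (lift τ H) (lift τ (bil k F G)) =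
      ∫ z : ℝ × ℝ, ((wt τ (z.1 + z.2) ^ 2 : ℝ) : ℂ) * k z.1 z.2 *
        (F z.1 * G z.2 * starRingEnd ℂ (H (z.1 + z.2))) ∂(volume.prod volume) := by
  have hmp : MeasurePreserving (fun z : ℝ × ℝ => (z.1 - z.2, z.2)) (volume.prod volume)
      (volume.prod volume) := measurePreserving_sub_prod volume volume
  have hint' := (hmp.integrable_comp hint.1).2 hint
  simp only [Function.comp_def] at hint'
  rw [← integral_comp_measurePreserving hmp hint, integral_prod _ hint', L2.inner_def]
  refine integral_congr_ae ?_
  filter_upwards [coeFn_lift hH, coeFn_lift hB] with ξ h1 h2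
  rw [h1, h2, RCLike.inner_apply, bil, map_mul, Complex.conj_ofReal]
  rw [mul_right_comm, ← integral_const_mul]
  refine integral_congr_ae (Eventually.of_forall fun η => ?_)
  simp only [sub_add_cancel]
  push_cast
  ring

/-! ### The symbols of the Camassa-Holm equation -/

/-- The dispersion relation of the linear Camassa-Holm equation. -/
def chOm (δ ξ : ℝ) : ℝ := ξ * (1 + 3 / 4 * δ ^ 2 * ξ ^ 2) / (1 + 5 / 4 * δ ^ 2 * ξ ^ 2)

/-- The symbol of the quadratic term in `w_x`. -/
def chLo (δ ξ : ℝ) : ℝ := 3 / 4 * δ ^ 2 * ξ / (1 + 5 / 4 * δ ^ 2 * ξ ^ 2)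

lemma ch_den_pos (δ ξ : ℝ) : 0 < 1 + 5 / 4 * δ ^ 2 * ξ ^ 2 := by positivity

@[fun_prop] lemma continuous_chOm (δ : ℝ) : Continuous (chOm δ) :=
  Continuous.div (by fun_prop) (by fun_prop) fun ξ => (ch_den_pos δ ξ).ne'

@[fun_prop] lemma continuous_chLo (δ : ℝ) : Continuous (chLo δ) :=
  Continuous.div (by fun_prop) (by fun_prop) fun ξ => (ch_den_pos δ ξ).ne'

lemma chOm_neg (δ ξ : ℝ) : chOm δ (-ξ) = -chOm δ ξ := by simp [chOm, neg_div]

lemma chLo_neg (δ ξ : ℝ) : chLo δ (-ξ) = -chLo δ ξ := by simp [chLo, neg_div]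

lemma abs_chOm_le (δ ξ : ℝ) : |chOm δ ξ| ≤ |ξ| := by
  rw [chOm, abs_div, abs_mul, div_le_iff₀ (abs_pos.2 (ch_den_pos δ ξ).ne')]
  refine mul_le_mul_of_nonneg_left ?_ (abs_nonneg _)
  rw [abs_of_pos (ch_den_pos δ ξ), abs_of_pos (by positivity)]
  nlinarith [mul_nonneg (sq_nonneg δ) (sq_nonneg ξ)]

lemma abs_chLo_le {δ : ℝ} (h0 : 0 ≤ δ) (h1 : δ ≤ 1) (ξ : ℝ) : |chLo δ ξ| ≤ 1 := by
  have hd : δ ^ 2 ≤ 1 := pow_le_one₀ h0 h1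
  rw [chLo, abs_div, abs_of_pos (ch_den_pos δ ξ), div_le_one (ch_den_pos δ ξ), abs_mul,
    abs_of_nonneg (by positivity : (0 : ℝ) ≤ 3 / 4 * δ ^ 2)]
  nlinarith [mul_nonneg (sq_nonneg δ) (sq_nonneg (|ξ| - 1)), sq_abs ξ,
    mul_nonneg (sq_nonneg δ) (sq_nonneg ξ)]

/-- The factor `δ²ξ²` is absorbed by the denominator: `chLo` gains one derivative, uniformly in `δ`.
-/
lemma abs_chLo_mul_le (δ ξ : ℝ) : |chLo δ ξ| * |ξ| ≤ 1 := by
  rw [← abs_mul, chLo, div_mul_eq_mul_div, abs_div, abs_of_pos (ch_den_pos δ ξ),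
    div_le_one (ch_den_pos δ ξ),
    abs_of_nonneg (by nlinarith [mul_nonneg (sq_nonneg δ) (sq_nonneg ξ)])]
  nlinarith [mul_nonneg (sq_nonneg δ) (sq_nonneg ξ)]

/-- With `q = δ²ξ²` the derivative is `(1 + q + 15/16 q²) / (1 + 5/4 q)²`, which lies in `[0, 1]`.
This makes the commutator estimates uniform in `δ`. -/
lemma hasDerivAt_chOm (δ ξ : ℝ) : ∃ d, HasDerivAt (chOm δ) d ξ ∧ |d| ≤ 1 := by
  have hn : HasDerivAt (fun x : ℝ => x * (1 + 3 / 4 * δ ^ 2 * x ^ 2))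
      (1 * (1 + 3 / 4 * δ ^ 2 * ξ ^ 2) + ξ * (3 / 4 * δ ^ 2 * (2 * ξ))) ξ := by
    have h2 : HasDerivAt (fun x : ℝ => 1 + 3 / 4 * δ ^ 2 * x ^ 2) (3 / 4 * δ ^ 2 * (2 * ξ)) ξ := by
      have := (((hasDerivAt_id ξ).pow 2).const_mul (3 / 4 * δ ^ 2)).const_add 1
      simpa using this
    exact (hasDerivAt_id ξ).mul h2
  have hd : HasDerivAt (fun x : ℝ => 1 + 5 / 4 * δ ^ 2 * x ^ 2) (5 / 4 * δ ^ 2 * (2 * ξ)) ξ := by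
    have := (((hasDerivAt_id ξ).pow 2).const_mul (5 / 4 * δ ^ 2)).const_add 1
    simpa using this
  refine ⟨_, hn.div hd (ch_den_pos δ ξ).ne', ?_⟩
  have hp := ch_den_pos δ ξ
  have hq : 0 ≤ δ ^ 2 * ξ ^ 2 := by positivity
  rw [abs_div, abs_of_pos (by positivity : 0 < (1 + 5 / 4 * δ ^ 2 * ξ ^ 2) ^ 2),
    div_le_one (by positivity), abs_le]
  constructor <;> nlinarith [mul_nonneg hq hq]

lemma abs_chOm_sub_le (δ a b : ℝ) : |chOm δ a - chOm δ b| ≤ |a - b| := by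
  choose d hd hd1 using hasDerivAt_chOm δ
  have := Convex.norm_image_sub_le_of_norm_hasDerivWithin_le (f := chOm δ) (f' := d) (C := 1)
    (s := univ) (x := b) (y := a) (fun x _ => (hd x).hasDerivWithinAt) (fun x _ => hd1 x)
    convex_univ (mem_univ _) (mem_univ _)
  simpa using this

/-- The symbol of the energy form. -/
def chH (δ σ ξ : ℝ) : ℝ := chOm δ ξ * (1 + ξ ^ 2) ^ σ

lemma chH_neg (δ σ ξ : ℝ) : chH δ σ (-ξ) = -chH δ σ ξ := by simp [chH, chOm_neg]

lemma hasDerivAt_chH {σ : ℝ} (hσ : 0 ≤ σ) (δ ξ : ℝ) :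
    ∃ d, HasDerivAt (chH δ σ) d ξ ∧ |d| ≤ (1 + 2 * σ) * (1 + ξ ^ 2) ^ σ := by
  obtain ⟨d, hd, hd1⟩ := hasDerivAt_chOm δ ξ
  have hj : 0 < 1 + ξ ^ 2 := by positivity
  have h2 : HasDerivAt (fun x : ℝ => (1 + x ^ 2) ^ σ) (2 * ξ * σ * (1 + ξ ^ 2) ^ (σ - 1)) ξ := by
    have := (((hasDerivAt_id ξ).pow 2).const_add 1).rpow_const (p := σ) (Or.inl hj.ne')
    simpa using this
  refine ⟨_, hd.mul h2, ?_⟩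
  have hp : 0 < (1 + ξ ^ 2) ^ (σ - 1) := Real.rpow_pos_of_pos hj _
  have e : (1 + ξ ^ 2) ^ σ = (1 + ξ ^ 2) ^ (σ - 1) * (1 + ξ ^ 2) := by
    rw [Real.rpow_sub_one hj.ne']; field_simp
  calc _ ≤ |d| * (1 + ξ ^ 2) ^ σ + |chOm δ ξ| * (2 * |ξ| * σ * (1 + ξ ^ 2) ^ (σ - 1)) := by
        refine (abs_add_le _ _).trans (le_of_eq ?_)
        rw [abs_mul, abs_mul, abs_of_pos (Real.rpow_pos_of_pos hj _), abs_mul, abs_of_pos hp,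
          abs_mul, abs_mul, abs_of_nonneg hσ, abs_two]
    _ ≤ 1 * (1 + ξ ^ 2) ^ σ + |ξ| * (2 * |ξ| * σ * (1 + ξ ^ 2) ^ (σ - 1)) := by
        exact add_le_add (mul_le_mul_of_nonneg_right hd1 (Real.rpow_pos_of_pos hj _).le)
          (mul_le_mul_of_nonneg_right (abs_chOm_le δ ξ) (by positivity))
    _ ≤ _ := by
        rw [e]
        have : |ξ| * |ξ| ≤ 1 + ξ ^ 2 := by rw [← sq, sq_abs]; linarith
        have h3 : |ξ| * |ξ| * (σ * (1 + ξ ^ 2) ^ (σ - 1)) ≤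
            (1 + ξ ^ 2) * (σ * (1 + ξ ^ 2) ^ (σ - 1)) :=
          mul_le_mul_of_nonneg_right this (by positivity)
        nlinarith

/-- `M` stands for the larger of two frequencies that are comparable up to a factor `2`; half of the
power is charged to each of them. -/
lemma rpow_jap_le {σ M a b : ℝ} (hσ : 0 ≤ σ) (hM : M ^ 2 ≤ 4 * a ^ 2 ∧ M ^ 2 ≤ b ^ 2 ∨
    M ^ 2 ≤ 4 * b ^ 2 ∧ M ^ 2 ≤ a ^ 2) :
    (1 + M ^ 2) ^ σ ≤ 2 ^ σ * ((1 + a ^ 2) ^ (σ / 2) * (1 + b ^ 2) ^ (σ / 2)) := by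
  have hj : ∀ x : ℝ, 0 < 1 + x ^ 2 := fun x => by positivity
  have e : (1 + M ^ 2) ^ σ = (1 + M ^ 2) ^ (σ / 2) * (1 + M ^ 2) ^ (σ / 2) := by
    rw [← Real.rpow_add (hj M)]; congr 1; ring
  have four : ∀ x : ℝ, M ^ 2 ≤ 4 * x ^ 2 →
      (1 + M ^ 2) ^ (σ / 2) ≤ 2 ^ σ * (1 + x ^ 2) ^ (σ / 2) := fun x hx => by
    calc (1 + M ^ 2) ^ (σ / 2) ≤ (2 ^ 2 * (1 + x ^ 2)) ^ (σ / 2) :=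
          Real.rpow_le_rpow (hj M).le (by linarith) (by linarith)
      _ = _ := by
        rw [Real.mul_rpow (by positivity) (hj x).le, ← Real.rpow_natCast 2 2,
          ← Real.rpow_mul zero_le_two]
        congr 2; push_cast; ring
  have one : ∀ x : ℝ, M ^ 2 ≤ x ^ 2 → (1 + M ^ 2) ^ (σ / 2) ≤ (1 + x ^ 2) ^ (σ / 2) := fun x hx =>
    Real.rpow_le_rpow (hj M).le (by linarith) (by linarith)
  have pos : ∀ x : ℝ, 0 ≤ (1 + x ^ 2) ^ (σ / 2) := fun x => (Real.rpow_pos_of_pos (hj x) _).le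
  have p2 : (0 : ℝ) ≤ 2 ^ σ := by positivity
  rw [e]
  rcases hM with ⟨h1, h2⟩ | ⟨h1, h2⟩
  · calc _ ≤ (2 ^ σ * (1 + a ^ 2) ^ (σ / 2)) * (1 + b ^ 2) ^ (σ / 2) :=
        mul_le_mul (four a h1) (one b h2) (pos M) (mul_nonneg p2 (pos a))
      _ = _ := by ring
  · calc _ ≤ (2 ^ σ * (1 + b ^ 2) ^ (σ / 2)) * (1 + a ^ 2) ^ (σ / 2) :=
        mul_le_mul (four b h1) (one a h2) (pos M) (mul_nonneg p2 (pos b))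
      _ = _ := by ring

/-- As `chH` is odd, its values at `a` and `b` add up to a difference of values at `a` and `-b`, two
points at distance `|c|`. The mean value theorem thus moves one derivative from the high frequencies
to the lowest one, as integration by parts does. -/
lemma abs_chH_sum_le_aux {σ : ℝ} (hσ : 0 ≤ σ) (δ : ℝ) {a b c : ℝ} (h : a + b + c = 0)
    (ha : |c| ≤ |a|) (hb : |c| ≤ |b|) : |chH δ σ a + chH δ σ b + chH δ σ c| ≤
      ((1 + 2 * σ) * 2 ^ σ + 1) * (|c| * ((1 + a ^ 2) ^ (σ / 2) * (1 + b ^ 2) ^ (σ / 2))) := by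
  set M := max |a| |b| with hM
  have hM0 : 0 ≤ M := (abs_nonneg a).trans (le_max_left _ _)
  choose d hd hd1 using hasDerivAt_chH hσ δ
  have hj : ∀ x : ℝ, 0 < 1 + x ^ 2 := fun x => by positivity
  have mvt := Convex.norm_image_sub_le_of_norm_hasDerivWithin_le (f := chH δ σ) (f' := d)
    (C := (1 + 2 * σ) * (1 + M ^ 2) ^ σ) (s := Icc (-M) M) (x := -b) (y := a)
    (fun x _ => (hd x).hasDerivWithinAt) (fun x hx => (hd1 x).trans (by
      have : x ^ 2 ≤ M ^ 2 := sq_le_sq' hx.1 hx.2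
      gcongr)) (convex_Icc _ _)
    ⟨by linarith [le_abs_self b, le_max_right |a| |b|],
      by linarith [neg_abs_le b, le_max_right |a| |b|]⟩
    ⟨by linarith [neg_abs_le a, le_max_left |a| |b|], by linarith [le_abs_self a, le_max_left |a| |b|]⟩
  rw [chH_neg, sub_neg_eq_add, sub_neg_eq_add, Real.norm_eq_abs, Real.norm_eq_abs,
    show a + b = -c by linarith, abs_neg] at mvt
  have hMab : (1 + M ^ 2) ^ σ ≤ 2 ^ σ * ((1 + a ^ 2) ^ (σ / 2) * (1 + b ^ 2) ^ (σ / 2)) := by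
    refine rpow_jap_le hσ ?_
    -- The sum vanishes and `c` is the smallest of the three, so `a` and `b` are comparable.
    have hab : |a| ≤ 2 * |b| := by
      have : |a| ≤ |b| + |c| := by rw [show a = -(b + c) by linarith, abs_neg]; exact abs_add_le _ _
      linarith
    have hba : |b| ≤ 2 * |a| := by
      have : |b| ≤ |a| + |c| := by rw [show b = -(a + c) by linarith, abs_neg]; exact abs_add_le _ _
      linarith
    rcases le_total |a| |b| with h' | h'
    · left
      rw [hM, max_eq_right h', sq_abs]
      exact ⟨by nlinarith [abs_nonneg b, abs_nonneg a, sq_abs a, sq_abs b], le_rfl⟩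
    · right
      rw [hM, max_eq_left h', sq_abs]
      exact ⟨by nlinarith [abs_nonneg b, abs_nonneg a, sq_abs a, sq_abs b], le_rfl⟩
  have hc : |chH δ σ c| ≤ |c| * ((1 + a ^ 2) ^ (σ / 2) * (1 + b ^ 2) ^ (σ / 2)) := by
    rw [chH, abs_mul, abs_of_pos (Real.rpow_pos_of_pos (hj c) _)]
    refine mul_le_mul (abs_chOm_le δ c) ?_ (Real.rpow_pos_of_pos (hj c) _).le (abs_nonneg _)
    have e : (1 + c ^ 2) ^ σ = (1 + c ^ 2) ^ (σ / 2) * (1 + c ^ 2) ^ (σ / 2) := by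
      rw [← Real.rpow_add (hj c)]; congr 1; ring
    rw [e]
    have ha' : c ^ 2 ≤ a ^ 2 := sq_le_sq.2 ha
    have hb' : c ^ 2 ≤ b ^ 2 := sq_le_sq.2 hb
    gcongr
  calc _ ≤ |chH δ σ a + chH δ σ b| + |chH δ σ c| := abs_add_le _ _
    _ ≤ (1 + 2 * σ) * (2 ^ σ * ((1 + a ^ 2) ^ (σ / 2) * (1 + b ^ 2) ^ (σ / 2))) * |c| +
        |c| * ((1 + a ^ 2) ^ (σ / 2) * (1 + b ^ 2) ^ (σ / 2)) := by
        refine add_le_add (mvt.trans ?_) hc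
        gcongr
    _ = _ := by ring

/-- The constant in `abs_chH_sum_le`. -/
def chHC (σ : ℝ) : ℝ := (1 + 2 * σ) * 2 ^ σ + 1

lemma chHC_nonneg {σ : ℝ} (hσ : 0 ≤ σ) : 0 ≤ chHC σ := by unfold chHC; positivity

/-- Whichever frequency is smallest takes the role of `c` in `abs_chH_sum_le_aux`; each case
produces one of the three cyclic terms. -/
lemma abs_chH_sum_le {σ : ℝ} (hσ : 0 ≤ σ) (δ : ℝ) {x y z : ℝ} (h : x + y + z = 0) :
    |chH δ σ (freq x) + chH δ σ (freq y) + chH δ σ (freq z)| ≤ chHC σ *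
      (wt 1 x * (wt σ y * wt σ z) + wt 1 y * (wt σ z * wt σ x) + wt 1 z * (wt σ x * wt σ y)) := by
  have h' : freq x + freq y + freq z = 0 := by
    rw [← freq_add, ← freq_add, h]; simp [freq]
  have hw := fun x => wt_nonneg σ x
  have hC := chHC_nonneg hσ
  have p1 : 0 ≤ wt 1 x * (wt σ y * wt σ z) :=
    mul_nonneg (wt_nonneg _ _) (mul_nonneg (hw _) (hw _))
  have p2 : 0 ≤ wt 1 y * (wt σ z * wt σ x) :=
    mul_nonneg (wt_nonneg _ _) (mul_nonneg (hw _) (hw _))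
  have p3 : 0 ≤ wt 1 z * (wt σ x * wt σ y) :=
    mul_nonneg (wt_nonneg _ _) (mul_nonneg (hw _) (hw _))
  have q : ∀ x y z : ℝ, |freq z| * (wt σ x * wt σ y) ≤ wt 1 z * (wt σ x * wt σ y) := fun x y z =>
    mul_le_mul_of_nonneg_right (abs_freq_le z) (mul_nonneg (hw _) (hw _))
  by_cases hz : |freq z| ≤ |freq x| ∧ |freq z| ≤ |freq y|
  · refine (abs_chH_sum_le_aux hσ δ h' hz.1 hz.2).trans ?_
    exact mul_le_mul_of_nonneg_left ((q x y z).trans (by linarith)) hC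
  by_cases hx : |freq x| ≤ |freq y| ∧ |freq x| ≤ |freq z|
  · have := abs_chH_sum_le_aux hσ δ (a := freq y) (b := freq z) (c := freq x) (by linarith)
      hx.1 hx.2
    rw [show chH δ σ (freq x) + chH δ σ (freq y) + chH δ σ (freq z) =
      chH δ σ (freq y) + chH δ σ (freq z) + chH δ σ (freq x) by ring]
    exact this.trans (mul_le_mul_of_nonneg_left ((q y z x).trans (by linarith)) hC)
  · have hy1 : |freq y| ≤ |freq z| := by
      by_contra hcon; push Not at hcon hx hz
      by_cases h1 : |freq z| ≤ |freq x|
      · linarith [hz h1]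
      · push Not at h1; linarith [hx (h1.le.trans hcon.le)]
    have hy2 : |freq y| ≤ |freq x| := by
      by_contra hcon; push Not at hcon hx hz
      linarith [hx hcon.le]
    have := abs_chH_sum_le_aux hσ δ (a := freq z) (b := freq x) (c := freq y) (by linarith)
      hy1 hy2
    rw [show chH δ σ (freq x) + chH δ σ (freq y) + chH δ σ (freq z) =
      chH δ σ (freq z) + chH δ σ (freq x) + chH δ σ (freq y) by ring]
    exact this.trans (mul_le_mul_of_nonneg_left ((q z x y).trans (by linarith)) hC)

/-! ### The quadratic term of the Camassa-Holm equation -/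

/-- The kernel of the quadratic term of the Camassa-Holm equation. -/
def chKer (δ x y : ℝ) : ℂ := Complex.I *
  ((1 / 2 * (chOm δ (freq (x + y)) - chLo δ (freq (x + y)) * freq x * freq y) : ℝ) : ℂ)

/-- The restriction of a kernel to output frequencies in `[-n, n]`. -/
def trunc (n : ℝ) (k : ℝ → ℝ → ℂ) (x y : ℝ) : ℂ := if |x + y| ≤ n then k x y else 0

lemma continuous_chKer (δ : ℝ) : Continuous (Function.uncurry (chKer δ)) := by
  unfold chKer Function.uncurry
  fun_prop

lemma measurable_chKer (δ : ℝ) : Measurable (Function.uncurry (chKer δ)) :=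
  (continuous_chKer δ).measurable

lemma measurable_trunc {k : ℝ → ℝ → ℂ} (hk : Measurable (Function.uncurry k)) (n : ℝ) :
    Measurable (Function.uncurry (trunc n k)) := by
  refine Measurable.ite ?_ hk measurable_const
  exact measurableSet_le (by fun_prop) measurable_const

lemma chKer_symm (δ x y : ℝ) : chKer δ x y = chKer δ y x := by
  rw [chKer, chKer, add_comm x y]; ring_nf

lemma trunc_symm {k : ℝ → ℝ → ℂ} (hk : ∀ x y, k x y = k y x) (n x y : ℝ) :
    trunc n k x y = trunc n k y x := by
  rw [trunc, trunc, add_comm x y, hk]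

lemma norm_chKer (δ x y : ℝ) : ‖chKer δ x y‖ =
    1 / 2 * |chOm δ (freq (x + y)) - chLo δ (freq (x + y)) * freq x * freq y| := by
  rw [chKer, norm_mul, Complex.norm_I, one_mul, Complex.norm_real, Real.norm_eq_abs, abs_mul,
    abs_of_pos (by norm_num)]

lemma norm_trunc_le (n : ℝ) (k : ℝ → ℝ → ℂ) (x y : ℝ) : ‖trunc n k x y‖ ≤ ‖k x y‖ := by
  rw [trunc]; split_ifs <;> simp

lemma norm_chKer_le {δ : ℝ} (h0 : 0 ≤ δ) (h1 : δ ≤ 1) (x y : ℝ) :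
    ‖chKer δ x y‖ ≤ 2 * (wt 1 x * wt 1 y) := by
  rw [norm_chKer]
  have hx := abs_freq_le x
  have hy := abs_freq_le y
  have ox := one_le_wt zero_le_one x
  have oy := one_le_wt zero_le_one y
  have e1 : |chOm δ (freq (x + y))| ≤ wt 1 x + wt 1 y := by
    refine (abs_chOm_le _ _).trans ?_
    rw [freq_add]
    exact (abs_add_le _ _).trans (add_le_add hx hy)
  have e2 : |chLo δ (freq (x + y)) * freq x * freq y| ≤ wt 1 x * wt 1 y := by
    rw [abs_mul, abs_mul]
    calc _ ≤ 1 * wt 1 x * wt 1 y := by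
          gcongr
          exact abs_chLo_le h0 h1 _
      _ = _ := by ring
  have := abs_sub (chOm δ (freq (x + y))) (chLo δ (freq (x + y)) * freq x * freq y)
  nlinarith

/-- The quadratic term costs one derivative, uniformly in `δ`, and only one of the factors carries
the high weight. -/
lemma chKer_loss {δ τ : ℝ} (h0 : 0 ≤ δ) (h1 : δ ≤ 1) (hτ : 0 ≤ τ) (x y : ℝ) :
    ‖chKer δ x y‖ * wt τ (x + y) ≤
      2 * 2 ^ τ * (wt 1 x * wt (τ + 1) y + wt (τ + 1) x * wt 1 y) := by
  have := wt_nonneg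
  calc _ ≤ 2 * (wt 1 x * wt 1 y) * (2 ^ τ * (wt τ x + wt τ y)) :=
        mul_le_mul (norm_chKer_le h0 h1 x y) (wt_add_arg_le hτ x y) (wt_nonneg _ _)
          (mul_nonneg zero_le_two (mul_nonneg (wt_nonneg _ _) (wt_nonneg _ _)))
    _ = _ := by rw [wt_add τ 1 x, wt_add τ 1 y]; ring

/-- On the band the output weight is at most `wt σ n`, so no derivative is lost and the truncated
equation is an ordinary differential equation. The growth in `n` affects its Lipschitz constant but
not the energy bounds. -/
lemma trunc_chKer_bdd {δ σ n : ℝ} (h0 : 0 ≤ δ) (h1 : δ ≤ 1) (hσ : 1 ≤ σ) (x y : ℝ) :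
    ‖trunc n (chKer δ) x y‖ * wt σ (x + y) ≤
      2 * wt σ n * (wt 1 x * wt σ y + wt σ x * wt 1 y) := by
  have hx := wt_nonneg 1 x
  have hx' := wt_nonneg σ x
  have hy := wt_nonneg 1 y
  have hy' := wt_nonneg σ y
  have hn := wt_nonneg σ n
  rw [trunc]
  split_ifs with h
  · have hw : wt σ (x + y) ≤ wt σ n := by
      refine Real.rpow_le_rpow (jap_pos _).le ?_ (by linarith)
      have : freq (x + y) ^ 2 ≤ freq n ^ 2 := by
        refine sq_le_sq.2 ?_
        simp only [freq, abs_mul]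
        exact mul_le_mul_of_nonneg_left (h.trans (le_abs_self n)) (by positivity)
      linarith
    calc _ ≤ 2 * (wt 1 x * wt 1 y) * wt σ n :=
          mul_le_mul (norm_chKer_le h0 h1 x y) hw (wt_nonneg _ _) (by positivity)
      _ ≤ 2 * (wt 1 x * wt σ y) * wt σ n := by gcongr; exact wt_mono hσ y
      _ ≤ _ := by nlinarith [mul_nonneg hn (mul_nonneg hx' hy)]
  · rw [norm_zero, zero_mul]; positivity

/-- One of the `σ` derivatives on the output is absorbed by `chLo`; the other `σ - 1` are
distributed over the two factors, which carry one derivative each already. -/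
lemma chLo_weight_le {δ σ : ℝ} (h0 : 0 ≤ δ) (h1 : δ ≤ 1) (hσ : 1 ≤ σ) (x y : ℝ) :
    |chLo δ (freq (x + y))| * wt σ (x + y) * (|freq x| * |freq y|) ≤
      2 ^ σ * (wt 1 x * wt σ y + wt σ x * wt 1 y) := by
  have hx := wt_nonneg 1 x
  have hy := wt_nonneg 1 y
  have e1 : |chLo δ (freq (x + y))| * wt 1 (x + y) ≤ 2 := by
    have h2 : wt 1 (x + y) ≤ 1 + |freq (x + y)| := by
      refine abs_le_of_sq_le_sq' ?_ (by positivity) |>.2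
      rw [wt_one_sq]; nlinarith [sq_abs (freq (x + y)), abs_nonneg (freq (x + y))]
    calc _ ≤ |chLo δ (freq (x + y))| * (1 + |freq (x + y)|) := by gcongr
      _ ≤ 2 := by
        linarith [abs_chLo_le h0 h1 (freq (x + y)), abs_chLo_mul_le δ (freq (x + y))]
  have e2 : wt σ (x + y) = wt 1 (x + y) * wt (σ - 1) (x + y) := by
    rw [← wt_add]; congr 1; ring
  have e3 := wt_add_arg_le (σ := σ - 1) (by linarith) x y
  have e4 : (2 : ℝ) ^ σ = 2 * 2 ^ (σ - 1) := by
    rw [Real.rpow_sub_one (by norm_num)]; ring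
  calc _ = (|chLo δ (freq (x + y))| * wt 1 (x + y)) * wt (σ - 1) (x + y) *
        (|freq x| * |freq y|) := by rw [e2]; ring
    _ ≤ 2 * (2 ^ (σ - 1) * (wt (σ - 1) x + wt (σ - 1) y)) * (wt 1 x * wt 1 y) := by
        have := wt_nonneg (σ - 1) (x + y)
        have := wt_nonneg (σ - 1) x
        have := wt_nonneg (σ - 1) y
        gcongr
        · exact abs_freq_le x
        · exact abs_freq_le y
    _ = 2 ^ σ * (wt 1 x * (wt (σ - 1) y * wt 1 y) + (wt (σ - 1) x * wt 1 x) * wt 1 y) := by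
        rw [e4]; ring
    _ = _ := by rw [← wt_add, ← wt_add, sub_add_cancel]

/-- The constant of the energy estimate. -/
def chEnC (σ : ℝ) : ℝ := chHC σ + 2 ^ σ

/-- The weights of different orders are comparable on a band. This gives convergence of the
trilinear integrals before their symmetrization. -/
lemma InH.of_supp {σ τ n : ℝ} {F : ℝ → ℂ} (hF : InH σ F) (hs : ∀ η, n < |η| → F η = 0) :
    InH τ F := by
  refine hF.of_le (C := wt |τ - σ| n) hF.aesm (Eventually.of_forall fun η => ?_)
  by_cases h : n < |η|
  · simp [hs η h]
  · push Not at h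
    have e : wt τ η = wt (τ - σ) η * wt σ η := by rw [← wt_add]; congr 1; ring
    have h1 : wt (τ - σ) η ≤ wt |τ - σ| n := by
      refine (wt_mono (le_abs_self _) η).trans
        (Real.rpow_le_rpow (jap_pos _).le ?_ (by positivity))
      have : freq η ^ 2 ≤ freq n ^ 2 := by
        refine sq_le_sq.2 ?_
        simp only [freq, abs_mul]
        exact mul_le_mul_of_nonneg_left (h.trans (le_abs_self n)) (by positivity)
      linarith
    rw [e, mul_assoc]
    exact mul_le_mul_of_nonneg_right h1 (mul_nonneg (wt_nonneg _ _) (norm_nonneg _))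

/-! ### Energy estimates by symmetrization of trilinear forms -/

section Energy

variable {σ δ n : ℝ} {F : ℝ → ℂ}

lemma norm_chH_mul_le (δ : ℝ) (x : ℝ) (z : ℂ) :
    ‖(chH δ σ (freq x) : ℂ) * z‖ ≤ wt (2 * σ + 1) x * ‖z‖ := by
  rw [norm_mul, Complex.norm_real, Real.norm_eq_abs]
  refine mul_le_mul_of_nonneg_right ?_ (norm_nonneg _)
  rw [chH, abs_mul, abs_of_pos (Real.rpow_pos_of_pos (jap_pos x) _), wt_add,
    show wt (2 * σ) x = (1 + freq x ^ 2) ^ σ by rw [wt]; congr 1; ring, mul_comm]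
  exact mul_le_mul_of_nonneg_left ((abs_chOm_le _ _).trans (abs_freq_le x))
    (Real.rpow_pos_of_pos (jap_pos x) _).le

/-- The trilinear product on the plane `x + y + z = 0`. -/
def triProd (F : ℝ → ℂ) (z : ℝ × ℝ) : ℂ := F z.1 * F z.2 * F (-z.1 - z.2)

lemma aesm_triProd (hF : AEStronglyMeasurable F volume) (hH : Herm F) :
    AEStronglyMeasurable (triProd F) (volume.prod volume) := by
  refine (aesm_tri hF hF (Complex.continuous_conj.comp_aestronglyMeasurable hF)).congr
    (Eventually.of_forall fun z => ?_)
  simp only [triProd]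
  rw [show -z.1 - z.2 = -(z.1 + z.2) by ring, hH]

/-- The form of the transport term is bounded after symmetrization. -/
lemma norm_integral_chH_le (hσ : 0 ≤ σ) (hH : Herm F) (hF : InH σ F) (h1 : InL1 1 F)
    (hs : ∀ η, n < |η| → F η = 0) (h0 : InL1 0 F) :
    Integrable (fun z : ℝ × ℝ => (chH δ σ (freq (-z.1 - z.2)) : ℂ) * triProd F z)
      (volume.prod volume) ∧
    ‖∫ z : ℝ × ℝ, (chH δ σ (freq (-z.1 - z.2)) : ℂ) * triProd F z ∂(volume.prod volume)‖ ≤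
      chHC σ * (l1 1 F * (‖lift σ F‖ * ‖lift σ F‖)) := by
  set Θ : ℝ × ℝ → ℂ := fun z => (chH δ σ (freq (-z.1 - z.2)) : ℂ) * triProd F z with hΘ
  have cont : Continuous (chH δ σ) := by
    unfold chH
    exact (continuous_chOm δ).mul (Continuous.rpow_const (by fun_prop)
      fun x => Or.inl (by positivity))
  have meas : AEStronglyMeasurable Θ (volume.prod volume) := by
    refine AEStronglyMeasurable.mul ?_ (aesm_triProd hF.aesm hH)
    exact (by fun_prop : Continuous fun z : ℝ × ℝ =>
      (chH δ σ (freq (-z.1 - z.2)) : ℂ)).aestronglyMeasurable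
  -- Before symmetrization one factor carries `2σ + 1` derivatives. Only finiteness is taken from
  -- the band limitation here; the estimate below does not depend on `n`.
  have hint : Integrable Θ (volume.prod volume) := by
    refine (triMaj_integrable h0 (hF.of_supp (τ := 0) hs)
      (hF.of_supp (τ := 2 * σ + 1) hs)).mono' meas (Eventually.of_forall fun z => ?_)
    refine (norm_chH_mul_le δ (-z.1 - z.2) _).trans (le_of_eq ?_)
    rw [triProd, triMaj, norm_mul, norm_mul, wt_zero, wt_zero,
      show -z.1 - z.2 = -(z.1 + z.2) by ring, hH.norm, wt_neg_arg]
    ring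
  refine ⟨hint, ?_⟩
  set Ψ := triMaj 1 σ σ F F F with hΨ
  have hΨi : Integrable Ψ (volume.prod volume) := triMaj_integrable h1 hF hF
  -- The product of the three values of `F` is invariant under the rotation. So three times the
  -- integral has the sum of the three rotated symbols as its symbol, to which `abs_chH_sum_le`
  -- applies.
  set ρ : ℝ × ℝ → ℝ × ℝ := fun z => (z.2, -z.1 - z.2) with hρ
  have hmp : MeasurePreserving ρ (volume.prod volume) (volume.prod volume) :=
    measurePreserving_rotate
  have hmp2 := hmp.comp hmp
  have i1 := (hmp.integrable_comp hint.1).2 hint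
  have i2 := (hmp2.integrable_comp hint.1).2 hint
  have j1 := (hmp.integrable_comp hΨi.1).2 hΨi
  have j2 := (hmp2.integrable_comp hΨi.1).2 hΨi
  have e1 : ∫ z, (Θ ∘ ρ) z ∂(volume.prod volume) = ∫ z, Θ z ∂(volume.prod volume) :=
    integral_comp_measurePreserving hmp hint
  have e2 : ∫ z, (Θ ∘ (ρ ∘ ρ)) z ∂(volume.prod volume) = ∫ z, Θ z ∂(volume.prod volume) :=
    integral_comp_measurePreserving hmp2 hint
  have f1 : ∫ z, (Ψ ∘ ρ) z ∂(volume.prod volume) = ∫ z, Ψ z ∂(volume.prod volume) :=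
    integral_comp_measurePreserving_real hmp hΨi
  have f2 : ∫ z, (Ψ ∘ (ρ ∘ ρ)) z ∂(volume.prod volume) = ∫ z, Ψ z ∂(volume.prod volume) :=
    integral_comp_measurePreserving_real hmp2 hΨi
  have pt : ∀ z, ‖Θ z + (Θ ∘ ρ) z + (Θ ∘ (ρ ∘ ρ)) z‖ ≤
      chHC σ * (Ψ z + (Ψ ∘ ρ) z + (Ψ ∘ (ρ ∘ ρ)) z) := fun z => by
    obtain ⟨x, y⟩ := z
    have a1 : -y - (-x - y) = x := by ring
    have a2 : -(-x - y) - x = y := by ring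
    have a3 : y + (-x - y) = -x := by ring
    have a4 : -x - y + x = -y := by ring
    have a5 : F (x + y) = F (-(-x - y)) := by congr 1; ring
    have a6 : wt σ (x + y) = wt σ (-x - y) := by
      rw [show x + y = -(-x - y) by ring, wt_neg_arg]
    simp only [hΘ, hΨ, hρ, Function.comp_apply, triProd, triMaj, a1, a2, a3, a4, a5, a6,
      wt_neg_arg, hH.norm]
    have key := abs_chH_sum_le hσ δ (x := x) (y := y) (z := -x - y) (by ring)
    calc _ = |chH δ σ (freq x) + chH δ σ (freq y) + chH δ σ (freq (-x - y))| *
          (‖F x‖ * ‖F y‖ * ‖F (-x - y)‖) := by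
          rw [← norm_mul, ← norm_mul, ← Real.norm_eq_abs, ← Complex.norm_real, ← norm_mul]
          congr 1; push_cast; ring
      _ ≤ _ := mul_le_mul_of_nonneg_right key (by positivity)
      _ = _ := by ring
  have hsum : 3 * ∫ z, Θ z ∂(volume.prod volume) =
      ∫ z, (Θ z + (Θ ∘ ρ) z + (Θ ∘ (ρ ∘ ρ)) z) ∂(volume.prod volume) := by
    have h2 := integral_add (hint.add i1) i2
    have h1 := integral_add hint i1
    simp only [Pi.add_apply] at h1 h2
    rw [h2, h1, e1, e2]; ring
  have hsumΨ : ∫ z, chHC σ * (Ψ z + (Ψ ∘ ρ) z + (Ψ ∘ (ρ ∘ ρ)) z) ∂(volume.prod volume) =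
      chHC σ * (3 * ∫ z, Ψ z ∂(volume.prod volume)) := by
    have h2 := integral_add (hΨi.add j1) j2
    have h1 := integral_add hΨi j1
    simp only [Pi.add_apply] at h1 h2
    rw [integral_const_mul, h2, h1, f1, f2]; ring
  have hle : ‖3 * ∫ z, Θ z ∂(volume.prod volume)‖ ≤
      chHC σ * (3 * ∫ z, Ψ z ∂(volume.prod volume)) := by
    rw [hsum, ← hsumΨ]
    exact norm_integral_le_of_norm_le (((hΨi.add j1).add j2).const_mul _)
      (Eventually.of_forall pt)
  rw [norm_mul] at hle
  norm_num at hle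
  have := integral_triMaj_le h1 hF hF
  have hC := chHC_nonneg hσ
  nlinarith [mul_le_mul_of_nonneg_left this hC]

/-- The energy estimate for the truncated Camassa-Holm nonlinearity. -/
lemma energy_chKer (h0 : 0 ≤ δ) (hδ : δ ≤ 1) (hσ : 1 ≤ σ) (hH : Herm F) (hF : InH σ F)
    (h1 : InL1 1 F) (hs : ∀ η, n < |η| → F η = 0) :
    ‖inner ℂ (lift σ F) (lift σ (bil (trunc n (chKer δ)) F F))‖ ≤
      chEnC σ * (l1 1 F * (‖lift σ F‖ * ‖lift σ F‖)) := by
  have hL0 : InL1 0 F := by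
    refine h1.mono (aesm_wt_mul 0 hF.aesm) (Eventually.of_forall fun η => ?_)
    rw [norm_wt_mul, norm_wt_mul]
    exact mul_le_mul_of_nonneg_right (wt_mono zero_le_one η) (norm_nonneg _)
  obtain ⟨iΘ, bΘ⟩ := norm_integral_chH_le (δ := δ) (by linarith) hH hF h1 hs hL0
  -- The part with `chLo` is bounded directly by `chLo_weight_le`, without cancellation.
  set Λ : ℝ × ℝ → ℂ := fun z => ((wt σ (z.1 + z.2) ^ 2 *
    (chLo δ (freq (z.1 + z.2)) * freq z.1 * freq z.2) : ℝ) : ℂ) * triProd F z with hΛ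
  have mΛ : AEStronglyMeasurable Λ (volume.prod volume) := by
    refine AEStronglyMeasurable.mul ?_ (aesm_triProd hF.aesm hH)
    exact (by fun_prop : Continuous fun z : ℝ × ℝ => ((wt σ (z.1 + z.2) ^ 2 *
    (chLo δ (freq (z.1 + z.2)) * freq z.1 * freq z.2) : ℝ) : ℂ)).aestronglyMeasurable
  set Ψ := triMaj 1 σ σ F F F with hΨ
  have hΨi : Integrable Ψ (volume.prod volume) := triMaj_integrable h1 hF hF
  have hsw : MeasurePreserving (Prod.swap : ℝ × ℝ → ℝ × ℝ) (volume.prod volume)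
      (volume.prod volume) := Measure.measurePreserving_swap
  have j1 := (hsw.integrable_comp hΨi.1).2 hΨi
  have f1 : ∫ z, (Ψ ∘ Prod.swap) z ∂(volume.prod volume) = ∫ z, Ψ z ∂(volume.prod volume) :=
    integral_comp_measurePreserving_real hsw hΨi
  have pt : ∀ z, ‖Λ z‖ ≤ 2 ^ σ * (Ψ z + (Ψ ∘ Prod.swap) z) := fun z => by
    obtain ⟨x, y⟩ := z
    have a5 : F (-x - y) = F (-(x + y)) := by congr 1; ring
    simp only [hΛ, hΨ, Function.comp_apply, triProd, triMaj, a5, Prod.swap_prod_mk, norm_mul,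
      hH.norm, Complex.norm_real, Real.norm_eq_abs, add_comm y x, abs_pow,
      abs_of_nonneg (wt_nonneg _ _)]
    have key := chLo_weight_le h0 hδ hσ x y
    have hw := wt_nonneg σ (x + y)
    calc _ = (|chLo δ (freq (x + y))| * wt σ (x + y) * (|freq x| * |freq y|)) *
          (wt σ (x + y) * (‖F x‖ * ‖F y‖ * ‖F (x + y)‖)) := by ring
      _ ≤ _ := mul_le_mul_of_nonneg_right key (by positivity)
      _ = _ := by ring
  have iΛ : Integrable Λ (volume.prod volume) :=
    ((hΨi.add j1).const_mul (2 ^ σ)).mono' mΛ (Eventually.of_forall pt)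
  have bΛ : ‖∫ z, Λ z ∂(volume.prod volume)‖ ≤
      2 ^ σ * (2 * (l1 1 F * (‖lift σ F‖ * ‖lift σ F‖))) := by
    refine (norm_integral_le_of_norm_le ((hΨi.add j1).const_mul _)
      (Eventually.of_forall pt)).trans ?_
    have h1' := integral_add hΨi j1
    rw [integral_const_mul, Pi.add_def, h1', f1, ← two_mul]
    have := integral_triMaj_le h1 hF hF
    gcongr
  -- The truncation is invisible against `F`, which vanishes outside the band, and oddness moves the
  -- symbol to the third frequency.
  have hpt : ∀ z : ℝ × ℝ, ((wt σ (z.1 + z.2) ^ 2 : ℝ) : ℂ) * trunc n (chKer δ) z.1 z.2 *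
      (F z.1 * F z.2 * starRingEnd ℂ (F (z.1 + z.2))) =
      (-(Complex.I / 2)) * ((chH δ σ (freq (-z.1 - z.2)) : ℂ) * triProd F z + Λ z) := fun z => by
    obtain ⟨x, y⟩ := z
    have a5 : F (-x - y) = starRingEnd ℂ (F (x + y)) := by rw [← hH]; congr 1; ring
    have a7 : chH δ σ (freq (-x - y)) = -(chOm δ (freq (x + y)) * wt σ (x + y) ^ 2) := by
      rw [show -x - y = -(x + y) by ring, freq_neg, chH_neg, chH, wt_sq]
    simp only [hΛ, triProd, a5, a7]
    by_cases h : |x + y| ≤ n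
    · rw [trunc, if_pos h, chKer]
      push_cast; ring
    · rw [hs (x + y) (not_le.1 h)]; simp
  have hint : Integrable (fun z : ℝ × ℝ => ((wt σ (z.1 + z.2) ^ 2 : ℝ) : ℂ) *
      trunc n (chKer δ) z.1 z.2 * (F z.1 * F z.2 * starRingEnd ℂ (F (z.1 + z.2))))
      (volume.prod volume) := by
    simp only [hpt]
    exact (iΘ.add iΛ).const_mul _
  have hB := (bilBound (measurable_trunc (measurable_chKer δ) n)
    (mul_nonneg zero_le_two (wt_nonneg σ n)) (trunc_chKer_bdd h0 hδ hσ) hF hF h1 h1).mem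
  rw [inner_lift_bil hF hB hint]
  simp only [hpt]
  rw [integral_const_mul, norm_mul, integral_add iΘ iΛ]
  have hc : ‖-(Complex.I / 2)‖ = 1 / 2 := by simp
  rw [hc, chEnC]
  have h3 := norm_add_le (∫ z : ℝ × ℝ, (chH δ σ (freq (-z.1 - z.2)) : ℂ) * triProd F z
    ∂(volume.prod volume)) (∫ z, Λ z ∂(volume.prod volume))
  have hC := chHC_nonneg (σ := σ) (by linarith)
  have hX : 0 ≤ l1 1 F * (‖lift σ F‖ * ‖lift σ F‖) :=
    mul_nonneg (l1_nonneg _ _) (by positivity)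
  nlinarith [mul_nonneg hC hX]

end Energy

lemma InL1.mono {i j : ℝ} {F : ℝ → ℂ} (hF : InL1 j F) (hm : AEStronglyMeasurable F volume)
    (h : i ≤ j) : InL1 i F :=
  Integrable.mono hF (aesm_wt_mul i hm) (Eventually.of_forall fun η => by
    rw [norm_wt_mul, norm_wt_mul]
    exact mul_le_mul_of_nonneg_right (wt_mono h η) (norm_nonneg _))

/-- The `L²` estimate for the linearized Camassa-Holm nonlinearity. -/
lemma energy_chKer_diff {δ : ℝ} (h0 : 0 ≤ δ) (hδ : δ ≤ 1) {W Z : ℝ → ℂ}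
    (hZH : Herm Z) (hW : AEStronglyMeasurable W volume) (hW2 : InL1 2 W) (hZ : InH 1 Z) :
    InH 0 (bil (chKer δ) W Z) ∧
    ‖inner ℂ (lift 0 Z) (lift 0 (bil (chKer δ) W Z))‖ ≤
      2 * (l1 2 W * (‖lift 0 Z‖ * ‖lift 0 Z‖)) := by
  have hB := (bilBound_left (τ := 0) (j := 1) (σ := 1) (measurable_chKer δ) zero_le_two
    (fun x y => by simpa using norm_chKer_le h0 hδ x y) (hW2.mono hW (by norm_num)) hZ hW).mem
  refine ⟨hB, ?_⟩
  have hZ0 : InH 0 Z := hZ.mono zero_le_one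
  set Q : ℝ × ℝ → ℂ := fun z => W z.1 * Z z.2 * starRingEnd ℂ (Z (z.1 + z.2)) with hQ
  have mQ : AEStronglyMeasurable Q (volume.prod volume) :=
    aesm_tri hW hZ.aesm (Complex.continuous_conj.comp_aestronglyMeasurable hZ.aesm)
  set Θ : ℝ × ℝ → ℂ := fun z => (chOm δ (freq (z.1 + z.2)) : ℂ) * Q z with hΘ
  set Λ : ℝ × ℝ → ℂ :=
    fun z => ((chLo δ (freq (z.1 + z.2)) * freq z.1 * freq z.2 : ℝ) : ℂ) * Q z with hΛ
  have mΘ : AEStronglyMeasurable Θ (volume.prod volume) :=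
    (by fun_prop : Continuous fun z : ℝ × ℝ =>
      (chOm δ (freq (z.1 + z.2)) : ℂ)).aestronglyMeasurable.mul mQ
  have mΛ : AEStronglyMeasurable Λ (volume.prod volume) :=
    (by fun_prop : Continuous fun z : ℝ × ℝ => ((chLo δ (freq (z.1 + z.2)) * freq z.1 *
      freq z.2 : ℝ) : ℂ)).aestronglyMeasurable.mul mQ
  set Ψ := triMaj 2 0 0 W Z Z with hΨ
  have hΨi : Integrable Ψ (volume.prod volume) := triMaj_integrable hW2 hZ0 hZ0
  have iΘ : Integrable Θ (volume.prod volume) := by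
    refine (triMaj_integrable (hW2.mono hW zero_le_two) hZ0 hZ).mono' mΘ
      (Eventually.of_forall fun z => ?_)
    simp only [hΘ, hQ, triMaj, norm_mul, Complex.norm_real, Real.norm_eq_abs, RCLike.norm_conj,
      wt_zero, one_mul]
    have := (abs_chOm_le δ (freq (z.1 + z.2))).trans (abs_freq_le _)
    calc _ ≤ wt 1 (z.1 + z.2) * (‖W z.1‖ * ‖Z z.2‖ * ‖Z (z.1 + z.2)‖) := by gcongr
      _ = _ := by ring
  -- The reflection exchanges the two copies of `Z` and replaces the symbol at `x + y` by minus the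
  -- symbol at `y`. The resulting difference is bounded by `|freq x|`, so the derivative falls on
  -- `W`.
  set ρ : ℝ × ℝ → ℝ × ℝ := fun z => (z.1, -z.1 - z.2) with hρ
  have hmp : MeasurePreserving ρ (volume.prod volume) (volume.prod volume) :=
    measurePreserving_reflect
  have i1 := (hmp.integrable_comp iΘ.1).2 iΘ
  have e1 : ∫ z, (Θ ∘ ρ) z ∂(volume.prod volume) = ∫ z, Θ z ∂(volume.prod volume) :=
    integral_comp_measurePreserving hmp iΘ
  have ptΘ : ∀ z, ‖Θ z + (Θ ∘ ρ) z‖ ≤ Ψ z := fun z => by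
    obtain ⟨x, y⟩ := z
    have a1 : x + (-x - y) = -y := by ring
    have a2 : starRingEnd ℂ (Z (-y)) = Z y := by rw [hZH, Complex.conj_conj]
    have a3 : Z (-x - y) = starRingEnd ℂ (Z (x + y)) := by rw [← hZH]; congr 1; ring
    have e : Θ (x, y) + (Θ ∘ ρ) (x, y) =
        ((chOm δ (freq (x + y)) - chOm δ (freq y) : ℝ) : ℂ) * Q (x, y) := by
      simp only [hΘ, hQ, hρ, Function.comp_apply, a1, a2, a3, freq_neg, chOm_neg]
      push_cast; ring
    rw [e]
    simp only [hQ, hΨ, triMaj, norm_mul, Complex.norm_real, Real.norm_eq_abs, RCLike.norm_conj,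
      wt_zero, one_mul]
    have h1 : |chOm δ (freq (x + y)) - chOm δ (freq y)| ≤ wt 2 x := by
      refine (abs_chOm_sub_le _ _ _).trans ?_
      rw [freq_add, add_sub_cancel_right]
      exact (abs_freq_le x).trans (wt_mono one_le_two x)
    calc _ ≤ wt 2 x * (‖W x‖ * ‖Z y‖ * ‖Z (x + y)‖) := by gcongr
      _ = _ := by ring
  have ptΛ : ∀ z, ‖Λ z‖ ≤ 2 * Ψ z := fun z => by
    obtain ⟨x, y⟩ := z
    simp only [hΛ, hQ, hΨ, triMaj, norm_mul, Complex.norm_real, Real.norm_eq_abs,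
      RCLike.norm_conj, wt_zero, one_mul]
    -- The derivative on `Z` is moved either to the output, where `chLo` absorbs it, or to `W`;
    -- hence the order `2` on `W`.
    have h1 : |chLo δ (freq (x + y))| * |freq x| * |freq y| ≤ 2 * wt 2 x := by
      have h2 : |freq y| ≤ |freq (x + y)| + |freq x| := by
        rw [show freq y = freq (x + y) - freq x by rw [freq_add]; ring]
        exact abs_sub _ _
      have h3 := abs_chLo_le h0 hδ (freq (x + y))
      have h4 := abs_chLo_mul_le δ (freq (x + y))
      have h5 := abs_nonneg (freq x)
      have h6 := abs_nonneg (chLo δ (freq (x + y)))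
      rw [wt_two]
      calc _ ≤ |chLo δ (freq (x + y))| * |freq x| * (|freq (x + y)| + |freq x|) := by gcongr
        _ = (|chLo δ (freq (x + y))| * |freq (x + y)|) * |freq x| +
            |chLo δ (freq (x + y))| * (|freq x| * |freq x|) := by ring
        _ ≤ 1 * |freq x| + 1 * (|freq x| * |freq x|) := by gcongr
        _ ≤ _ := by nlinarith [sq_abs (freq x)]
    calc _ ≤ 2 * wt 2 x * (‖W x‖ * ‖Z y‖ * ‖Z (x + y)‖) := by gcongr
      _ = _ := by ring
  have iΛ : Integrable Λ (volume.prod volume) :=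
    (hΨi.const_mul 2).mono' mΛ (Eventually.of_forall ptΛ)
  have hΨle := integral_triMaj_le hW2 hZ0 hZ0
  have bΘ : ‖2 * ∫ z, Θ z ∂(volume.prod volume)‖ ≤ ∫ z, Ψ z ∂(volume.prod volume) := by
    have h1 := integral_add iΘ i1
    rw [e1, ← two_mul] at h1
    rw [← h1]
    exact norm_integral_le_of_norm_le hΨi (Eventually.of_forall ptΘ)
  have bΛ : ‖∫ z, Λ z ∂(volume.prod volume)‖ ≤ 2 * ∫ z, Ψ z ∂(volume.prod volume) := by
    rw [← integral_const_mul]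
    exact norm_integral_le_of_norm_le (hΨi.const_mul 2) (Eventually.of_forall ptΛ)
  have hpt : ∀ z : ℝ × ℝ, ((wt 0 (z.1 + z.2) ^ 2 : ℝ) : ℂ) * chKer δ z.1 z.2 *
      (W z.1 * Z z.2 * starRingEnd ℂ (Z (z.1 + z.2))) = (Complex.I / 2) * (Θ z - Λ z) := fun z => by
    simp only [hΘ, hΛ, hQ, wt_zero, chKer]
    push_cast; ring
  have hint : Integrable (fun z : ℝ × ℝ => ((wt 0 (z.1 + z.2) ^ 2 : ℝ) : ℂ) * chKer δ z.1 z.2 *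
      (W z.1 * Z z.2 * starRingEnd ℂ (Z (z.1 + z.2)))) (volume.prod volume) := by
    simp only [hpt]
    exact (iΘ.sub iΛ).const_mul _
  rw [inner_lift_bil hZ0 hB hint]
  simp only [hpt]
  rw [integral_const_mul, norm_mul, integral_sub iΘ iΛ]
  have hc : ‖Complex.I / 2‖ = 1 / 2 := by simp
  rw [norm_mul] at bΘ
  norm_num at bΘ
  have h3 := norm_sub_le (∫ z, Θ z ∂(volume.prod volume)) (∫ z, Λ z ∂(volume.prod volume))
  rw [hc]
  have hX : 0 ≤ ∫ z, Ψ z ∂(volume.prod volume) :=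
    integral_nonneg fun z => triMaj_nonneg _ _ _ _ _ _ _
  linarith

/-! ### Differential inequalities -/

section Gronwall

variable {H : Type*} [NormedAddCommGroup H] [InnerProductSpace ℝ H]

/-- From `e^x - 1 ≤ x e^x`. This form includes `K = 0`, where it gives linear growth. -/
lemma gronwallBound_le {b K a t : ℝ} (hK : 0 ≤ K) (ha : 0 ≤ a) :
    gronwallBound b K a t ≤ (b + a * t) * Real.exp (K * t) := by
  by_cases h : K = 0
  · simp [gronwallBound, h]
  · have hK' : 0 < K := lt_of_le_of_ne hK (Ne.symm h)
    rw [gronwallBound, if_neg h, add_mul]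
    have h1 : Real.exp (K * t) - 1 ≤ K * t * Real.exp (K * t) := by
      have := Real.add_one_le_exp (-(K * t))
      rw [Real.exp_neg] at this
      have hp := Real.exp_pos (K * t)
      have h2 : (-(K * t) + 1) * Real.exp (K * t) ≤ 1 := by
        calc _ ≤ (Real.exp (K * t))⁻¹ * Real.exp (K * t) := by gcongr
          _ = 1 := inv_mul_cancel₀ hp.ne'
      nlinarith
    calc _ ≤ b * Real.exp (K * t) + a / K * (K * t * Real.exp (K * t)) := by gcongr
      _ = _ := by field_simp

lemma HasDerivWithinAt.Ici_of_Icc {X : Type*} [NormedAddCommGroup X] [NormedSpace ℝ X]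
    {f : ℝ → X} {f' : X} {T t : ℝ} (h : HasDerivWithinAt f f' (Icc 0 T) t) (ht : t ∈ Ico 0 T) :
    HasDerivWithinAt f f' (Ici t) t :=
  h.mono_of_mem_nhdsWithin (Icc_mem_nhdsGE_of_mem ht)

/-- An energy inequality of the form `⟨f, f'⟩ ≤ K ‖f‖² + a ‖f‖` bounds the norm of `f`. -/
theorem norm_le_of_inner_deriv_le {f f' : ℝ → H} {T K a : ℝ} (hK : 0 ≤ K) (ha : 0 ≤ a)
    (hf : ∀ t ∈ Icc 0 T, HasDerivWithinAt f (f' t) (Icc 0 T) t)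
    (h : ∀ t ∈ Icc 0 T, inner ℝ (f t) (f' t) ≤ K * ‖f t‖ ^ 2 + a * ‖f t‖) :
    ∀ t ∈ Icc 0 T, ‖f t‖ ≤ (‖f 0‖ + a * t) * Real.exp (K * t) := by
  intro t ht
  have key : ∀ κ : ℝ, 0 < κ → ‖f t‖ ≤ (‖f 0‖ + κ + a * t) * Real.exp (K * t) := fun κ hκ => by
    -- The norm need not be differentiable at zeros of `f`; this regularization is, and `κ` tends to
    -- `0` at the end.
    set g : ℝ → ℝ := fun τ => Real.sqrt (‖f τ‖ ^ 2 + κ ^ 2) with hg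
    have pos : ∀ τ, 0 < ‖f τ‖ ^ 2 + κ ^ 2 := fun τ => by positivity
    have gpos : ∀ τ, 0 < g τ := fun τ => Real.sqrt_pos.2 (pos τ)
    have gsq : ∀ τ, g τ ^ 2 = ‖f τ‖ ^ 2 + κ ^ 2 := fun τ => Real.sq_sqrt (pos τ).le
    have fle : ∀ τ, ‖f τ‖ ≤ g τ := fun τ => Real.le_sqrt_of_sq_le (by nlinarith)
    have hder : ∀ τ ∈ Icc 0 T, HasDerivWithinAt g
        (2 * inner ℝ (f τ) (f' τ) / (2 * Real.sqrt (‖f τ‖ ^ 2 + κ ^ 2))) (Icc 0 T) τ :=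
      fun τ hτ => ((hf τ hτ).norm_sq.add_const (κ ^ 2)).sqrt (pos τ).ne'
    have hb := le_gronwallBound_of_liminf_deriv_right_le (f := g) (δ := ‖f 0‖ + κ) (K := K)
      (ε := a) (a := 0) (b := T) (fun τ hτ => (hder τ hτ).continuousWithinAt)
      (fun τ hτ r hr => HasDerivWithinAt.liminf_right_slope_le
        (HasDerivWithinAt.Ici_of_Icc (hder τ ⟨hτ.1, hτ.2.le⟩) hτ) hr)
      (Real.sqrt_le_iff.2 ⟨by positivity, by nlinarith [norm_nonneg (f 0)]⟩)
      (fun τ hτ => by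
        have h1 := h τ ⟨hτ.1, hτ.2.le⟩
        rw [mul_div_mul_left _ _ two_ne_zero, div_le_iff₀ (gpos τ)]
        have h2 := fle τ
        have h3 := gpos τ
        have h4 := gsq τ
        change _ ≤ (K * g τ + a) * g τ
        nlinarith [mul_le_mul_of_nonneg_left h2 ha, mul_nonneg hK (sq_nonneg κ)])
      t ht
    rw [sub_zero] at hb
    exact (fle t).trans (hb.trans (gronwallBound_le hK ha))
  have hlim : Tendsto (fun κ : ℝ => (‖f 0‖ + κ + a * t) * Real.exp (K * t)) (𝓝[>] 0)
      (𝓝 ((‖f 0‖ + 0 + a * t) * Real.exp (K * t))) :=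
    Tendsto.mono_left (Continuous.tendsto (by fun_prop) 0) nhdsWithin_le_nhds
  rw [add_zero] at hlim
  exact ge_of_tendsto hlim (by filter_upwards [self_mem_nhdsWithin] with κ hκ using key κ hκ)

end Gronwall

/-- The derivatives of a pointwise convergent sequence may be exchanged with the limit if they
converge uniformly. -/
theorem hasDerivWithinAt_of_uniform {X : Type*} [NormedAddCommGroup X] [NormedSpace ℝ X]
    {T : ℝ} {f f' : ℕ → ℝ → X} {F G : ℝ → X}
    (hf : ∀ n, ∀ t ∈ Icc 0 T, HasDerivWithinAt (f n) (f' n t) (Icc 0 T) t)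
    (hF : ∀ t ∈ Icc 0 T, Tendsto (fun n => f n t) atTop (𝓝 (F t)))
    (hG : TendstoUniformlyOn f' G atTop (Icc 0 T)) :
    ∀ t ∈ Icc 0 T, HasDerivWithinAt F (G t) (Icc 0 T) t := by
  intro t ht
  rw [hasDerivWithinAt_iff_isLittleO, Asymptotics.isLittleO_iff]
  intro c hc
  have hc4 : 0 < c / 4 := by positivity
  obtain ⟨n, hn⟩ := eventually_atTop.1 (Metric.tendstoUniformlyOn_iff.1 hG (c / 4) hc4)
  have hG' : ∀ m ≥ n, ∀ x ∈ Icc 0 T, ‖f' m x - G x‖ ≤ c / 4 := fun m hm x hx => by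
    rw [← dist_eq_norm, dist_comm]; exact (hn m hm x hx).le
  -- The mean value inequality for `f n - f m`, followed by the limit in `m`, so that `F` itself
  -- need not be differentiable yet.
  have lip : ∀ τ ∈ Icc 0 T, ‖(f n τ - F τ) - (f n t - F t)‖ ≤ (c / 4 + c / 4) * ‖τ - t‖ := by
    intro τ hτ
    have h1 : ∀ m ≥ n, ‖(f n τ - f m τ) - (f n t - f m t)‖ ≤ (c / 4 + c / 4) * ‖τ - t‖ :=
      fun m hm => Convex.norm_image_sub_le_of_norm_hasDerivWithin_le
        (f := fun x => f n x - f m x) (f' := fun x => f' n x - f' m x)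
        (fun x hx => (hf n x hx).sub (hf m x hx)) (fun x hx => by
          calc ‖f' n x - f' m x‖ = ‖(f' n x - G x) - (f' m x - G x)‖ := by congr 1; abel
            _ ≤ _ := (norm_sub_le _ _).trans (add_le_add (hG' n le_rfl x hx) (hG' m hm x hx)))
        (convex_Icc 0 T) ht hτ
    have l1 : Tendsto (fun m => ‖(f n τ - f m τ) - (f n t - f m t)‖) atTop
        (𝓝 ‖(f n τ - F τ) - (f n t - F t)‖) :=
      ((tendsto_const_nhds.sub (hF τ hτ)).sub (tendsto_const_nhds.sub (hF t ht))).norm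
    exact le_of_tendsto l1 (eventually_atTop.2 ⟨n, h1⟩)
  have h2 := hf n t ht
  rw [hasDerivWithinAt_iff_isLittleO, Asymptotics.isLittleO_iff] at h2
  filter_upwards [h2 hc4, self_mem_nhdsWithin] with τ h3 hτ
  have h4 := lip τ hτ
  have h5 : ‖(τ - t) • (f' n t - G t)‖ ≤ ‖τ - t‖ * (c / 4) := by
    rw [norm_smul]; exact mul_le_mul_of_nonneg_left (hG' n le_rfl t ht) (norm_nonneg _)
  have e : F τ - F t - (τ - t) • G t = (f n τ - f n t - (τ - t) • f' n t) -
      ((f n τ - F τ) - (f n t - F t)) + (τ - t) • (f' n t - G t) := by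
    rw [smul_sub]; abel
  rw [e]
  have h6 := norm_add_le ((f n τ - f n t - (τ - t) • f' n t) -
      ((f n τ - F τ) - (f n t - F t))) ((τ - t) • (f' n t - G t))
  have h7 := norm_sub_le (f n τ - f n t - (τ - t) • f' n t) ((f n τ - F τ) - (f n t - F t))
  linarith

/-! ### Ordinary differential equations with a cutoff -/

/-- A cutoff function which is `1` on `[0, R]` and `0` on `[2R, ∞)`. -/
def chi (R r : ℝ) : ℝ := max 0 (min 1 (2 - r / R))

lemma chi_nonneg (R r : ℝ) : 0 ≤ chi R r := le_max_left _ _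

lemma chi_le_one (R r : ℝ) : chi R r ≤ 1 := max_le zero_le_one (min_le_left _ _)

lemma chi_eq_one {R r : ℝ} (hR : 0 < R) (h : r ≤ R) : chi R r = 1 := by
  have : r / R ≤ 1 := (div_le_one hR).2 h
  rw [chi, min_eq_left (by linarith), max_eq_right zero_le_one]

lemma chi_eq_zero {R r : ℝ} (hR : 0 < R) (h : 2 * R ≤ r) : chi R r = 0 := by
  have : 2 ≤ r / R := (le_div_iff₀ hR).2 h
  exact max_eq_left ((min_le_right _ _).trans (by linarith))

lemma abs_chi_sub_le {R : ℝ} (hR : 0 < R) (a b : ℝ) : |chi R a - chi R b| ≤ |a - b| / R := by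
  rw [chi, chi, max_comm 0, max_comm 0]
  refine (abs_max_sub_max_le_abs _ _ _).trans ?_
  have := abs_min_sub_min_le_max 1 (2 - a / R) 1 (2 - b / R)
  rw [sub_self, abs_zero, max_eq_right (abs_nonneg _)] at this
  refine this.trans (le_of_eq ?_)
  rw [sub_sub_sub_cancel_left, ← sub_div, abs_div, abs_of_pos hR, abs_sub_comm]

section Cutoff

variable {X : Type*} [NormedAddCommGroup X] [NormedSpace ℝ X]

/-- `V` is controlled only on the ball of radius `2R`. The difference of the cutoff factors is
therefore always multiplied with a value of `V` inside this ball; at outer points the factor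
vanishes. -/
lemma lipschitzWith_cutoff {V : X → X} {R L M : ℝ} (hR : 0 < R) (hL : 0 ≤ L) (hM : 0 ≤ M)
    (hV : ∀ x y, ‖x‖ ≤ 2 * R → ‖y‖ ≤ 2 * R → ‖V x - V y‖ ≤ L * ‖x - y‖)
    (hVM : ∀ x, ‖x‖ ≤ 2 * R → ‖V x‖ ≤ M) (x y : X) :
    ‖chi R ‖x‖ • V x - chi R ‖y‖ • V y‖ ≤ (L + M / R) * ‖x - y‖ := by
  have hMR : 0 ≤ M / R := by positivity
  have hchi : |chi R ‖x‖ - chi R ‖y‖| ≤ ‖x - y‖ / R :=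
    (abs_chi_sub_le hR _ _).trans (by gcongr; exact abs_norm_sub_norm_le x y)
  have aux : ∀ v : X, ‖v‖ ≤ M → ‖(chi R ‖x‖ - chi R ‖y‖) • v‖ ≤ M / R * ‖x - y‖ := fun v hv => by
    rw [norm_smul, Real.norm_eq_abs]
    calc _ ≤ ‖x - y‖ / R * M := by gcongr
      _ = _ := by ring
  by_cases hx : ‖x‖ ≤ 2 * R
  · by_cases hy : ‖y‖ ≤ 2 * R
    · have e : chi R ‖x‖ • V x - chi R ‖y‖ • V y =
          chi R ‖y‖ • (V x - V y) + (chi R ‖x‖ - chi R ‖y‖) • V x := by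
        rw [smul_sub, sub_smul]; abel
      rw [e, add_mul]
      refine (norm_add_le _ _).trans (add_le_add ?_ (aux _ (hVM x hx)))
      rw [norm_smul, Real.norm_of_nonneg (chi_nonneg _ _)]
      calc _ ≤ 1 * (L * ‖x - y‖) := by
            gcongr
            · exact chi_le_one _ _
            · exact hV x y hx hy
        _ = _ := one_mul _
    · have h0 := chi_eq_zero hR (not_le.1 hy).le
      have := aux _ (hVM x hx)
      rw [h0, sub_zero] at this
      rw [h0, zero_smul, sub_zero]
      exact this.trans (mul_le_mul_of_nonneg_right (by linarith) (norm_nonneg _))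
  · have h0 := chi_eq_zero hR (not_le.1 hx).le
    by_cases hy : ‖y‖ ≤ 2 * R
    · have := aux _ (hVM y hy)
      rw [h0, zero_sub, neg_smul] at this
      rw [h0, zero_smul, zero_sub]
      exact this.trans (mul_le_mul_of_nonneg_right (by linarith) (norm_nonneg _))
    · rw [h0, chi_eq_zero hR (not_le.1 hy).le, zero_smul, zero_smul, sub_zero, norm_zero]
      positivity

variable [CompleteSpace X]

/-- A globally Lipschitz and bounded vector field has global solutions. -/
theorem exists_solution_of_lipschitz {V : X → X} {L M : ℝ} (hL : 0 ≤ L) (hM : 0 ≤ M)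
    (hV : ∀ x y, ‖V x - V y‖ ≤ L * ‖x - y‖) (hVM : ∀ x, ‖V x‖ ≤ M) (x₀ : X) {T : ℝ} (hT : 0 ≤ T) :
    ∃ x : ℝ → X, x 0 = x₀ ∧ ∀ t ∈ Icc 0 T, HasDerivWithinAt x (V (x t)) (Icc 0 T) t := by
  have hp : IsPicardLindelof (fun _ => V) (tmin := 0) (tmax := T) ⟨0, left_mem_Icc.2 hT⟩ x₀
      (M * T).toNNReal 0 M.toNNReal L.toNNReal :=
    IsPicardLindelof.of_time_independent
      (fun x _ => (hVM x).trans (Real.le_coe_toNNReal M))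
      (LipschitzWith.lipschitzOnWith (LipschitzWith.of_dist_le_mul fun x y => by
        rw [dist_eq_norm, dist_eq_norm, Real.coe_toNNReal _ hL]; exact hV x y))
      (by simp [hM, hT, mul_nonneg])
  exact hp.exists_eq_forall_mem_Icc_hasDerivWithinAt₀

/-- Solutions of the differential equation with a cutoff, in an invariant closed subspace. -/
theorem exists_cutoff_solution (K : Submodule ℝ X) (hK : IsClosed (K : Set X)) {V : X → X}
    (hVK : ∀ x ∈ K, V x ∈ K) {R L : ℝ} (hR : 0 < R) (hL : 0 ≤ L)
    (hV : ∀ x y, ‖x‖ ≤ 2 * R → ‖y‖ ≤ 2 * R → ‖V x - V y‖ ≤ L * ‖x - y‖) {x₀ : X} (hx₀ : x₀ ∈ K)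
    {T : ℝ} (hT : 0 ≤ T) :
    ∃ x : ℝ → X, x 0 = x₀ ∧ ∀ t ∈ Icc 0 T, x t ∈ K ∧
      HasDerivWithinAt x (chi R ‖x t‖ • V (x t)) (Icc 0 T) t := by
  have : CompleteSpace K := hK.completeSpace_coe
  set M := ‖V 0‖ + L * (2 * R) with hM
  have hM0 : 0 ≤ M := by positivity
  have hVM : ∀ x, ‖x‖ ≤ 2 * R → ‖V x‖ ≤ M := fun x hx => by
    have h1 := hV x 0 hx (by simpa using hR.le)
    have h2 := norm_add_le (V x - V 0) (V 0)
    rw [sub_add_cancel] at h2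
    rw [sub_zero] at h1
    have := mul_le_mul_of_nonneg_left hx hL
    linarith
  -- The equation is solved inside `K`, itself a complete space, so that invariance of `K` is
  -- automatic.
  let VK : K → K := fun x => ⟨chi R ‖x‖ • V x, K.smul_mem _ (hVK x x.2)⟩
  obtain ⟨x, hx0, hx⟩ := exists_solution_of_lipschitz (V := VK) (L := L + M / R) (M := M)
    (by positivity) hM0 (fun x y => lipschitzWith_cutoff hR hL hM0 hV hVM x y) (fun x => by
      change ‖chi R ‖x‖ • V x‖ ≤ M
      rw [norm_smul, Real.norm_of_nonneg (chi_nonneg _ _)]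
      by_cases h : ‖(x : X)‖ ≤ 2 * R
      · calc _ ≤ 1 * M := mul_le_mul (chi_le_one _ _) (hVM x h) (norm_nonneg _) zero_le_one
          _ = M := one_mul _
      · have := chi_eq_zero hR (not_le.1 h).le
        change chi R ‖(x : X)‖ * _ ≤ M
        rw [this, zero_mul]; exact hM0) ⟨x₀, hx₀⟩ hT
  refine ⟨fun t => (x t : X), by simp only [hx0], fun t ht => ⟨(x t).2, ?_⟩⟩
  exact (K.subtypeL.hasFDerivAt.comp_hasDerivWithinAt t (hx t ht))

end Cutoff

/-- Long time existence in a Hilbert space from tame energy estimates: the growth rate of the norm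
is controlled by a weaker norm, and the weaker norm grows slowly. -/
theorem exists_solution_of_tame {H : Type*} [NormedAddCommGroup H] [InnerProductSpace ℝ H]
    [CompleteSpace H] (ι : H →L[ℝ] H) (K : Submodule ℝ H)
    (hK : IsClosed (K : Set H)) {V : H → H} (hVK : ∀ x ∈ K, V x ∈ K)
    {C ε T N₀ M₀ R L : ℝ} (hC : 0 ≤ C) (hε : 0 ≤ ε) (hT : 0 ≤ T) (hM₀ : 0 ≤ M₀) (hL : 0 ≤ L)
    (hR : R = (N₀ + 1) * Real.exp (C * (M₀ + 1) * T))
    (hV : ∀ x y, ‖x‖ ≤ 2 * R → ‖y‖ ≤ 2 * R → ‖V x - V y‖ ≤ L * ‖x - y‖)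
    (hE : ∀ x ∈ K, inner ℝ x (V x) ≤ C * ‖ι x‖ * ‖x‖ ^ 2)
    (hι : ∀ x ∈ K, inner ℝ (ι x) (ι (V x)) ≤ ε * C * ‖ι x‖ * ‖x‖ ^ 2)
    (hsmall : ε * C * (2 * R) ^ 2 * T ≤ 1)
    {x₀ : H} (hx₀ : x₀ ∈ K) (hN : ‖x₀‖ ≤ N₀) (hM : ‖ι x₀‖ ≤ M₀) :
    ∃ x : ℝ → H, x 0 = x₀ ∧ ∀ t ∈ Icc 0 T, x t ∈ K ∧ HasDerivWithinAt x (V (x t)) (Icc 0 T) t ∧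
      ‖x t‖ ≤ R ∧ ‖ι (x t)‖ ≤ M₀ + 1 := by
  have hN0 : 0 ≤ N₀ := (norm_nonneg _).trans hN
  have hRpos : 0 < R := by rw [hR]; positivity
  obtain ⟨x, hx0, hx⟩ := exists_cutoff_solution K hK hVK hRpos hL hV hx₀ hT
  -- The cutoff replaces a continuation argument: beyond the radius `2R` the field vanishes, so the
  -- weak norm grows at most at the rate `ε C (2R)²`, and by at most `1` in total by `hsmall`.
  have hlow : ∀ t ∈ Icc 0 T, ‖ι (x t)‖ ≤ M₀ + 1 := by
    intro t ht
    have := norm_le_of_inner_deriv_le (f := fun t => ι (x t))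
      (f' := fun t => ι (chi R ‖x t‖ • V (x t))) (K := 0) (a := ε * C * (2 * R) ^ 2) (T := T)
      le_rfl (by positivity) (fun τ hτ => ι.hasFDerivAt.comp_hasDerivWithinAt τ (hx τ hτ).2)
      (fun τ hτ => by
        rw [zero_mul, zero_add, map_smul, inner_smul_right]
        by_cases h : ‖x τ‖ ≤ 2 * R
        · have h1 := hι (x τ) (hx τ hτ).1
          have h2 : ε * C * ‖ι (x τ)‖ * ‖x τ‖ ^ 2 ≤ ε * C * ‖ι (x τ)‖ * (2 * R) ^ 2 := by gcongr
          calc _ ≤ chi R ‖x τ‖ * (ε * C * ‖ι (x τ)‖ * (2 * R) ^ 2) :=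
                mul_le_mul_of_nonneg_left (h1.trans h2) (chi_nonneg _ _)
            _ ≤ 1 * (ε * C * ‖ι (x τ)‖ * (2 * R) ^ 2) :=
                mul_le_mul_of_nonneg_right (chi_le_one _ _) (by positivity)
            _ = _ := by ring
        · rw [chi_eq_zero hRpos (not_le.1 h).le, zero_mul]; positivity) t ht
    simp only [zero_mul, Real.exp_zero, mul_one] at this
    refine this.trans ?_
    rw [hx0]
    have : ε * C * (2 * R) ^ 2 * t ≤ ε * C * (2 * R) ^ 2 * T := by gcongr; exact ht.2
    linarith
  -- The bound on the weak norm fixes the exponential rate, and `R` was chosen to dominate the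
  -- result; so the cutoff is never active.
  have hhigh : ∀ t ∈ Icc 0 T, ‖x t‖ ≤ R := by
    intro t ht
    have := norm_le_of_inner_deriv_le (f := x)
      (f' := fun t => chi R ‖x t‖ • V (x t)) (K := C * (M₀ + 1)) (a := 0) (T := T)
      (by positivity) le_rfl (fun τ hτ => (hx τ hτ).2)
      (fun τ hτ => by
        rw [zero_mul, add_zero, inner_smul_right]
        have h1 := hE (x τ) (hx τ hτ).1
        have h2 : C * ‖ι (x τ)‖ * ‖x τ‖ ^ 2 ≤ C * (M₀ + 1) * ‖x τ‖ ^ 2 := by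
          gcongr; exact hlow τ hτ
        calc _ ≤ chi R ‖x τ‖ * (C * (M₀ + 1) * ‖x τ‖ ^ 2) :=
              mul_le_mul_of_nonneg_left (h1.trans h2) (chi_nonneg _ _)
          _ ≤ 1 * (C * (M₀ + 1) * ‖x τ‖ ^ 2) :=
              mul_le_mul_of_nonneg_right (chi_le_one _ _) (by positivity)
          _ = _ := one_mul _) t ht
    rw [zero_mul, add_zero, hx0] at this
    refine this.trans ?_
    rw [hR]
    have h3 : C * (M₀ + 1) * t ≤ C * (M₀ + 1) * T := by gcongr; exact ht.2
    gcongr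
    linarith
  refine ⟨x, hx0, fun t ht => ⟨(hx t ht).1, ?_, hhigh t ht, hlow t ht⟩⟩
  have := (hx t ht).2
  rwa [chi_eq_one hRpos (hhigh t ht), one_smul] at this

/-! ### Hermitian symmetry -/

/-- `F` is, up to a null set, the Fourier transform of a real function. -/
def HermAE (F : ℝ → ℂ) : Prop := ∀ᵐ η, F (-η) = starRingEnd ℂ (F η)

lemma Herm.hermAE {F : ℝ → ℂ} (h : Herm F) : HermAE F := Eventually.of_forall h

lemma ae_neg {p : ℝ → Prop} (h : ∀ᵐ η, p η) : ∀ᵐ η, p (-η) :=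
  (Measure.measurePreserving_neg (volume : Measure ℝ)).quasiMeasurePreserving.ae h

lemma HermAE.congr {F G : ℝ → ℂ} (h : HermAE F) (hFG : F =ᵐ[volume] G) : HermAE G := by
  filter_upwards [h, hFG, ae_neg hFG] with η h1 h2 h3
  rw [← h2, ← h3, h1]

lemma HermAE.add {F G : ℝ → ℂ} (hF : HermAE F) (hG : HermAE G) : HermAE fun η => F η + G η := by
  filter_upwards [hF, hG] with η h1 h2
  rw [h1, h2, map_add]

lemma HermAE.sub {F G : ℝ → ℂ} (hF : HermAE F) (hG : HermAE G) : HermAE fun η => F η - G η := by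
  filter_upwards [hF, hG] with η h1 h2
  rw [h1, h2, map_sub]

lemma HermAE.mul {F G : ℝ → ℂ} (hF : HermAE F) (hG : HermAE G) : HermAE fun η => F η * G η := by
  filter_upwards [hF, hG] with η h1 h2
  rw [h1, h2, map_mul]

lemma hermAE_of_even {r : ℝ → ℝ} (h : ∀ η, r (-η) = r η) : HermAE fun η => (r η : ℂ) :=
  Eventually.of_forall fun η => by simp only [h, Complex.conj_ofReal]

lemma hermAE_of_odd {r : ℝ → ℝ} (h : ∀ η, r (-η) = -r η) :
    HermAE fun η => Complex.I * (r η : ℂ) :=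
  Eventually.of_forall fun η => by
    simp only [h, map_mul, Complex.conj_I, Complex.conj_ofReal]; push_cast; ring

lemma hermAE_lift {σ : ℝ} {F : ℝ → ℂ} (hF : InH σ F) (h : HermAE F) : HermAE (lift σ F) :=
  ((hermAE_of_even (wt_neg_arg σ)).mul h).congr (coeFn_lift hF).symm

lemma hermAE_unlift {σ : ℝ} {f : E} (h : HermAE f) : HermAE (unlift σ f) :=
  (hermAE_of_even (wt_neg_arg (-σ))).mul h

/-- The Hermitian part of a function, restricted to frequencies in `[-n, n]`. -/
def hermTrunc (n : ℝ) (F : ℝ → ℂ) (η : ℝ) : ℂ :=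
  if |η| ≤ n then (F η + starRingEnd ℂ (F (-η))) / 2 else 0

/-- The Hermitian part of a function. -/
def hermPart (F : ℝ → ℂ) (η : ℝ) : ℂ := (F η + starRingEnd ℂ (F (-η))) / 2

lemma herm_hermPart (F : ℝ → ℂ) : Herm (hermPart F) := fun η => by
  simp only [hermPart, neg_neg, map_div₀, map_add, Complex.conj_conj, map_ofNat]
  ring

lemma herm_hermTrunc (n : ℝ) (F : ℝ → ℂ) : Herm (hermTrunc n F) := fun η => by
  simp only [hermTrunc, abs_neg, neg_neg]
  split_ifs
  · simp only [map_div₀, map_add, Complex.conj_conj, map_ofNat]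
    ring
  · simp

lemma hermTrunc_supp (n : ℝ) (F : ℝ → ℂ) (η : ℝ) (h : n < |η|) : hermTrunc n F η = 0 :=
  if_neg (not_le.2 h)

lemma HermAE.hermPart_ae {F : ℝ → ℂ} (h : HermAE F) : hermPart F =ᵐ[volume] F := by
  filter_upwards [h] with η h1
  rw [hermPart, h1, Complex.conj_conj]; ring

lemma HermAE.hermTrunc_ae {F : ℝ → ℂ} {n : ℝ} (h : HermAE F) (hs : ∀ᵐ η, n < |η| → F η = 0) :
    hermTrunc n F =ᵐ[volume] F := by
  filter_upwards [h, hs] with η h1 h2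
  rw [hermTrunc]
  split_ifs with h3
  · rw [h1, Complex.conj_conj]; ring
  · exact (h2 (not_le.1 h3)).symm

lemma herm_bil {k : ℝ → ℝ → ℂ} (hk : ∀ x y, k (-x) (-y) = starRingEnd ℂ (k x y)) {F G : ℝ → ℂ}
    (hF : Herm F) (hG : Herm G) : Herm (bil k F G) := fun ξ => by
  rw [bil, bil, ← integral_neg_eq_self, ← integral_conj]
  refine integral_congr_ae (Eventually.of_forall fun η => ?_)
  simp only [show -ξ - -η = -(ξ - η) by ring, hk, hF (ξ - η), hG η, map_mul]

lemma hermAE_bil {k : ℝ → ℝ → ℂ} (hk : ∀ x y, k (-x) (-y) = starRingEnd ℂ (k x y)) {F G : ℝ → ℂ}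
    (hF : HermAE F) (hG : HermAE G) : HermAE (bil k F G) := by
  rw [← bil_congr hF.hermPart_ae hG.hermPart_ae]
  exact (herm_bil hk (herm_hermPart F) (herm_hermPart G)).hermAE

/-- The reflection `F(η) ↦ conj F(-η)` on `L²`. -/
def reflE (f : E) : E := toE fun η => starRingEnd ℂ (f (-η))

lemma memLp_refl {F : ℝ → ℂ} (h : MemLp F 2 volume) :
    MemLp (fun η => starRingEnd ℂ (F (-η))) 2 volume := by
  have h1 : MemLp (fun η => F (-η)) 2 volume :=
    h.comp_measurePreserving (Measure.measurePreserving_neg volume)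
  exact h1.of_le (Complex.continuous_conj.comp_aestronglyMeasurable h1.1)
    (Eventually.of_forall fun η => by simp)

lemma dist_reflE_le (f g : E) : ‖reflE f - reflE g‖ ≤ ‖f - g‖ := by
  rw [reflE, reflE, ← toE_sub (memLp_refl (Lp.memLp f)) (memLp_refl (Lp.memLp g)), norm_toE
    (show MemLp (fun η => starRingEnd ℂ (f (-η)) - starRingEnd ℂ (g (-η))) 2 volume from
      (memLp_refl (Lp.memLp f)).sub (memLp_refl (Lp.memLp g))), Lp.norm_def]
  refine ENNReal.toReal_mono (Lp.eLpNorm_ne_top _) (le_of_eq ?_)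
  rw [← eLpNorm_comp_measurePreserving (Lp.aestronglyMeasurable (f - g))
    (Measure.measurePreserving_neg (volume : Measure ℝ))]
  refine eLpNorm_congr_norm_ae ?_
  filter_upwards [ae_neg (Lp.coeFn_sub f g)] with η h
  rw [Function.comp_apply, h, Pi.sub_apply, ← map_sub, RCLike.norm_conj]

lemma reflE_eq_iff (f : E) : reflE f = f ↔ HermAE f := by
  rw [reflE, toE_eq_iff (memLp_refl (Lp.memLp f))]
  constructor
  · intro h
    filter_upwards [h] with η h1
    rw [← h1, Complex.conj_conj]
  · intro h
    filter_upwards [h] with η h1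
    rw [h1, Complex.conj_conj]

/-- The real subspace of `L²` of the Fourier transforms of real functions. -/
def hermSub : Submodule ℝ E where
  carrier := {f | HermAE f}
  zero_mem' := by
    filter_upwards [Lp.coeFn_zero ℂ 2 (volume : Measure ℝ),
      ae_neg (Lp.coeFn_zero ℂ 2 (volume : Measure ℝ))] with η h1 h2
    rw [h1, h2]; simp
  add_mem' := fun {f g} hf hg => (HermAE.add hf hg).congr (Lp.coeFn_add f g).symm
  smul_mem' := fun c f hf => by
    have h1 : HermAE fun η => (c : ℂ) * f η := (hermAE_of_even (r := fun _ => c)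
      fun _ => rfl).mul hf
    refine h1.congr ?_
    filter_upwards [Lp.coeFn_smul c f] with η h
    rw [h, Pi.smul_apply, Complex.real_smul]

/-- The Hermitian functions are the fixed points of a continuous reflection. -/
lemma isClosed_hermSub : IsClosed (hermSub : Set E) := by
  have hc : Continuous reflE :=
    (LipschitzWith.of_dist_le_mul (K := 1) fun f g => by
      rw [dist_eq_norm, dist_eq_norm, NNReal.coe_one, one_mul]; exact dist_reflE_le f g).continuous
  have : (hermSub : Set E) = {f | reflE f = f} := by
    ext f; exact (reflE_eq_iff f).symm
  rw [this]
  exact isClosed_eq hc continuous_id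

/-! ### Frequency bands and functions supported in them -/

/-- The indicator function of `[-n, n]`. -/
def band (n : ℝ) (η : ℝ) : ℝ := if |η| ≤ n then 1 else 0

lemma measurable_band (n : ℝ) : Measurable (band n) :=
  Measurable.ite (measurableSet_le (by fun_prop) measurable_const) measurable_const
    measurable_const

lemma band_neg (n η : ℝ) : band n (-η) = band n η := by simp [band]

lemma band_nonneg (n η : ℝ) : 0 ≤ band n η := by rw [band]; split_ifs <;> simp

lemma band_le_one (n η : ℝ) : band n η ≤ 1 := by rw [band]; split_ifs <;> simp

lemma norm_one_sub_band_le (n η : ℝ) : ‖((1 - band n η : ℝ) : ℂ)‖ ≤ 1 := by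
  rw [Complex.norm_real, Real.norm_eq_abs, abs_le]
  constructor <;> linarith [band_nonneg n η, band_le_one n η]

/-- The subspace of the functions with support in `[-n, n]`. -/
def suppSub (n : ℝ) : Submodule ℝ E where
  carrier := {f | ∀ᵐ η, n < |η| → f η = 0}
  zero_mem' := by
    filter_upwards [Lp.coeFn_zero ℂ 2 (volume : Measure ℝ)] with η h1 _
    rw [h1]; rfl
  add_mem' := fun {f g} hf hg => by
    filter_upwards [hf, hg, Lp.coeFn_add f g] with η h1 h2 h3 h4
    rw [h3, Pi.add_apply, h1 h4, h2 h4, add_zero]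
  smul_mem' := fun c f hf => by
    filter_upwards [hf, Lp.coeFn_smul c f] with η h1 h2 h3
    rw [h2, Pi.smul_apply, h1 h3, smul_zero]

lemma mem_suppSub {n : ℝ} {f : E} : f ∈ suppSub n ↔ ∀ᵐ η, n < |η| → f η = 0 := Iff.rfl

lemma isClosed_suppSub (n : ℝ) : IsClosed (suppSub n : Set E) := by
  have hm : Measurable fun η => ((1 - band n η : ℝ) : ℂ) :=
    Complex.measurable_ofReal.comp (measurable_const.sub (measurable_band n))
  have : (suppSub n : Set E) = {f | mulE _ hm 1 (norm_one_sub_band_le n) f = 0} := by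
    ext f
    rw [SetLike.mem_coe, mem_suppSub, mem_ofPred_eq, Lp.eq_zero_iff_ae_eq_zero]
    constructor
    · intro h
      filter_upwards [h, coeFn_mulE hm (norm_one_sub_band_le n) f] with η h1 h2
      rw [h2, band]
      split_ifs with h3
      · simp
      · rw [h1 (not_le.1 h3)]; simp
    · intro h
      filter_upwards [h, coeFn_mulE hm (norm_one_sub_band_le n) f] with η h1 h2 h3
      rw [h2, band, if_neg (not_le.2 h3)] at h1
      simpa using h1
  rw [this]
  exact isClosed_eq (mulE _ hm 1 (norm_one_sub_band_le n)).continuous continuous_const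

/-! ### Inner products -/

lemma real_inner_eq_re (f g : E) : inner ℝ f g = (inner ℂ f g).re := by
  have h1 := real_inner_eq_norm_add_mul_self_sub_norm_mul_self_sub_norm_mul_self_div_two f g
  have h2 := re_inner_eq_norm_add_mul_self_sub_norm_mul_self_sub_norm_mul_self_div_two
    (𝕜 := ℂ) f g
  rw [h1]; exact h2.symm

/-- Multipliers with imaginary symbol are skew-adjoint at every level `σ`; therefore the linear
parts drop out of the energy estimates. -/
lemma real_inner_imag (σ : ℝ) {F G : ℝ → ℂ} {r : ℝ → ℝ} (hF : InH σ F) (hG : InH σ G)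
    (h : ∀ η, G η = Complex.I * (r η : ℂ) * F η) : inner ℝ (lift σ F) (lift σ G) = 0 := by
  rw [L2.inner_def]
  refine integral_eq_zero_of_ae ?_
  filter_upwards [coeFn_lift hF, coeFn_lift hG] with η h1 h2
  rw [h1, h2, h, Complex.inner, Pi.zero_apply]
  simp only [map_mul, Complex.conj_ofReal, Complex.mul_re, Complex.mul_im, Complex.conj_re,
    Complex.conj_im, Complex.ofReal_re, Complex.ofReal_im, Complex.I_re, Complex.I_im]
  ring

/-! ### The Galerkin approximation of the Camassa-Holm equation -/

lemma InH.inL1_of_le {s j σ : ℝ} (hs : 1 / 2 < s) {F : ℝ → ℂ} (hF : InH σ F) (h : s + j ≤ σ) :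
    InL1 j F := (hF.mono h).inL1 hs

lemma l1_le_of_le {s j σ : ℝ} (hs : 1 / 2 < s) {F : ℝ → ℂ} (hF : InH σ F) (h : s + j ≤ σ) :
    l1 j F ≤ embC s * ‖lift σ F‖ :=
  (l1_le hs (hF.mono h)).trans
    (mul_le_mul_of_nonneg_left (norm_lift_mono hF h) (embC_nonneg s))

lemma bil_trunc (n : ℝ) (k : ℝ → ℝ → ℂ) (F G : ℝ → ℂ) (ξ : ℝ) :
    bil (trunc n k) F G ξ = (band n ξ : ℂ) * bil k F G ξ := by
  simp only [bil, trunc, sub_add_cancel, band]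
  split_ifs <;> simp

lemma conj_chKer (δ x y : ℝ) : chKer δ (-x) (-y) = starRingEnd ℂ (chKer δ x y) := by
  rw [chKer, chKer, map_mul, Complex.conj_I, Complex.conj_ofReal,
    show -x + -y = -(x + y) by ring, freq_neg, freq_neg, freq_neg, chOm_neg, chLo_neg]
  push_cast; ring

lemma conj_trunc {k : ℝ → ℝ → ℂ} (hk : ∀ x y, k (-x) (-y) = starRingEnd ℂ (k x y)) (n x y : ℝ) :
    trunc n k (-x) (-y) = starRingEnd ℂ (trunc n k x y) := by
  rw [trunc, trunc, show -x + -y = -(x + y) by ring, abs_neg]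
  split_ifs
  · exact hk x y
  · simp

/-- A symmetric bilinear operator is Lipschitz continuous on the diagonal. -/
lemma norm_lift_bil_sub_le {k : ℝ → ℝ → ℂ} (hk : Measurable (Function.uncurry k))
    (hks : ∀ x y, k x y = k y x) {F G : ℝ → ℂ} {s τ j σ A : ℝ} (hs : 1 / 2 < s) (hA : 0 ≤ A)
    (h : ∀ x y, ‖k x y‖ * wt τ (x + y) ≤ A * (wt j x * wt σ y + wt σ x * wt j y))
    (hj : s + j ≤ σ) (hF : InH σ F) (hG : InH σ G) :
    ‖lift τ (bil k F F) - lift τ (bil k G G)‖ ≤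
      2 * A * embC s * ‖lift σ F + lift σ G‖ * ‖lift σ F - lift σ G‖ := by
  have hF1 := hF.inL1_of_le hs hj
  have hG1 := hG.inL1_of_le hs hj
  have b1 := bilBound hk hA h hF hF hF1 hF1
  have b2 := bilBound hk hA h hF hG hF1 hG1
  have b3 := bilBound hk hA h hG hF hG1 hF1
  have b4 := bilBound hk hA h hG hG hG1 hG1
  have hp := hF.add hG
  have hm := hF.sub hG
  have b5 := bilBound hk hA h hp hm (hp.inL1_of_le hs hj) (hm.inL1_of_le hs hj)
  rw [← lift_sub b1.mem b4.mem, lift_congr (bil_sub_bil hks b1.integrable b2.integrable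
    b3.integrable b4.integrable)]
  refine b5.norm_le.trans ?_
  have l1p := l1_le_of_le hs hp hj
  have l1m := l1_le_of_le hs hm hj
  rw [lift_add hF hG] at *
  rw [lift_sub hF hG] at *
  calc _ ≤ A * (embC s * ‖lift σ F + lift σ G‖ * ‖lift σ F - lift σ G‖ +
        ‖lift σ F + lift σ G‖ * (embC s * ‖lift σ F - lift σ G‖)) := by gcongr
    _ = _ := by ring

lemma norm_lift_bil_le {k : ℝ → ℝ → ℂ} (hk : Measurable (Function.uncurry k))
    {F : ℝ → ℂ} {s τ j σ A : ℝ} (hs : 1 / 2 < s) (hA : 0 ≤ A)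
    (h : ∀ x y, ‖k x y‖ * wt τ (x + y) ≤ A * (wt j x * wt σ y + wt σ x * wt j y))
    (hj : s + j ≤ σ) (hF : InH σ F) :
    InH τ (bil k F F) ∧ ‖lift τ (bil k F F)‖ ≤ 2 * A * embC s * ‖lift σ F‖ ^ 2 := by
  have hF1 := hF.inL1_of_le hs hj
  have b1 := bilBound hk hA h hF hF hF1 hF1
  have l := l1_le_of_le hs hF hj
  refine ⟨b1.mem, b1.norm_le.trans ?_⟩
  calc _ ≤ A * (embC s * ‖lift σ F‖ * ‖lift σ F‖ + ‖lift σ F‖ * (embC s * ‖lift σ F‖)) := by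
        gcongr
    _ = _ := by ring

/-- The linear part of the Camassa-Holm equation. -/
def chLin (κ δ : ℝ) (W : ℝ → ℂ) (η : ℝ) : ℂ := Complex.I * ((-κ * chOm δ (freq η) : ℝ) : ℂ) * W η

/-- The right hand side of the Camassa-Holm equation, solved for the time derivative. -/
def chRhs (κ ε δ : ℝ) (W : ℝ → ℂ) (η : ℝ) : ℂ :=
  chLin κ δ W η - ((κ * ε : ℝ) : ℂ) * bil (chKer δ) W W η

/-- The right hand side of the Galerkin approximation. -/
def galRhs (n κ ε δ : ℝ) (W : ℝ → ℂ) (η : ℝ) : ℂ :=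
  chLin κ δ W η - ((κ * ε : ℝ) : ℂ) * bil (trunc n (chKer δ)) W W η

lemma aesm_chLin {κ δ : ℝ} {W : ℝ → ℂ} (hW : AEStronglyMeasurable W volume) :
    AEStronglyMeasurable (chLin κ δ W) volume :=
  (by fun_prop : Continuous fun η => Complex.I * ((-κ * chOm δ (freq η) : ℝ) : ℂ)
    ).aestronglyMeasurable.mul hW

lemma norm_chLin_le {κ : ℝ} (hκ : |κ| = 1) (δ : ℝ) (W : ℝ → ℂ) (η : ℝ) :
    ‖chLin κ δ W η‖ ≤ wt 1 η * ‖W η‖ := by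
  rw [chLin, norm_mul, norm_mul, Complex.norm_I, one_mul, Complex.norm_real, Real.norm_eq_abs,
    abs_mul, abs_neg, hκ, one_mul]
  exact mul_le_mul_of_nonneg_right ((abs_chOm_le _ _).trans (abs_freq_le _)) (norm_nonneg _)

lemma inH_chLin {κ δ σ : ℝ} (hκ : |κ| = 1) {W : ℝ → ℂ} (hW : InH (σ + 1) W) :
    InH σ (chLin κ δ W) :=
  hW.of_le (C := 1) (aesm_chLin hW.aesm) (Eventually.of_forall fun η => by
    rw [one_mul, wt_add, mul_assoc]
    exact mul_le_mul_of_nonneg_left (norm_chLin_le hκ δ W η) (wt_nonneg _ _))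

lemma norm_lift_chLin_le {κ δ σ : ℝ} (hκ : |κ| = 1) {W : ℝ → ℂ} (hW : InH (σ + 1) W) :
    ‖lift σ (chLin κ δ W)‖ ≤ ‖lift (σ + 1) W‖ := by
  simpa using norm_lift_le (C := 1) zero_le_one hW (F := chLin κ δ W)
    (Eventually.of_forall fun η => by
    rw [one_mul, wt_add, mul_assoc]
    exact mul_le_mul_of_nonneg_left (norm_chLin_le hκ δ W η) (wt_nonneg _ _))

lemma chLin_sub (κ δ : ℝ) (F G : ℝ → ℂ) (η : ℝ) :
    chLin κ δ (fun η => F η - G η) η = chLin κ δ F η - chLin κ δ G η := by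
  simp only [chLin]; ring

/-- The growth constant of the Camassa-Holm equation in `H^σ`. -/
def chC (s σ : ℝ) : ℝ := chEnC σ * embC s + 4 * 2 ^ σ * embC s

lemma chC_nonneg {s σ : ℝ} (hσ : 0 ≤ σ) : 0 ≤ chC s σ := by
  have := embC_nonneg s
  have := chHC_nonneg hσ
  unfold chC chEnC; positivity

/-- The symbol of the linear part of the Galerkin approximation. -/
def galSym (n κ δ η : ℝ) : ℂ := Complex.I * ((-κ * chOm δ (freq η) * band n η : ℝ) : ℂ)

lemma measurable_galSym (n κ δ : ℝ) : Measurable (galSym n κ δ) := by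
  have := measurable_band n
  have h2 : Measurable fun η => chOm δ (freq η) := by fun_prop
  unfold galSym
  fun_prop

lemma norm_galSym_le {κ : ℝ} (hκ : |κ| = 1) (n δ η : ℝ) : ‖galSym n κ δ η‖ ≤ |freq n| := by
  rw [galSym, norm_mul, Complex.norm_I, one_mul, Complex.norm_real, Real.norm_eq_abs, abs_mul,
    abs_mul, abs_neg, hκ, one_mul, band]
  split_ifs with h
  · rw [abs_one, mul_one]
    refine (abs_chOm_le _ _).trans ?_
    simp only [freq, abs_mul]
    exact mul_le_mul_of_nonneg_left (h.trans (le_abs_self n)) (by positivity)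
  · simp

/-- The vector field of the Galerkin approximation. -/
def galV (n κ ε δ : ℝ) (hκ : |κ| = 1) (σ : ℝ) (f : E) : E :=
  mulE (galSym n κ δ) (measurable_galSym n κ δ) _ (norm_galSym_le hκ n δ) f -
    ((κ * ε : ℝ) : ℂ) • lift σ (bil (trunc n (chKer δ)) (unlift σ f) (unlift σ f))

section Galerkin

variable {s σ κ ε δ : ℝ} (hs : 1 / 2 < s) (hσ : s + 2 ≤ σ) (hκ : |κ| = 1) (hε : 0 ≤ ε)
  (hε1 : ε ≤ 1) (hδ : 0 ≤ δ) (hδ1 : δ ≤ 1) (n : ℝ)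

include hs hσ hδ hδ1 in
lemma inH_bil_trunc {F : ℝ → ℂ} (hF : InH σ F) : InH σ (bil (trunc n (chKer δ)) F F) :=
  (norm_lift_bil_le (measurable_trunc (measurable_chKer δ) n) hs
    (mul_nonneg zero_le_two (wt_nonneg σ n)) (trunc_chKer_bdd hδ hδ1 (by linarith))
    (by linarith) hF).1

include hs hσ hδ hδ1 in
-- Uniform in `n`, in contrast to `trunc_chKer_bdd`, because one derivative is given up. This bounds
-- the slow growth of the weaker norm.
lemma norm_bil_trunc_le {F : ℝ → ℂ} (hF : InH σ F) :
    ‖lift (σ - 1) (bil (trunc n (chKer δ)) F F)‖ ≤ 4 * 2 ^ σ * embC s * ‖lift σ F‖ ^ 2 := by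
  have h := (norm_lift_bil_le (τ := σ - 1) (j := 1) (σ := σ) (A := 2 * 2 ^ (σ - 1))
    (measurable_trunc (measurable_chKer δ) n) hs (by positivity) (fun x y => by
      have := chKer_loss hδ hδ1 (τ := σ - 1) (by linarith) x y
      rw [sub_add_cancel] at this
      exact (mul_le_mul_of_nonneg_right (norm_trunc_le n _ x y) (wt_nonneg _ _)).trans this)
    (by linarith) hF).2
  refine h.trans ?_
  have h2 : (2 : ℝ) ^ (σ - 1) ≤ 2 ^ σ :=
    Real.rpow_le_rpow_of_exponent_le one_le_two (by linarith)
  have := embC_nonneg s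
  calc _ = 4 * 2 ^ (σ - 1) * embC s * ‖lift σ F‖ ^ 2 := by ring
    _ ≤ _ := by gcongr

include hs hσ hδ hδ1 hε1 hε in
lemma galV_lipschitz (hκ : |κ| = 1) {r : ℝ} (f g : E) (hf : ‖f‖ ≤ r) (hg : ‖g‖ ≤ r) :
    ‖galV n κ ε δ hκ σ f - galV n κ ε δ hκ σ g‖ ≤
      (|freq n| + 2 * (2 * wt σ n) * embC s * (2 * r)) * ‖f - g‖ := by
  have h1 := norm_mulE_le (measurable_galSym n κ δ) (norm_galSym_le hκ n δ) (f - g)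
  have h2 := norm_lift_bil_sub_le (measurable_trunc (measurable_chKer δ) n)
    (trunc_symm (chKer_symm δ) n) hs (mul_nonneg zero_le_two (wt_nonneg σ n))
    (trunc_chKer_bdd hδ hδ1 (by linarith)) (by linarith) (inH_unlift σ f) (inH_unlift σ g)
  rw [lift_unlift, lift_unlift] at h2
  have e : galV n κ ε δ hκ σ f - galV n κ ε δ hκ σ g =
      mulE _ (measurable_galSym n κ δ) _ (norm_galSym_le hκ n δ) (f - g) -
      ((κ * ε : ℝ) : ℂ) • (lift σ (bil (trunc n (chKer δ)) (unlift σ f) (unlift σ f)) -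
        lift σ (bil (trunc n (chKer δ)) (unlift σ g) (unlift σ g))) := by
    rw [galV, galV, map_sub, smul_sub]; abel
  rw [e, add_mul]
  refine (norm_sub_le _ _).trans (add_le_add h1 ?_)
  rw [norm_smul, Complex.norm_real, Real.norm_eq_abs, abs_mul, hκ, one_mul, abs_of_nonneg hε]
  have h3 : ‖f + g‖ ≤ 2 * r := (norm_add_le f g).trans (by linarith)
  have := embC_nonneg s
  have := wt_nonneg σ n
  calc _ ≤ 1 * (2 * (2 * wt σ n) * embC s * ‖f + g‖ * ‖f - g‖) :=
        mul_le_mul hε1 h2 (norm_nonneg _) zero_le_one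
    _ ≤ 1 * (2 * (2 * wt σ n) * embC s * (2 * r) * ‖f - g‖) := by gcongr
    _ = _ := one_mul _

/-- The linear symbol is cut off by `band n` only to make it bounded; on functions supported in the
band the cutoff changes nothing. -/
lemma galV_lift (hκ : |κ| = 1) {F : ℝ → ℂ} {f : E} (hF : InH σ F) (hf : lift σ F = f)
    (hsF : ∀ η, n < |η| → F η = 0) (hB : InH σ (bil (trunc n (chKer δ)) F F)) :
    InH σ (galRhs n κ ε δ F) ∧ InH σ (chLin κ δ F) ∧
      galV n κ ε δ hκ σ f = lift σ (galRhs n κ ε δ F) := by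
  have e1 : ∀ η, galSym n κ δ η * F η = chLin κ δ F η := fun η => by
    rw [galSym, chLin, band]
    split_ifs with h
    · simp
    · rw [hsF η (not_le.1 h)]; simp
  have e3 : ∀ η, galSym n κ δ η * ((wt σ η : ℂ) * F η) = (wt σ η : ℂ) * chLin κ δ F η := fun η => by
    rw [← e1]; ring
  have hL : InH σ (chLin κ δ F) := by
    have := memLp_mul_of_bdd (measurable_galSym n κ δ) (norm_galSym_le hκ n δ) hF
    simp only [e3] at this
    exact this
  have e2 : mulE (galSym n κ δ) (measurable_galSym n κ δ) _ (norm_galSym_le hκ n δ) f =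
      lift σ (chLin κ δ F) := by
    rw [← hf, lift, mulE_toE _ _ hF, lift]
    simp only [e3]
  have hu : unlift σ f =ᵐ[volume] F := by rw [← hf]; exact unlift_lift hF
  refine ⟨hL.sub (hB.const_mul _), hL, ?_⟩
  rw [galV, e2, bil_congr hu hu, ← lift_const_mul _ hB, ← lift_sub hL (hB.const_mul _)]
  rfl

/-- The elements of `L²` which are Hermitian with support in `[-n, n]`. -/
def galSub : Submodule ℝ E := hermSub ⊓ suppSub n

lemma isClosed_galSub : IsClosed (galSub n : Set E) :=
  isClosed_hermSub.inter (isClosed_suppSub n)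

/-- The energy estimates need the symmetry and the support at every point. Symmetrizing and
truncating a representative provides both and changes it on a null set only. -/
lemma exists_rep (σ : ℝ) {f : E} (hf : f ∈ galSub n) :
    ∃ F, F = hermTrunc n (unlift σ f) ∧ InH σ F ∧ lift σ F = f := by
  refine ⟨_, rfl, ?_⟩
  have h1 : hermTrunc n (unlift σ f) =ᵐ[volume] unlift σ f :=
    (hermAE_unlift hf.1).hermTrunc_ae (by
      have h2 : ∀ᵐ η, n < |η| → f η = 0 := hf.2
      filter_upwards [h2] with η h3 h4
      rw [unlift, h3 h4, mul_zero])
  exact ⟨(inH_unlift σ f).congr h1.symm, by rw [lift_congr h1, lift_unlift]⟩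

lemma lift_mem_galSub {F : ℝ → ℂ} (hF : InH σ F) (hH : HermAE F)
    (hsF : ∀ η, n < |η| → F η = 0) : lift σ F ∈ galSub n := by
  refine ⟨hermAE_lift hF hH, ?_⟩
  change ∀ᵐ η, n < |η| → lift σ F η = 0
  filter_upwards [coeFn_lift hF] with η h1 h2
  rw [h1, hsF η h2, mul_zero]

lemma hermAE_chLin {F : ℝ → ℂ} (hH : HermAE F) : HermAE (chLin κ δ F) :=
  (hermAE_of_odd (r := fun η => -κ * chOm δ (freq η)) fun η => by
    rw [freq_neg, chOm_neg]; ring).mul hH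

lemma hermAE_galRhs {F : ℝ → ℂ} (hH : HermAE F) : HermAE (galRhs n κ ε δ F) :=
  (hermAE_chLin hH).sub ((hermAE_of_even (r := fun _ => κ * ε) fun _ => rfl).mul
    (hermAE_bil (conj_trunc (conj_chKer δ) n) hH hH))

lemma galRhs_supp {F : ℝ → ℂ} (hsF : ∀ η, n < |η| → F η = 0) (η : ℝ) (h : n < |η|) :
    galRhs n κ ε δ F η = 0 := by
  rw [galRhs, chLin, hsF η h, bil_trunc, band, if_neg (not_le.2 h)]; simp

include hs hσ hκ hε hε1 hδ hδ1 in
/-- Existence of solutions of the Galerkin approximation, with bounds that do not depend on the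
order of the approximation. -/
theorem exists_galerkin {T N₀ M₀ R : ℝ} (hT : 0 ≤ T)
    (hR : R = (N₀ + 1) * Real.exp (chC s σ * (M₀ + 1) * T))
    (hsmall : ε * chC s σ * (2 * R) ^ 2 * T ≤ 1) {W₀ : ℝ → ℂ} (hW₀ : InH σ W₀)
    (hH₀ : HermAE W₀) (hN : ‖lift σ W₀‖ ≤ N₀) (hM : ‖lift (σ - 1) W₀‖ ≤ M₀) :
    ∃ W : ℝ → ℝ → ℂ, W 0 =ᵐ[volume] (fun η => (band n η : ℂ) * W₀ η) ∧
      ∀ t ∈ Icc 0 T, InH σ (W t) ∧ Herm (W t) ∧ ‖lift σ (W t)‖ ≤ R ∧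
        ‖lift (σ - 1) (W t)‖ ≤ M₀ + 1 ∧ InH σ (galRhs n κ ε δ (W t)) ∧
        HasDerivWithinAt (fun τ => lift σ (W τ)) (lift σ (galRhs n κ ε δ (W t))) (Icc 0 T) t := by
  have hC : 0 ≤ chC s σ := chC_nonneg (by linarith)
  have hlow : σ - 1 ≤ σ := by linarith
  set B₀ : ℝ → ℂ := fun η => (band n η : ℂ) * W₀ η with hB₀
  have hble : ∀ η, ‖B₀ η‖ ≤ ‖W₀ η‖ := fun η => by
    rw [hB₀, norm_mul, Complex.norm_real, Real.norm_of_nonneg (band_nonneg n η)]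
    exact mul_le_of_le_one_left (norm_nonneg _) (band_le_one n η)
  have hB₀m : AEStronglyMeasurable B₀ volume :=
    (Complex.measurable_ofReal.comp (measurable_band n)).aestronglyMeasurable.mul hW₀.aesm
  have hble' : ∀ τ : ℝ, ∀ᵐ η, wt τ η * ‖B₀ η‖ ≤ 1 * (wt τ η * ‖W₀ η‖) := fun τ =>
    Eventually.of_forall fun η => by
      rw [one_mul]; exact mul_le_mul_of_nonneg_left (hble η) (wt_nonneg _ _)
  have hB₀H : InH σ B₀ := hW₀.of_le hB₀m (hble' σ)
  have hB₀Herm : HermAE B₀ := (hermAE_of_even (band_neg n)).mul hH₀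
  have hB₀s : ∀ η, n < |η| → B₀ η = 0 := fun η h => by
    rw [hB₀]; simp [band, not_le.2 h]
  have hx₀ : lift σ B₀ ∈ galSub n := lift_mem_galSub n hB₀H hB₀Herm hB₀s
  have low_lift : ∀ {F : ℝ → ℂ}, InH σ F →
      (lower (σ - 1) σ hlow).restrictScalars ℝ (lift σ F) = lift (σ - 1) F :=
    fun hF => lower_lift hlow hF
  have hM₀ : 0 ≤ M₀ := (norm_nonneg _).trans hM
  have hN₀ : 0 ≤ N₀ := (norm_nonneg _).trans hN
  have hRn : 0 ≤ R := by rw [hR]; positivity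
  have emb := embC_nonneg s
  have chE : 0 ≤ chEnC σ := by
    have := chHC_nonneg (σ := σ) (by linarith); unfold chEnC; positivity
  obtain ⟨x, hx0, hx⟩ := exists_solution_of_tame
    ((lower (σ - 1) σ hlow).restrictScalars ℝ) (galSub n) (isClosed_galSub n)
    (V := galV n κ ε δ hκ σ) (L := |freq n| + 2 * (2 * wt σ n) * embC s * (2 * (2 * R)))
    (fun f hf => by
      obtain ⟨F, hFdef, hF, hlF⟩ := exists_rep n σ hf
      have hsF : ∀ η, n < |η| → F η = 0 := by rw [hFdef]; exact hermTrunc_supp n _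
      have hHF : Herm F := by rw [hFdef]; exact herm_hermTrunc n _
      obtain ⟨hG, -, hV⟩ := galV_lift (ε := ε) n hκ hF hlF hsF
        (inH_bil_trunc hs hσ hδ hδ1 n hF)
      rw [hV]
      exact lift_mem_galSub n hG (hermAE_galRhs n hHF.hermAE) (galRhs_supp n hsF))
    hC hε hT hM₀ (by have := wt_nonneg σ n; positivity) hR
    (fun f g hf hg => galV_lipschitz hs hσ hε hε1 hδ hδ1 n hκ f g hf hg)
    -- The estimate in `H^σ`: the linear part drops out, and `l1 1` is controlled by the `H^{σ-1}`
    -- norm because `s + 1 ≤ σ - 1`.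
    (fun f hf => by
      obtain ⟨F, hFdef, hF, hlF⟩ := exists_rep n σ hf
      have hsF : ∀ η, n < |η| → F η = 0 := by rw [hFdef]; exact hermTrunc_supp n _
      have hHF : Herm F := by rw [hFdef]; exact herm_hermTrunc n _
      have hB := inH_bil_trunc hs hσ hδ hδ1 n hF
      obtain ⟨hG, hL, hV⟩ := galV_lift (ε := ε) n hκ hF hlF hsF hB
      have e : lift σ (galRhs n κ ε δ F) = lift σ (chLin κ δ F) -
          ((κ * ε : ℝ) : ℂ) • lift σ (bil (trunc n (chKer δ)) F F) := by
        rw [← lift_const_mul _ hB, ← lift_sub hL (hB.const_mul _)]; rfl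
      have en := energy_chKer (n := n) hδ hδ1 (by linarith) hHF hF
        (hF.inL1_of_le hs (by linarith)) hsF
      rw [hV, ← hlF, e, inner_sub_right, real_inner_imag σ hF hL (fun η => rfl), zero_sub,
        low_lift hF, real_inner_eq_re, inner_smul_right]
      have h1 : l1 1 F ≤ embC s * ‖lift (σ - 1) F‖ :=
        l1_le_of_le hs (hF.mono hlow) (by linarith)
      have h2 : ‖((κ * ε : ℝ) : ℂ) * inner ℂ (lift σ F) (lift σ (bil (trunc n (chKer δ)) F F))‖ ≤
          1 * (chEnC σ * (l1 1 F * (‖lift σ F‖ * ‖lift σ F‖))) := by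
        rw [norm_mul, Complex.norm_real, Real.norm_eq_abs, abs_mul, hκ, one_mul,
          abs_of_nonneg hε]
        exact mul_le_mul hε1 en (norm_nonneg _) zero_le_one
      have h3 := (abs_le.1 (Complex.abs_re_le_norm
        (((κ * ε : ℝ) : ℂ) * inner ℂ (lift σ F) (lift σ (bil (trunc n (chKer δ)) F F))))).1
      calc _ ≤ chEnC σ * (l1 1 F * (‖lift σ F‖ * ‖lift σ F‖)) := by linarith
        _ ≤ chEnC σ * ((embC s * ‖lift (σ - 1) F‖) * (‖lift σ F‖ * ‖lift σ F‖)) := by gcongr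
        _ = chEnC σ * embC s * ‖lift (σ - 1) F‖ * ‖lift σ F‖ ^ 2 := by ring
        _ ≤ _ := by
          gcongr
          have : 0 ≤ 4 * 2 ^ σ * embC s := by positivity
          unfold chC; linarith)
    -- The estimate in `H^{σ-1}`: no cancellation in the quadratic term is needed, as a derivative
    -- may be lost, and the factor `ε` is kept.
    (fun f hf => by
      obtain ⟨F, hFdef, hF, hlF⟩ := exists_rep n σ hf
      have hsF : ∀ η, n < |η| → F η = 0 := by rw [hFdef]; exact hermTrunc_supp n _
      have hB := inH_bil_trunc hs hσ hδ hδ1 n hF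
      obtain ⟨hG, hL, hV⟩ := galV_lift (ε := ε) n hκ hF hlF hsF hB
      have hB' := hB.mono hlow
      have hL' := hL.mono hlow
      have e : lift (σ - 1) (galRhs n κ ε δ F) = lift (σ - 1) (chLin κ δ F) -
          ((κ * ε : ℝ) : ℂ) • lift (σ - 1) (bil (trunc n (chKer δ)) F F) := by
        rw [← lift_const_mul _ hB', ← lift_sub hL' (hB'.const_mul _)]; rfl
      rw [hV, ← hlF, low_lift hF, low_lift hG, e, inner_sub_right,
        real_inner_imag (σ - 1) (hF.mono hlow) hL' (fun η => rfl), zero_sub, ← inner_neg_right]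
      refine (real_inner_le_norm _ _).trans ?_
      rw [norm_neg, norm_smul, Complex.norm_real, Real.norm_eq_abs, abs_mul, hκ, one_mul,
          abs_of_nonneg hε]
      have h1 := norm_bil_trunc_le hs hσ hδ hδ1 n hF
      calc _ ≤ ‖lift (σ - 1) F‖ * (ε * (4 * 2 ^ σ * embC s * ‖lift σ F‖ ^ 2)) := by gcongr
        _ = ε * (4 * 2 ^ σ * embC s) * ‖lift (σ - 1) F‖ * ‖lift σ F‖ ^ 2 := by ring
        _ ≤ _ := by
          gcongr
          have : 0 ≤ chEnC σ * embC s := by positivity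
          unfold chC; linarith)
    hsmall hx₀
    (((norm_lift_le zero_le_one hW₀ (hble' σ)).trans (one_mul _).le).trans hN)
    (by
      rw [low_lift hB₀H]
      exact ((norm_lift_le zero_le_one (hW₀.mono hlow) (hble' (σ - 1))).trans
        (one_mul _).le).trans hM)
  refine ⟨fun t => hermTrunc n (unlift σ (x t)), ?_, fun t ht => ?_⟩
  · obtain ⟨F, hFdef, hF, hlF⟩ := exists_rep n σ (f := x 0) (by rw [hx0]; exact hx₀)
    dsimp only
    rw [← hFdef]
    exact lift_inj hF hB₀H (hlF.trans hx0)
  · have hrep : ∀ τ ∈ Icc 0 T, lift σ (hermTrunc n (unlift σ (x τ))) = x τ := fun τ hτ => by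
      obtain ⟨F, hFdef, hF, hlF⟩ := exists_rep n σ (hx τ hτ).1
      rw [← hFdef, hlF]
    obtain ⟨hmem, hder, hb1, hb2⟩ := hx t ht
    obtain ⟨F, hFdef, hF, hlF⟩ := exists_rep n σ hmem
    dsimp only
    rw [← hFdef]
    have hsF : ∀ η, n < |η| → F η = 0 := by rw [hFdef]; exact hermTrunc_supp n _
    have hHF : Herm F := by rw [hFdef]; exact herm_hermTrunc n _
    obtain ⟨hG, hL, hV⟩ := galV_lift (ε := ε) n hκ hF hlF hsF
      (inH_bil_trunc hs hσ hδ hδ1 n hF)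
    refine ⟨hF, hHF, by rw [hlF]; exact hb1, ?_, hG, ?_⟩
    · rw [← low_lift hF, hlF]; exact hb2
    · rw [← hV]
      exact hder.congr hrep (hrep t ht)

end Galerkin

/-! ### Solutions of the Camassa-Holm equation -/

section Ch

variable {s κ ε δ : ℝ} (hs : 1 / 2 < s) (hκ : |κ| = 1) (hε : 0 ≤ ε)
  (hε1 : ε ≤ 1) (hδ : 0 ≤ δ) (hδ1 : δ ≤ 1)

include hδ hδ1 in
lemma chKer_loss' {τ σ : ℝ} (hτ : 0 ≤ τ) (h : τ + 1 ≤ σ) (x y : ℝ) :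
    ‖chKer δ x y‖ * wt τ (x + y) ≤ 2 * 2 ^ τ * (wt 1 x * wt σ y + wt σ x * wt 1 y) := by
  refine (chKer_loss hδ hδ1 hτ x y).trans ?_
  have := wt_nonneg 1 x
  have := wt_nonneg 1 y
  have := wt_mono h x
  have := wt_mono h y
  gcongr

include hs hδ hδ1 in
lemma norm_bil_chKer_le {τ σ : ℝ} (hτ : 0 ≤ τ) (h : τ + 1 ≤ σ) (hσ : s + 1 ≤ σ) {W : ℝ → ℂ}
    (hW : InH σ W) : InH τ (bil (chKer δ) W W) ∧
      ‖lift τ (bil (chKer δ) W W)‖ ≤ 2 * (2 * 2 ^ τ) * embC s * ‖lift σ W‖ ^ 2 :=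
  norm_lift_bil_le (measurable_chKer δ) hs (by positivity) (chKer_loss' hδ hδ1 hτ h) hσ hW

include hs hκ hδ hδ1 in
lemma inH_chRhs {τ σ : ℝ} (hτ : 0 ≤ τ) (h : τ + 1 ≤ σ) (hσ : s + 1 ≤ σ) {W : ℝ → ℂ}
    (hW : InH σ W) : InH τ (chRhs κ ε δ W) :=
  (inH_chLin hκ (hW.mono h)).sub ((norm_bil_chKer_le hs hδ hδ1 hτ h hσ hW).1.const_mul _)

include hs hκ hδ hδ1 in
lemma lift_chRhs {τ σ : ℝ} (hτ : 0 ≤ τ) (h : τ + 1 ≤ σ) (hσ : s + 1 ≤ σ) {W : ℝ → ℂ}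
    (hW : InH σ W) : lift τ (chRhs κ ε δ W) = lift τ (chLin κ δ W) -
      ((κ * ε : ℝ) : ℂ) • lift τ (bil (chKer δ) W W) := by
  have hB := (norm_bil_chKer_le hs hδ hδ1 hτ h hσ hW).1
  rw [← lift_const_mul _ hB, ← lift_sub (inH_chLin hκ (hW.mono h)) (hB.const_mul _)]
  rfl

include hs hκ hε hε1 hδ hδ1 in
lemma norm_chRhs_sub_le {τ : ℝ} (hτ : s ≤ τ) {F G : ℝ → ℂ} (hF : InH (τ + 1) F)
    (hG : InH (τ + 1) G) : ‖lift τ (chRhs κ ε δ F) - lift τ (chRhs κ ε δ G)‖ ≤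
      (1 + 2 * (2 * 2 ^ τ) * embC s * ‖lift (τ + 1) F + lift (τ + 1) G‖) *
        ‖lift (τ + 1) F - lift (τ + 1) G‖ := by
  have hτ0 : 0 ≤ τ := by linarith
  rw [lift_chRhs hs hκ hδ hδ1 hτ0 le_rfl (by linarith) hF,
    lift_chRhs hs hκ hδ hδ1 hτ0 le_rfl (by linarith) hG]
  have h1 : ‖lift τ (chLin κ δ F) - lift τ (chLin κ δ G)‖ ≤
      ‖lift (τ + 1) F - lift (τ + 1) G‖ := by
    rw [← lift_sub hF hG, ← lift_sub (inH_chLin hκ hF) (inH_chLin hκ hG)]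
    have := norm_lift_chLin_le (δ := δ) hκ (hF.sub hG)
    rwa [show chLin κ δ (fun η => F η - G η) = fun η => chLin κ δ F η - chLin κ δ G η from
      funext fun η => chLin_sub κ δ F G η] at this
  have h2 := norm_lift_bil_sub_le (τ := τ) (measurable_chKer δ) (chKer_symm δ) hs (by positivity)
    (chKer_loss' hδ hδ1 hτ0 le_rfl) (by linarith) hF hG
  have e : lift τ (chLin κ δ F) - ((κ * ε : ℝ) : ℂ) • lift τ (bil (chKer δ) F F) -
      (lift τ (chLin κ δ G) - ((κ * ε : ℝ) : ℂ) • lift τ (bil (chKer δ) G G)) =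
      (lift τ (chLin κ δ F) - lift τ (chLin κ δ G)) - ((κ * ε : ℝ) : ℂ) •
        (lift τ (bil (chKer δ) F F) - lift τ (bil (chKer δ) G G)) := by
    rw [smul_sub]; abel
  rw [e, add_mul, one_mul]
  refine (norm_sub_le _ _).trans (add_le_add h1 ?_)
  rw [norm_smul, Complex.norm_real, Real.norm_eq_abs, abs_mul, hκ, one_mul, abs_of_nonneg hε]
  exact (mul_le_of_le_one_left (norm_nonneg _) hε1).trans h2

include hs hκ hε hε1 hδ hδ1 in
/-- Stability of the Camassa-Holm equation in `L²`. -/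
theorem ch_stability {T R a : ℝ} (ha : 0 ≤ a) {W : Bool → ℝ → ℝ → ℂ} {D : Bool → ℝ → E}
    (hW : ∀ i, ∀ t ∈ Icc 0 T, InH (s + 2) (W i t) ∧ HermAE (W i t) ∧
      ‖lift (s + 2) (W i t)‖ ≤ R ∧ ‖D i t - lift 0 (chRhs κ ε δ (W i t))‖ ≤ a ∧
      HasDerivWithinAt (fun τ => lift 0 (W i τ)) (D i t) (Icc 0 T) t) :
    ∀ t ∈ Icc 0 T, ‖lift 0 (W true t) - lift 0 (W false t)‖ ≤
      (‖lift 0 (W true 0) - lift 0 (W false 0)‖ + 2 * a * t) *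
        Real.exp (4 * embC s * R * t) := by
  intro t ht
  have hT : 0 ≤ T := ht.1.trans ht.2
  have hR : 0 ≤ R := (norm_nonneg _).trans (hW true t ht).2.2.1
  have emb := embC_nonneg s
  -- Each `D i` has to agree with the right hand side only up to `a`, so that the estimate covers
  -- exact solutions as well as Galerkin approximations; the two errors give `2 * a`.
  refine norm_le_of_inner_deriv_le (f := fun τ => lift 0 (W true τ) - lift 0 (W false τ))
    (f' := fun τ => D true τ - D false τ) (K := 4 * embC s * R) (a := 2 * a) (T := T)
    (by positivity) (by positivity)
    (fun τ hτ => (hW true τ hτ).2.2.2.2.sub (hW false τ hτ).2.2.2.2) ?_ t ht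
  intro τ hτ
  obtain ⟨hF, hFH, hFR, hFa, -⟩ := hW true τ hτ
  obtain ⟨hG, hGH, hGR, hGa, -⟩ := hW false τ hτ
  set F := W true τ
  set G := W false τ
  -- A representative of the difference with pointwise symmetry, as `energy_chKer_diff` requires.
  set Z := hermPart fun η => F η - G η with hZdef
  have hZae : Z =ᵐ[volume] fun η => F η - G η := (hFH.sub hGH).hermPart_ae
  have hZ1 : InH 1 Z := ((hF.mono (by linarith)).sub (hG.mono (by linarith))).congr hZae.symm
  have hZ0 : InH 0 Z := hZ1.mono zero_le_one
  have h02 : (0 : ℝ) ≤ s + 2 := by linarith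
  have hliftZ : lift 0 F - lift 0 G = lift 0 Z := by
    rw [← lift_sub (hF.mono h02) (hG.mono h02)]; exact lift_congr hZae.symm
  have hS := hF.add hG
  have hS2 : InL1 2 fun η => F η + G η := hS.inL1_of_le hs le_rfl
  obtain ⟨hB, hen⟩ := energy_chKer_diff hδ hδ1 (herm_hermPart fun η => F η - G η) hS.aesm hS2 hZ1
  rw [← hZdef] at hB hen
  have b : ∀ {F G : ℝ → ℂ}, InH (s + 2) F → InH (s + 2) G →
      ∀ᵐ ξ, Integrable fun η => chKer δ (ξ - η) η * F (ξ - η) * G η := fun {F G} hF hG =>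
    (bilBound (τ := 0) (σ := s + 2) (j := 1) (measurable_chKer δ) (by positivity)
      (chKer_loss' hδ hδ1 le_rfl (by linarith)) hF hG (hF.inL1_of_le hs (by linarith))
      (hG.inL1_of_le hs (by linarith))).integrable
  have hdiff : lift 0 (chRhs κ ε δ F) - lift 0 (chRhs κ ε δ G) =
      lift 0 (chLin κ δ Z) - ((κ * ε : ℝ) : ℂ) •
        lift 0 (bil (chKer δ) (fun η => F η + G η) Z) := by
    have hL : InH 0 (chLin κ δ Z) := inH_chLin hκ (by simpa using hZ1)
    rw [← lift_const_mul _ hB, ← lift_sub hL (hB.const_mul _),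
      ← lift_sub (inH_chRhs hs hκ hδ hδ1 le_rfl (by linarith) (by linarith) hF)
      (inH_chRhs hs hκ hδ hδ1 le_rfl (by linarith) (by linarith) hG)]
    refine lift_congr ?_
    rw [bil_congr (ae_eq_refl fun η => F η + G η) hZae]
    filter_upwards [hZae, bil_sub_bil (chKer_symm δ) (b hF hF) (b hF hG) (b hG hF) (b hG hG)]
      with η h1 h2
    rw [← h2]
    simp only [chRhs, chLin, h1]
    ring
  have hinner : inner ℝ (lift 0 Z) (lift 0 (chRhs κ ε δ F) - lift 0 (chRhs κ ε δ G)) ≤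
      4 * embC s * R * ‖lift 0 Z‖ ^ 2 := by
    rw [hdiff, inner_sub_right, real_inner_imag 0 hZ0 (inH_chLin hκ (by simpa using hZ1))
      (fun η => rfl), zero_sub, real_inner_eq_re, inner_smul_right]
    have h3 := (abs_le.1 (Complex.abs_re_le_norm (((κ * ε : ℝ) : ℂ) *
      inner ℂ (lift 0 Z) (lift 0 (bil (chKer δ) (fun η => F η + G η) Z))))).1
    have h2 : ‖((κ * ε : ℝ) : ℂ) *
        inner ℂ (lift 0 Z) (lift 0 (bil (chKer δ) (fun η => F η + G η) Z))‖ ≤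
        1 * (2 * (l1 2 (fun η => F η + G η) * (‖lift 0 Z‖ * ‖lift 0 Z‖))) := by
      rw [norm_mul, Complex.norm_real, Real.norm_eq_abs, abs_mul, hκ, one_mul, abs_of_nonneg hε]
      exact mul_le_mul hε1 hen (norm_nonneg _) zero_le_one
    -- Together with the factor `2` of `energy_chKer_diff` this gives the rate `4 * embC s * R`.
    have h4 : l1 2 (fun η => F η + G η) ≤ embC s * (2 * R) := by
      refine (l1_le_of_le hs hS le_rfl).trans (mul_le_mul_of_nonneg_left ?_ emb)
      rw [lift_add hF hG]
      exact (norm_add_le _ _).trans (by linarith)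
    calc _ ≤ 2 * (l1 2 (fun η => F η + G η) * (‖lift 0 Z‖ * ‖lift 0 Z‖)) := by linarith
      _ ≤ 2 * (embC s * (2 * R) * (‖lift 0 Z‖ * ‖lift 0 Z‖)) := by gcongr
      _ = _ := by ring
  rw [hliftZ]
  have e : D true τ - D false τ = (lift 0 (chRhs κ ε δ F) - lift 0 (chRhs κ ε δ G)) +
      ((D true τ - lift 0 (chRhs κ ε δ F)) - (D false τ - lift 0 (chRhs κ ε δ G))) := by abel
  rw [e, inner_add_right]
  refine add_le_add hinner ?_
  refine (real_inner_le_norm _ _).trans ?_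
  have := (norm_sub_le (D true τ - lift 0 (chRhs κ ε δ F))
    (D false τ - lift 0 (chRhs κ ε δ G))).trans (add_le_add hFa hGa)
  rw [mul_comm (2 * a)]
  exact mul_le_mul_of_nonneg_left (by linarith) (norm_nonneg _)

include hs hκ hε hε1 hδ hδ1 in
/-- Uniqueness of the solutions of the Camassa-Holm equation. -/
theorem ch_unique {T σ : ℝ} (hσ : s + 2 ≤ σ) {W₁ W₂ : ℝ → ℝ → ℂ} (h₀ : W₁ 0 =ᵐ[volume] W₂ 0)
    (hW₁ : ∀ t ∈ Icc 0 T, InH σ (W₁ t) ∧ HermAE (W₁ t) ∧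
      HasDerivWithinAt (fun τ => lift (σ - 1) (W₁ τ)) (lift (σ - 1) (chRhs κ ε δ (W₁ t)))
        (Icc 0 T) t)
    (hW₂ : ∀ t ∈ Icc 0 T, InH σ (W₂ t) ∧ HermAE (W₂ t) ∧
      HasDerivWithinAt (fun τ => lift (σ - 1) (W₂ τ)) (lift (σ - 1) (chRhs κ ε δ (W₂ t)))
        (Icc 0 T) t)
    (hc₁ : ContinuousOn (fun t => lift σ (W₁ t)) (Icc 0 T))
    (hc₂ : ContinuousOn (fun t => lift σ (W₂ t)) (Icc 0 T)) :
    ∀ t ∈ Icc 0 T, W₁ t =ᵐ[volume] W₂ t := by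
  intro t ht
  -- Compactness of the time interval supplies the bound that `ch_stability` needs; it is then
  -- applied with zero error and equal data.
  obtain ⟨R₁, hR₁⟩ := isCompact_Icc.exists_bound_of_continuousOn hc₁
  obtain ⟨R₂, hR₂⟩ := isCompact_Icc.exists_bound_of_continuousOn hc₂
  have h0 : (0 : ℝ) ≤ σ - 1 := by linarith
  have key : ∀ V : ℝ → ℝ → ℂ, (∀ t ∈ Icc 0 T, InH σ (V t) ∧ HermAE (V t) ∧
      HasDerivWithinAt (fun τ => lift (σ - 1) (V τ)) (lift (σ - 1) (chRhs κ ε δ (V t)))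
        (Icc 0 T) t) → (∀ t ∈ Icc 0 T, ‖lift σ (V t)‖ ≤ max R₁ R₂) → ∀ t ∈ Icc 0 T,
      InH (s + 2) (V t) ∧ HermAE (V t) ∧ ‖lift (s + 2) (V t)‖ ≤ max R₁ R₂ ∧
      ‖lift 0 (chRhs κ ε δ (V t)) - lift 0 (chRhs κ ε δ (V t))‖ ≤ 0 ∧
      HasDerivWithinAt (fun τ => lift 0 (V τ)) (lift 0 (chRhs κ ε δ (V t))) (Icc 0 T) t := by
    intro V hV hVR τ hτ
    obtain ⟨h1, h2, h3⟩ := hV τ hτ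
    refine ⟨h1.mono hσ, h2, (norm_lift_mono h1 hσ).trans (hVR τ hτ), by simp, ?_⟩
    have h4 := ((lower 0 (σ - 1) h0).restrictScalars ℝ).hasFDerivAt.comp_hasDerivWithinAt τ h3
    have e : ∀ x ∈ Icc 0 T, lift 0 (V x) = lower 0 (σ - 1) h0 (lift (σ - 1) (V x)) := fun x hx =>
      (lower_lift h0 ((hV x hx).1.mono (by linarith))).symm
    have e2 : lower 0 (σ - 1) h0 (lift (σ - 1) (chRhs κ ε δ (V τ))) =
        lift 0 (chRhs κ ε δ (V τ)) :=
      lower_lift h0 (inH_chRhs hs hκ hδ hδ1 h0 (by linarith) (by linarith) h1)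
    simp only [ContinuousLinearMap.coe_restrictScalars', e2] at h4
    exact h4.congr e (e τ hτ)
  have := ch_stability hs hκ hε hε1 hδ hδ1 (T := T) (R := max R₁ R₂) (a := 0) le_rfl
    (W := fun i => cond i W₁ W₂) (D := fun i t => lift 0 (chRhs κ ε δ (cond i W₁ W₂ t)))
    (fun i => by
      cases i
      · exact key W₂ hW₂ fun t ht => (hR₂ t ht).trans (le_max_right _ _)
      · exact key W₁ hW₁ fun t ht => (hR₁ t ht).trans (le_max_left _ _)) t ht
  simp only [cond_true, cond_false] at this
  rw [lift_congr h₀, sub_self, norm_zero, mul_zero, zero_mul, add_zero, zero_mul] at this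
  exact lift_inj ((hW₁ t ht).1.mono (by linarith)) ((hW₂ t ht).1.mono (by linarith))
    (sub_eq_zero.1 (norm_le_zero_iff.1 this))

end Ch

/-! ### Existence of solutions of the Camassa-Holm equation -/

lemma le_wt_one {n η : ℝ} (h : n ≤ |η|) : n ≤ wt 1 η := by
  refine h.trans (le_trans ?_ (abs_freq_le η))
  rw [freq, abs_mul, abs_of_pos (by positivity : 0 < 2 * Real.pi)]
  exact le_mul_of_one_le_left (abs_nonneg _) (by linarith [Real.pi_gt_three])

lemma one_sub_band_le {n : ℝ} (hn : 0 < n) (η : ℝ) : 1 - band n η ≤ n⁻¹ * wt 1 η := by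
  rw [band]
  split_ifs with h
  · rw [sub_self]; exact mul_nonneg (by positivity) (wt_nonneg _ _)
  · rw [sub_zero]
    have := le_wt_one (not_le.1 h).le
    calc (1 : ℝ) = n⁻¹ * n := (inv_mul_cancel₀ hn.ne').symm
      _ ≤ _ := by gcongr

/-- Outside the band `wt 1` exceeds `n`, so one derivative pays for the factor `n⁻¹`. -/
lemma norm_lift_band_sub_le {σ τ n : ℝ} (h : τ + 1 ≤ σ) (hn : 0 < n) {F : ℝ → ℂ} (hF : InH σ F) :
    InH τ (fun η => (band n η : ℂ) * F η) ∧
      ‖lift τ (fun η => (band n η : ℂ) * F η) - lift τ F‖ ≤ n⁻¹ * ‖lift σ F‖ := by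
  have hFτ := hF.mono (show τ ≤ σ by linarith)
  have hm : AEStronglyMeasurable (fun η => (band n η : ℂ) * F η) volume :=
    (Complex.measurable_ofReal.comp (measurable_band n)).aestronglyMeasurable.mul hF.aesm
  have hB : InH τ (fun η => (band n η : ℂ) * F η) :=
    hFτ.of_le (C := 1) hm (Eventually.of_forall fun η => by
      rw [norm_mul, Complex.norm_real, Real.norm_of_nonneg (band_nonneg n η), one_mul]
      exact mul_le_mul_of_nonneg_left
        (mul_le_of_le_one_left (norm_nonneg _) (band_le_one n η)) (wt_nonneg _ _))
  refine ⟨hB, ?_⟩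
  rw [← lift_sub hB hFτ]
  refine norm_lift_le (by positivity) hF (Eventually.of_forall fun η => ?_)
  have e : (band n η : ℂ) * F η - F η = -(((1 - band n η : ℝ) : ℂ) * F η) := by push_cast; ring
  rw [e, norm_neg, norm_mul, Complex.norm_real,
    Real.norm_of_nonneg (by linarith [band_le_one n η])]
  have h1 := one_sub_band_le hn η
  have h2 := wt_mono h η
  rw [wt_add] at h2
  have := wt_nonneg τ η
  calc _ ≤ wt τ η * (n⁻¹ * wt 1 η * ‖F η‖) := by gcongr
    _ = n⁻¹ * (wt τ η * wt 1 η * ‖F η‖) := by ring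
    _ ≤ _ := by gcongr

/-- Interpolation between the norms of order `0` and `σ`. -/
lemma norm_lift_interp {σ ρ : ℝ} (hσ : 1 ≤ σ) (hρ : 0 < ρ) {F : ℝ → ℂ} (hF : InH σ F) :
    ‖lift (σ - 1) F‖ ≤ wt (σ - 1) ρ * ‖lift 0 F‖ + ρ⁻¹ * ‖lift σ F‖ := by
  have hF0 : InH 0 F := hF.mono (by linarith)
  have h0 : 0 ≤ wt (σ - 1) ρ := wt_nonneg _ _
  have key : ‖lift (σ - 1) F‖ ≤
      1 * ‖toE fun η => ((wt (σ - 1) ρ : ℝ) : ℂ) * ((wt 0 η : ℂ) * F η) +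
        ((ρ⁻¹ : ℝ) : ℂ) * ((wt σ η : ℂ) * F η)‖ := by
    refine norm_toE_le zero_le_one
      ((MemLp.const_mul hF0 _).add (MemLp.const_mul hF _)) (Eventually.of_forall fun η => ?_)
    have e : ((wt (σ - 1) ρ : ℝ) : ℂ) * ((wt 0 η : ℂ) * F η) +
        ((ρ⁻¹ : ℝ) : ℂ) * ((wt σ η : ℂ) * F η) =
        ((wt (σ - 1) ρ + ρ⁻¹ * wt σ η : ℝ) : ℂ) * F η := by
      rw [wt_zero]; push_cast; ring
    have hp : 0 ≤ wt (σ - 1) ρ + ρ⁻¹ * wt σ η :=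
      add_nonneg h0 (mul_nonneg (by positivity) (wt_nonneg _ _))
    rw [e, one_mul, norm_wt_mul, norm_mul, Complex.norm_real, Real.norm_of_nonneg hp]
    refine mul_le_mul_of_nonneg_right ?_ (norm_nonneg _)
    -- Low frequencies are charged to the `L²` norm; at high ones the missing derivative gains
    -- `ρ⁻¹`.
    rcases le_total |η| ρ with h | h
    · have h1 : wt (σ - 1) η ≤ wt (σ - 1) ρ := by
        rw [wt, wt]
        refine Real.rpow_le_rpow (jap_pos _).le ?_ (by linarith)
        have : freq η ^ 2 ≤ freq ρ ^ 2 := by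
          rw [freq, freq, mul_pow _ η, mul_pow _ ρ]
          exact mul_le_mul_of_nonneg_left (sq_le_sq' (abs_le.1 h).1 (abs_le.1 h).2)
            (by positivity)
        linarith
      have := mul_nonneg (inv_nonneg.2 hρ.le) (wt_nonneg σ η)
      linarith
    · have h1 := le_wt_one h
      have h2 : wt σ η = wt (σ - 1) η * wt 1 η := by rw [← wt_add, sub_add_cancel]
      have h3 : wt (σ - 1) η ≤ ρ⁻¹ * wt σ η := by
        rw [h2, ← mul_assoc, mul_comm ρ⁻¹, mul_assoc]
        refine le_mul_of_one_le_right (wt_nonneg _ _) ?_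
        calc (1 : ℝ) = ρ⁻¹ * ρ := (inv_mul_cancel₀ hρ.ne').symm
          _ ≤ _ := by gcongr
      linarith
  rw [one_mul, toE_add (MemLp.const_mul hF0 _) (MemLp.const_mul hF _), toE_const_mul _ hF0,
    toE_const_mul _ hF] at key
  refine key.trans ((norm_add_le _ _).trans (le_of_eq ?_))
  rw [norm_smul, norm_smul, Complex.norm_real, Complex.norm_real, Real.norm_of_nonneg h0,
    Real.norm_of_nonneg (inv_nonneg.2 hρ.le)]
  rfl

section Ch

variable {s κ ε δ : ℝ} (hs : 1 / 2 < s) (hκ : |κ| = 1) (hε : 0 ≤ ε)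
  (hε1 : ε ≤ 1) (hδ : 0 ≤ δ) (hδ1 : δ ≤ 1)

include hs hκ hε hε1 hδ hδ1 in
-- The difference is the part of the quadratic term outside the band. One derivative is lost in
-- `chKer`, and a second one pays for `n⁻¹`.
lemma norm_galRhs_sub_chRhs_le {τ σ n R : ℝ} (hτ : 0 ≤ τ) (h : τ + 2 ≤ σ) (hσ : s + 2 ≤ σ)
    (hn : 0 < n) {W : ℝ → ℂ} (hW : InH σ W) (hR : ‖lift σ W‖ ≤ R) :
    ‖lift τ (galRhs n κ ε δ W) - lift τ (chRhs κ ε δ W)‖ ≤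
      n⁻¹ * (2 * (2 * 2 ^ (τ + 1)) * embC s * R ^ 2) := by
  obtain ⟨hB, hBn⟩ := norm_bil_chKer_le hs hδ hδ1 (τ := τ + 1) (by linarith) (by linarith)
    (by linarith) hW
  obtain ⟨hC, hCn⟩ := norm_lift_band_sub_le (τ := τ) le_rfl hn hB
  have hBτ := hB.mono (show τ ≤ τ + 1 by linarith)
  have hT : bil (trunc n (chKer δ)) W W = fun η => (band n η : ℂ) * bil (chKer δ) W W η :=
    funext fun η => bil_trunc n _ W W η
  have hL : InH τ (chLin κ δ W) := inH_chLin hκ (hW.mono (by linarith))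
  have e : lift τ (galRhs n κ ε δ W) = lift τ (chLin κ δ W) -
      ((κ * ε : ℝ) : ℂ) • lift τ (fun η => (band n η : ℂ) * bil (chKer δ) W W η) := by
    rw [← lift_const_mul _ hC, ← lift_sub hL (hC.const_mul _)]
    congr 1
    funext η
    rw [galRhs, hT]
  rw [e, lift_chRhs hs hκ hδ hδ1 hτ (by linarith) (by linarith) hW, sub_sub_sub_cancel_left,
    ← smul_sub, norm_smul, Complex.norm_real, Real.norm_eq_abs, abs_mul, hκ, one_mul,
    abs_of_nonneg hε, norm_sub_rev]
  have emb := embC_nonneg s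
  have h2 : ‖lift σ W‖ ^ 2 ≤ R ^ 2 := pow_le_pow_left₀ (norm_nonneg _) hR 2
  calc _ ≤ 1 * (n⁻¹ * (2 * (2 * 2 ^ (τ + 1)) * embC s * R ^ 2)) := by
        refine mul_le_mul hε1 (hCn.trans ?_) (norm_nonneg _) zero_le_one
        refine mul_le_mul_of_nonneg_left (hBn.trans ?_) (by positivity)
        gcongr
    _ = _ := one_mul _

include hs hκ hε hε1 hδ hδ1 in
lemma continuousOn_lift_chRhs {τ : ℝ} (hτ : s ≤ τ) {S : Set ℝ} {W : ℝ → ℝ → ℂ}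
    (hW : ∀ t ∈ S, InH (τ + 1) (W t)) (hc : ContinuousOn (fun t => lift (τ + 1) (W t)) S) :
    ContinuousOn (fun t => lift τ (chRhs κ ε δ (W t))) S := by
  intro t ht
  have h1 := hc t ht
  rw [ContinuousWithinAt, tendsto_iff_norm_sub_tendsto_zero]
  have h2 : Tendsto (fun r => (1 + 2 * (2 * 2 ^ τ) * embC s *
      ‖lift (τ + 1) (W r) + lift (τ + 1) (W t)‖) * ‖lift (τ + 1) (W r) - lift (τ + 1) (W t)‖)
      (𝓝[S] t) (𝓝 0) := by
    have h3 := (h1.sub (continuousWithinAt_const (b := lift (τ + 1) (W t)))).norm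
    have h4 := ((h1.add (continuousWithinAt_const (b := lift (τ + 1) (W t)))).norm.const_mul
      (2 * (2 * 2 ^ τ) * embC s)).const_add 1
    have h5 := Filter.Tendsto.mul h4 h3
    simpa using h5
  refine squeeze_zero' (Eventually.of_forall fun r => norm_nonneg _) ?_ h2
  filter_upwards [self_mem_nhdsWithin] with r hr
  exact norm_chRhs_sub_le hs hκ hε hε1 hδ hδ1 hτ (hW r hr) (hW t ht)

include hs hκ hε hε1 hδ hδ1 in
/-- Existence of solutions of the Camassa-Holm equation on long time intervals. -/
theorem exists_ch {T N₀ M₀ R σ : ℝ} (hσ : s + 2 ≤ σ) (hT : 0 ≤ T)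
    (hR : R = (N₀ + 1) * Real.exp (chC s σ * (M₀ + 1) * T))
    (hsmall : ε * chC s σ * (2 * R) ^ 2 * T ≤ 1) {W₀ : ℝ → ℂ} (hW₀ : InH σ W₀)
    (hH₀ : HermAE W₀) (hN : ‖lift σ W₀‖ ≤ N₀) (hM : ‖lift (σ - 1) W₀‖ ≤ M₀) :
    ∃ W : ℝ → ℝ → ℂ, W 0 =ᵐ[volume] W₀ ∧
      ContinuousOn (fun t => lift (σ - 1) (W t)) (Icc 0 T) ∧
      ∀ t ∈ Icc 0 T, InH (σ - 1) (W t) ∧ HermAE (W t) ∧ ‖lift (σ - 1) (W t)‖ ≤ M₀ + 1 ∧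
        HasDerivWithinAt (fun τ => lift (σ - 2) (W τ)) (lift (σ - 2) (chRhs κ ε δ (W t)))
          (Icc 0 T) t := by
  have npos : ∀ n : ℕ, (0 : ℝ) < n + 1 := fun n => by positivity
  choose W hW0 hW using fun n : ℕ => exists_galerkin hs hσ hκ hε hε1 hδ hδ1 (n + 1 : ℝ) hT hR
    hsmall hW₀ hH₀ hN hM
  have hR0 : 0 ≤ R := (norm_nonneg _).trans (hW 0 0 (left_mem_Icc.2 hT)).2.2.1
  have emb := embC_nonneg s
  have hσ0 : 0 ≤ σ := by linarith
  set A : ℝ → ℝ := fun τ => 2 * (2 * 2 ^ (τ + 1)) * embC s * R ^ 2 with hA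
  have hA0 : ∀ τ, 0 ≤ A τ := fun τ => by positivity
  set c : ℝ := (2 * N₀ + 2 * A 0 * T) * Real.exp (4 * embC s * R * T) with hc
  have hN0 : 0 ≤ N₀ := (norm_nonneg _).trans hN
  have hc0 : 0 ≤ c := mul_nonneg (add_nonneg (by positivity) (mul_nonneg
    (mul_nonneg zero_le_two (hA0 0)) hT)) (Real.exp_pos _).le
  have hder : ∀ (τ : ℝ) (hτσ : τ ≤ σ) (n : ℕ), ∀ t ∈ Icc 0 T,
      HasDerivWithinAt (fun r => lift τ (W n r)) (lift τ (galRhs (n + 1) κ ε δ (W n t)))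
        (Icc 0 T) t := by
    intro τ hτσ n t ht
    have h4 := ((lower τ σ hτσ).restrictScalars ℝ).hasFDerivAt.comp_hasDerivWithinAt t
      (hW n t ht).2.2.2.2.2
    have e : ∀ x ∈ Icc 0 T, lift τ (W n x) = lower τ σ hτσ (lift σ (W n x)) := fun x hx =>
      (lower_lift hτσ (hW n x hx).1).symm
    have e2 := lower_lift hτσ (hW n t ht).2.2.2.2.1
    simp only [ContinuousLinearMap.coe_restrictScalars', e2] at h4
    exact h4.congr e (e t ht)
  -- In `L²` the truncated data and the truncated equation are both accurate to order `1/(p + 1)`.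
  -- The constant `c` collects the initial errors, the consistency errors and the exponential factor
  -- of `ch_stability`.
  have hL2 : ∀ p m n : ℕ, p ≤ m → p ≤ n → ∀ t ∈ Icc 0 T,
      ‖lift 0 (W m t) - lift 0 (W n t)‖ ≤ ((p : ℝ) + 1)⁻¹ * c := by
    intro p m n hm hn t ht
    have hinv : ∀ q : ℕ, p ≤ q → ((q : ℝ) + 1)⁻¹ ≤ ((p : ℝ) + 1)⁻¹ := fun q hq => by
      have : (p : ℝ) ≤ q := by exact_mod_cast hq
      gcongr
    have h1 := ch_stability hs hκ hε hε1 hδ hδ1 (T := T) (R := R) (a := ((p : ℝ) + 1)⁻¹ * A 0)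
      (mul_nonneg (by positivity) (hA0 0)) (W := fun i => cond i (W m) (W n))
      (D := fun i r => lift 0 (cond i (galRhs (m + 1) κ ε δ (W m r)) (galRhs (n + 1) κ ε δ (W n r))))
      (fun i r hr => by
        have key : ∀ q : ℕ, p ≤ q → InH (s + 2) (W q r) ∧ HermAE (W q r) ∧
            ‖lift (s + 2) (W q r)‖ ≤ R ∧
            ‖lift 0 (galRhs (q + 1) κ ε δ (W q r)) - lift 0 (chRhs κ ε δ (W q r))‖ ≤
              ((p : ℝ) + 1)⁻¹ * A 0 ∧
            HasDerivWithinAt (fun τ => lift 0 (W q τ)) (lift 0 (galRhs (q + 1) κ ε δ (W q r)))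
              (Icc 0 T) r := by
          intro q hq
          obtain ⟨a1, a2, a3, a4, a5, a6⟩ := hW q r hr
          refine ⟨a1.mono hσ, a2.hermAE, (norm_lift_mono a1 hσ).trans a3, ?_,
            hder 0 hσ0 q r hr⟩
          refine (norm_galRhs_sub_chRhs_le hs hκ hε hε1 hδ hδ1 le_rfl (by linarith) hσ (npos q)
            a1 a3).trans ?_
          exact mul_le_mul_of_nonneg_right (hinv q hq) (hA0 0)
        cases i
        · exact key n hn
        · exact key m hm) t ht
    simp only [cond_true, cond_false] at h1
    have h2 : ∀ q : ℕ, p ≤ q → ‖lift 0 (W q 0) - lift 0 W₀‖ ≤ ((p : ℝ) + 1)⁻¹ * N₀ := by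
      intro q hq
      rw [lift_congr (hW0 q)]
      refine (norm_lift_band_sub_le (σ := σ) (by linarith) (npos q) hW₀).2.trans ?_
      exact mul_le_mul (hinv q hq) hN (norm_nonneg _) (by positivity)
    have h3 : ‖lift 0 (W m 0) - lift 0 (W n 0)‖ ≤ ((p : ℝ) + 1)⁻¹ * (2 * N₀) := by
      have := norm_sub_le (lift 0 (W m 0) - lift 0 W₀) (lift 0 (W n 0) - lift 0 W₀)
      rw [sub_sub_sub_cancel_right] at this
      linarith [h2 m hm, h2 n hn]
    refine h1.trans ?_
    have hA00 := hA0 0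
    calc _ ≤ (((p : ℝ) + 1)⁻¹ * (2 * N₀) + 2 * (((p : ℝ) + 1)⁻¹ * A 0) * T) *
          Real.exp (4 * embC s * R * T) := by
          have := ht.2
          gcongr
      _ = _ := by rw [hc]; ring
  set f : ℕ → ℝ → E := fun n t => lift (σ - 1) (W n t) with hf
  have hUC : UniformCauchySeqOn f atTop (Icc 0 T) := by
    rw [Metric.uniformCauchySeqOn_iff]
    intro e he
    -- This makes the high frequency term `ρ⁻¹ * (2 * R)` smaller than `e / 2`; afterwards `p` is
    -- chosen for the low frequency term.
    set ρ : ℝ := 4 * (R + 1) / e with hρ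
    have hρ0 : 0 < ρ := by positivity
    have hwpos : 0 < wt (σ - 1) ρ := wt_pos _ _
    obtain ⟨p, hp⟩ := exists_nat_gt (2 * (wt (σ - 1) ρ * c) / e)
    refine ⟨p, fun m hm n hn t ht => ?_⟩
    have a1 := hW m t ht
    have a2 := hW n t ht
    have hI := norm_lift_interp (σ := σ) (by linarith) hρ0 (a1.1.sub a2.1)
    rw [lift_sub (a1.1.mono (by linarith)) (a2.1.mono (by linarith)),
      lift_sub (a1.1.mono hσ0) (a2.1.mono hσ0), lift_sub a1.1 a2.1] at hI
    rw [dist_eq_norm]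
    have h1 := hL2 p m n hm hn t ht
    have h2 : ‖lift σ (W m t) - lift σ (W n t)‖ ≤ 2 * R :=
      (norm_sub_le _ _).trans (by linarith [a1.2.2.1, a2.2.2.1])
    have h3 : ρ⁻¹ * (2 * R) < e / 2 := by
      rw [hρ, inv_div, div_mul_eq_mul_div, div_lt_div_iff₀ (by positivity) (by positivity)]
      nlinarith
    have h4 : wt (σ - 1) ρ * (((p : ℝ) + 1)⁻¹ * c) ≤ e / 2 := by
      have hp1 : 2 * (wt (σ - 1) ρ * c) ≤ ((p : ℝ) + 1) * e := by
        rw [div_lt_iff₀ he] at hp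
        nlinarith
      rw [show wt (σ - 1) ρ * (((p : ℝ) + 1)⁻¹ * c) = (wt (σ - 1) ρ * c) / ((p : ℝ) + 1) by
        rw [div_eq_mul_inv]; ring, div_le_div_iff₀ (npos p) zero_lt_two]
      linarith
    calc _ ≤ wt (σ - 1) ρ * (((p : ℝ) + 1)⁻¹ * c) + ρ⁻¹ * (2 * R) := hI.trans (by gcongr)
      _ < e := by linarith
  have hlim : ∀ t : ℝ, ∃ g : E, t ∈ Icc 0 T → Tendsto (fun n => f n t) atTop (𝓝 g) := fun t => by
    by_cases ht : t ∈ Icc 0 T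
    · obtain ⟨g, hg⟩ := cauchySeq_tendsto_of_complete (hUC.cauchySeq ht)
      exact ⟨g, fun _ => hg⟩
    · exact ⟨0, fun h => (ht h).elim⟩
  choose g hg using hlim
  have hTU : TendstoUniformlyOn f g atTop (Icc 0 T) :=
    hUC.tendstoUniformlyOn_of_tendsto fun t ht => hg t ht
  have hgc : ContinuousOn g (Icc 0 T) := hTU.continuousOn (Frequently.of_forall fun n t ht =>
    (hder (σ - 1) (by linarith) n t ht).continuousWithinAt)
  have hgn : ∀ t ∈ Icc 0 T, ‖g t‖ ≤ M₀ + 1 := fun t ht =>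
    le_of_tendsto (hg t ht).norm (Eventually.of_forall fun n => (hW n t ht).2.2.2.1)
  have low : σ - 2 ≤ σ - 1 := by linarith
  refine ⟨fun t => unlift (σ - 1) (g t), ?_, by simpa only [lift_unlift] using hgc,
    fun t ht => ⟨inH_unlift _ _, ?_, by rw [lift_unlift]; exact hgn t ht, ?_⟩⟩
  · have h0 : (0 : ℝ) ∈ Icc 0 T := left_mem_Icc.2 hT
    refine lift_inj (inH_unlift _ _) (hW₀.mono (by linarith)) ?_
    rw [lift_unlift]
    refine tendsto_nhds_unique (hg 0 h0) ?_
    rw [tendsto_iff_norm_sub_tendsto_zero]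
    refine squeeze_zero (g := fun n : ℕ => ((n : ℝ) + 1)⁻¹ * N₀) (fun n => norm_nonneg _)
      (fun n => ?_) ?_
    · rw [hf]
      dsimp only
      rw [lift_congr (hW0 n)]
      refine (norm_lift_band_sub_le (σ := σ) (by linarith) (npos n) hW₀).2.trans ?_
      gcongr
    · simpa [one_div] using (tendsto_one_div_add_atTop_nhds_zero_nat (𝕜 := ℝ)).mul_const N₀
  · exact hermAE_unlift (isClosed_hermSub.mem_of_tendsto (hg t ht) (Eventually.of_forall fun n =>
      hermAE_lift ((hW n t ht).1.mono (by linarith)) (hW n t ht).2.1.hermAE))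
  -- Uniform convergence of the derivatives in `H^{σ-2}`: the consistency error tends to `0`, and
  -- `chRhs` is Lipschitz from bounded sets of `H^{σ-1}` to `H^{σ-2}`.
  · refine hasDerivWithinAt_of_uniform (f := fun n r => lift (σ - 2) (W n r))
      (f' := fun n r => lift (σ - 2) (galRhs (n + 1) κ ε δ (W n r)))
      (F := fun r => lift (σ - 2) (unlift (σ - 1) (g r)))
      (G := fun r => lift (σ - 2) (chRhs κ ε δ (unlift (σ - 1) (g r))))
      (hder (σ - 2) (by linarith)) (fun r hr => ?_) ?_ t ht
    · have := ((lower (σ - 2) (σ - 1) low).continuous.tendsto (g r)).comp (hg r hr)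
      rw [← lower_eq_lift_unlift low]
      refine this.congr fun n => ?_
      exact lower_lift low ((hW n r hr).1.mono (by linarith))
    · set B : ℝ := 1 + 2 * (2 * 2 ^ (σ - 2)) * embC s * (2 * (M₀ + 1)) with hB
      have hM0 : 0 ≤ M₀ := (norm_nonneg _).trans hM
      have hBpos : 0 < B := by positivity
      rw [Metric.tendstoUniformlyOn_iff]
      intro e he
      have hev := Metric.tendstoUniformlyOn_iff.1 hTU (e / (2 * B)) (by positivity)
      have hev2 : ∀ᶠ n : ℕ in atTop, ((n : ℝ) + 1)⁻¹ * A (σ - 2) < e / 2 := by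
        have : Tendsto (fun n : ℕ => ((n : ℝ) + 1)⁻¹ * A (σ - 2)) atTop (𝓝 0) := by
          simpa [one_div] using
            (tendsto_one_div_add_atTop_nhds_zero_nat (𝕜 := ℝ)).mul_const (A (σ - 2))
        exact this.eventually_lt_const (by positivity)
      filter_upwards [hev, hev2] with n h1 h2 r hr
      obtain ⟨a1, a2, a3, a4, a5, a6⟩ := hW n r hr
      have h3 := h1 r hr
      rw [dist_comm, dist_eq_norm] at h3 ⊢
      have k1 := norm_galRhs_sub_chRhs_le hs hκ hε hε1 hδ hδ1 (τ := σ - 2) (by linarith)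
        (by linarith) hσ (npos n) a1 a3
      have eσ : σ - 2 + 1 = σ - 1 := by ring
      have k2 := norm_chRhs_sub_le hs hκ hε hε1 hδ hδ1 (τ := σ - 2) (by linarith)
        (F := W n r) (G := unlift (σ - 1) (g r)) (by rw [eσ]; exact a1.mono (by linarith))
        (by rw [eσ]; exact inH_unlift _ _)
      rw [eσ, lift_unlift] at k2
      have k3 : ‖lift (σ - 1) (W n r) + g r‖ ≤ 2 * (M₀ + 1) :=
        (norm_add_le _ _).trans (by linarith [hgn r hr])
      have k4 : B * ‖lift (σ - 1) (W n r) - g r‖ < e / 2 := by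
        rw [lt_div_iff₀ (by positivity)] at h3
        rw [hf] at h3
        dsimp only at h3
        linarith
      have k5 : ‖lift (σ - 2) (chRhs κ ε δ (W n r)) -
          lift (σ - 2) (chRhs κ ε δ (unlift (σ - 1) (g r)))‖ ≤
          B * ‖lift (σ - 1) (W n r) - g r‖ := k2.trans (by rw [hB]; gcongr)
      have k6 := norm_sub_le_norm_sub_add_norm_sub
        (lift (σ - 2) (galRhs (n + 1) κ ε δ (W n r))) (lift (σ - 2) (chRhs κ ε δ (W n r)))
        (lift (σ - 2) (chRhs κ ε δ (unlift (σ - 1) (g r))))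
      linarith

end Ch

/-! ### The improved Boussinesq equation -/

/-- The square root of `1 + δ² ξ²`. -/
def ibRt (δ ξ : ℝ) : ℝ := Real.sqrt (1 + δ ^ 2 * ξ ^ 2)

/-- The dispersion relation of the improved Boussinesq equation. -/
def ibOm (δ ξ : ℝ) : ℝ := ξ / ibRt δ ξ

lemma ibRt_sq (δ ξ : ℝ) : ibRt δ ξ ^ 2 = 1 + δ ^ 2 * ξ ^ 2 := Real.sq_sqrt (by positivity)

lemma one_le_ibRt (δ ξ : ℝ) : 1 ≤ ibRt δ ξ := Real.one_le_sqrt.2 (by nlinarith [sq_nonneg (δ * ξ)])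

lemma ibRt_pos (δ ξ : ℝ) : 0 < ibRt δ ξ := one_pos.trans_le (one_le_ibRt δ ξ)

lemma ibRt_neg (δ ξ : ℝ) : ibRt δ (-ξ) = ibRt δ ξ := by simp [ibRt]

lemma ibOm_neg (δ ξ : ℝ) : ibOm δ (-ξ) = -ibOm δ ξ := by simp [ibOm, ibRt_neg, neg_div]

lemma ibOm_mul_ibRt (δ ξ : ℝ) : ibOm δ ξ * ibRt δ ξ = ξ := div_mul_cancel₀ _ (ibRt_pos δ ξ).ne'

lemma ibOm_sq_mul (δ ξ : ℝ) : (1 + δ ^ 2 * ξ ^ 2) * ibOm δ ξ ^ 2 = ξ ^ 2 := by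
  rw [← ibRt_sq, ← mul_pow, mul_comm, ibOm_mul_ibRt]

lemma abs_ibOm_le (δ ξ : ℝ) : |ibOm δ ξ| ≤ |ξ| := by
  rw [ibOm, abs_div, abs_of_pos (ibRt_pos δ ξ)]
  exact div_le_self (abs_nonneg _) (one_le_ibRt δ ξ)

/-- The term `u_xxtt` makes the symbol bounded for fixed `δ > 0`; so the IB equation is an ordinary
differential equation in `H^σ` and needs no truncation. -/
lemma mul_abs_ibOm_le {δ : ℝ} (hδ : 0 ≤ δ) (ξ : ℝ) : δ * |ibOm δ ξ| ≤ 1 := by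
  have h : (δ * |ibOm δ ξ|) ^ 2 ≤ 1 := by
    rw [mul_pow, sq_abs]
    nlinarith [ibOm_sq_mul δ ξ, sq_nonneg (ibOm δ ξ), sq_nonneg (δ * ξ), sq_nonneg ξ,
      sq_nonneg (δ * ibOm δ ξ), ibRt_sq δ ξ, mul_nonneg (sq_nonneg δ) (sq_nonneg ξ),
      mul_nonneg (mul_nonneg (sq_nonneg δ) (sq_nonneg ξ)) (sq_nonneg (δ * ibOm δ ξ))]
  exact (sq_le_one_iff₀ (by positivity)).1 h

lemma ibRt_sub_one_le (δ ξ : ℝ) : |ibRt δ ξ - 1| ≤ δ ^ 2 * ξ ^ 2 := by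
  have h := one_le_ibRt δ ξ
  rw [abs_of_nonneg (by linarith)]
  nlinarith [ibRt_sq δ ξ]

@[fun_prop] lemma continuous_ibRt (δ : ℝ) : Continuous (ibRt δ) := by unfold ibRt; fun_prop

@[fun_prop] lemma continuous_ibOm (δ : ℝ) : Continuous (ibOm δ) :=
  continuous_id.div (continuous_ibRt δ) fun ξ => (ibRt_pos δ ξ).ne'

/-- The kernel of the ordinary convolution. -/
def oneKer (_ _ : ℝ) : ℂ := 1

lemma measurable_oneKer : Measurable (Function.uncurry oneKer) := measurable_const

lemma oneKer_symm (x y : ℝ) : oneKer x y = oneKer y x := rfl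

lemma conj_oneKer (x y : ℝ) : oneKer (-x) (-y) = starRingEnd ℂ (oneKer x y) := (map_one _).symm

lemma oneKer_le {σ : ℝ} (hσ : 0 ≤ σ) (x y : ℝ) :
    ‖oneKer x y‖ * wt σ (x + y) ≤ 2 ^ σ * (wt 0 x * wt σ y + wt σ x * wt 0 y) := by
  rw [oneKer, norm_one, one_mul, wt_zero, wt_zero, one_mul, mul_one, add_comm (wt σ y)]
  exact wt_add_arg_le hσ x y

/-- Sobolev spaces above the critical order are algebras. -/
lemma norm_conv_le {s σ : ℝ} (hs : 1 / 2 < s) (hσ : s ≤ σ) {F : ℝ → ℂ} (hF : InH σ F) :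
    InH σ (bil oneKer F F) ∧
      ‖lift σ (bil oneKer F F)‖ ≤ 2 * 2 ^ σ * embC s * ‖lift σ F‖ ^ 2 :=
  norm_lift_bil_le measurable_oneKer hs (by positivity) (oneKer_le (by linarith)) (by linarith) hF

/-- One factor is always measured in the `L¹` norm of its transform, for which `H^{σ-1}` suffices.
-/
lemma norm_conv_tame {s σ : ℝ} (hs : 1 / 2 < s) (hσ : s + 1 ≤ σ) {F : ℝ → ℂ} (hF : InH σ F) :
    ‖lift σ (bil oneKer F F)‖ ≤ 2 * 2 ^ σ * embC s * ‖lift (σ - 1) F‖ * ‖lift σ F‖ := by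
  have hF1 : InL1 0 F := hF.inL1_of_le hs (by linarith)
  have h := (bilBound measurable_oneKer (by positivity) (oneKer_le (σ := σ) (by linarith)) hF hF
    hF1 hF1).norm_le
  have l := l1_le_of_le hs (j := 0) (hF.mono (show σ - 1 ≤ σ by linarith)) (by linarith)
  refine h.trans ?_
  calc _ ≤ 2 ^ σ * ((embC s * ‖lift (σ - 1) F‖) * ‖lift σ F‖ +
        ‖lift σ F‖ * (embC s * ‖lift (σ - 1) F‖)) := by gcongr
    _ = _ := by ring

lemma norm_conv_sub_le {s σ : ℝ} (hs : 1 / 2 < s) (hσ : s ≤ σ) {F G : ℝ → ℂ} (hF : InH σ F)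
    (hG : InH σ G) : ‖lift σ (bil oneKer F F) - lift σ (bil oneKer G G)‖ ≤
      2 * 2 ^ σ * embC s * ‖lift σ F + lift σ G‖ * ‖lift σ F - lift σ G‖ :=
  norm_lift_bil_sub_le measurable_oneKer oneKer_symm hs (by positivity) (oneKer_le (by linarith))
    (by linarith) hF hG

/-- The symbol `i ω`. -/
def ibSym (δ η : ℝ) : ℂ := Complex.I * (ibOm δ (freq η) : ℂ)

lemma continuous_ibSym (δ : ℝ) : Continuous (ibSym δ) := by unfold ibSym; fun_prop

lemma norm_ibSym (δ η : ℝ) : ‖ibSym δ η‖ = |ibOm δ (freq η)| := by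
  rw [ibSym, norm_mul, Complex.norm_I, one_mul, Complex.norm_real, Real.norm_eq_abs]

lemma norm_ibSym_le {δ : ℝ} (hδ : 0 < δ) (η : ℝ) : ‖ibSym δ η‖ ≤ δ⁻¹ := by
  rw [norm_ibSym, ← one_div, le_div_iff₀ hδ, mul_comm]
  exact mul_abs_ibOm_le hδ.le _

lemma hermAE_ibSym (δ : ℝ) : HermAE (ibSym δ) :=
  hermAE_of_odd (r := fun η => ibOm δ (freq η)) fun η => by rw [freq_neg, ibOm_neg]

/-- The multiplication with `i ω`. -/
def ibD (δ : ℝ) (hδ : 0 < δ) : E →L[ℂ] E :=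
  mulE (ibSym δ) (continuous_ibSym δ).measurable δ⁻¹ (norm_ibSym_le hδ)

section

variable {δ : ℝ} (hδ : 0 < δ) {σ : ℝ} {F : ℝ → ℂ}

include hδ in
lemma InH.ibSym_mul (hF : InH σ F) : InH σ fun η => ibSym δ η * F η := by
  have := memLp_mul_of_bdd (continuous_ibSym δ).measurable (norm_ibSym_le hδ) hF
  simp only [mul_left_comm (ibSym δ _)] at this
  exact this

lemma ibD_lift (hF : InH σ F) : ibD δ hδ (lift σ F) = lift σ fun η => ibSym δ η * F η := by
  rw [ibD, lift, mulE_toE _ _ hF, lift]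
  simp only [mul_left_comm (ibSym δ _)]

lemma norm_ibD_le (f : E) : ‖ibD δ hδ f‖ ≤ δ⁻¹ * ‖f‖ := norm_mulE_le _ _ f

lemma inner_ibD (f : E) : inner ℝ f (ibD δ hδ f) = 0 := by
  have h := inH_unlift 0 f
  rw [← lift_unlift 0 f, ibD_lift hδ h]
  exact real_inner_imag 0 h (h.ibSym_mul hδ) fun η => rfl

lemma hermAE_ibD {f : E} (hf : HermAE f) : HermAE (ibD δ hδ f) :=
  ((hermAE_ibSym δ).mul hf).congr (coeFn_mulE _ _ f).symm

lemma lower_ibD {τ : ℝ} (h : τ ≤ σ) (f : E) :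
    lower τ σ h (ibD δ hδ f) = ibD δ hδ (lower τ σ h f) := by
  have h1 := inH_unlift σ f
  rw [← lift_unlift σ f, ibD_lift hδ h1, lower_lift h (h1.ibSym_mul hδ), lower_lift h h1,
    ibD_lift hδ (h1.mono h)]

/-- `|ω| ≤ |ξ|` costs a derivative but, in contrast to `norm_ibD_le`, is uniform in `δ`. -/
lemma norm_lower_ibD_le {τ : ℝ} (h : τ + 1 ≤ σ) (f : E) :
    ‖lower τ σ (by linarith) (ibD δ hδ f)‖ ≤ ‖f‖ := by
  have h1 := inH_unlift σ f
  rw [← lift_unlift σ f, ibD_lift hδ h1, lower_lift _ (h1.ibSym_mul hδ)]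
  have := norm_lift_le zero_le_one h1 (σ := τ) (F := fun η => ibSym δ η * unlift σ f η)
    (Eventually.of_forall fun η => by
    have h2 := wt_mono h η
    rw [wt_add] at h2
    have h3 := (abs_ibOm_le δ (freq η)).trans (abs_freq_le η)
    have := wt_nonneg τ η
    rw [norm_mul, norm_ibSym, one_mul]
    calc _ ≤ wt τ η * (wt 1 η * ‖unlift σ f η‖) := by gcongr
      _ = wt τ η * wt 1 η * ‖unlift σ f η‖ := by ring
      _ ≤ _ := by gcongr)
  rwa [one_mul] at this

end

/-! ### The vector field in Riemann coordinates -/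

/-- The growth constant of the improved Boussinesq equation in `H^σ`. -/
def ibC (s σ : ℝ) : ℝ := 4 * 2 ^ σ * embC s

lemma ibC_nonneg (s σ : ℝ) : 0 ≤ ibC s σ := by
  have := embC_nonneg s
  unfold ibC; positivity

/-- The square of half the sum, on the Fourier side and at level `σ`. -/
def ibSq (σ : ℝ) (x : WithLp 2 (E × E)) : E :=
  lift σ (bil oneKer (unlift σ ((1 / 2 : ℂ) • (x.fst + x.snd)))
    (unlift σ ((1 / 2 : ℂ) • (x.fst + x.snd))))

/-- The vector field of the improved Boussinesq equation in Riemann coordinates. -/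
def ibV (ε δ : ℝ) (hδ : 0 < δ) (σ : ℝ) (x : WithLp 2 (E × E)) : WithLp 2 (E × E) :=
  WithLp.toLp 2 (ibD δ hδ (x.fst + (ε : ℂ) • ibSq σ x), -ibD δ hδ (x.snd + (ε : ℂ) • ibSq σ x))

/-- The inclusion of `H^σ × H^σ` into `H^τ × H^τ`. -/
def lower₂ (τ σ : ℝ) (h : τ ≤ σ) : WithLp 2 (E × E) →L[ℝ] WithLp 2 (E × E) :=
  (WithLp.prodContinuousLinearEquiv 2 ℝ E E).symm.toContinuousLinearMap ∘L
    (((lower τ σ h).restrictScalars ℝ).prodMap ((lower τ σ h).restrictScalars ℝ)) ∘L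
    (WithLp.prodContinuousLinearEquiv 2 ℝ E E).toContinuousLinearMap

lemma lower₂_fst {τ σ : ℝ} (h : τ ≤ σ) (x : WithLp 2 (E × E)) :
    (lower₂ τ σ h x).fst = lower τ σ h x.fst := rfl

lemma lower₂_snd {τ σ : ℝ} (h : τ ≤ σ) (x : WithLp 2 (E × E)) :
    (lower₂ τ σ h x).snd = lower τ σ h x.snd := rfl

lemma norm_fst_le (x : WithLp 2 (E × E)) : ‖x.fst‖ ≤ ‖x‖ := by
  have := WithLp.prod_norm_sq_eq_of_L2 x
  exact abs_le_of_sq_le_sq' (by nlinarith [sq_nonneg ‖x.snd‖]) (norm_nonneg _) |>.2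

lemma norm_snd_le (x : WithLp 2 (E × E)) : ‖x.snd‖ ≤ ‖x‖ := by
  have := WithLp.prod_norm_sq_eq_of_L2 x
  exact abs_le_of_sq_le_sq' (by nlinarith [sq_nonneg ‖x.fst‖]) (norm_nonneg _) |>.2

lemma norm_le_fst_add_snd (x : WithLp 2 (E × E)) : ‖x‖ ≤ ‖x.fst‖ + ‖x.snd‖ := by
  have := WithLp.prod_norm_sq_eq_of_L2 x
  exact abs_le_of_sq_le_sq' (by nlinarith [norm_nonneg x.fst, norm_nonneg x.snd])
    (by positivity) |>.2

lemma norm_half_le (x : WithLp 2 (E × E)) : ‖(1 / 2 : ℂ) • (x.fst + x.snd)‖ ≤ ‖x‖ := by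
  have h1 := norm_fst_le x
  have h2 := norm_snd_le x
  have h3 := norm_add_le x.fst x.snd
  rw [norm_smul]
  norm_num
  linarith

section Ib

variable {s σ ε δ : ℝ} (hs : 1 / 2 < s) (hσ : s + 1 ≤ σ) (hε : 0 ≤ ε) (hεδ : ε ≤ δ) (hδ : 0 < δ)

include hs hσ in
lemma norm_ibSq_le (x : WithLp 2 (E × E)) :
    ‖ibSq σ x‖ ≤ 2 * 2 ^ σ * embC s * ‖lower₂ (σ - 1) σ (by linarith) x‖ * ‖x‖ := by
  have h := norm_conv_tame hs hσ (inH_unlift σ ((1 / 2 : ℂ) • (x.fst + x.snd)))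
  have hl : σ - 1 ≤ σ := by linarith
  rw [lift_unlift, ← lower_eq_lift_unlift hl, map_smul, map_add] at h
  have h1 := norm_half_le (lower₂ (σ - 1) σ hl x)
  rw [lower₂_fst, lower₂_snd] at h1
  have emb := embC_nonneg s
  refine h.trans ?_
  gcongr
  exact norm_half_le x

include hs hσ in
lemma norm_ibSq_le' (x : WithLp 2 (E × E)) : ‖ibSq σ x‖ ≤ 2 * 2 ^ σ * embC s * ‖x‖ ^ 2 := by
  have h := (norm_conv_le hs (by linarith : s ≤ σ)
    (inH_unlift σ ((1 / 2 : ℂ) • (x.fst + x.snd)))).2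
  rw [lift_unlift] at h
  have h1 := norm_half_le x
  have emb := embC_nonneg s
  refine h.trans ?_
  gcongr

include hs hσ in
lemma norm_ibSq_sub_le {r : ℝ} (x y : WithLp 2 (E × E)) (hx : ‖x‖ ≤ r) (hy : ‖y‖ ≤ r) :
    ‖ibSq σ x - ibSq σ y‖ ≤ 2 * 2 ^ σ * embC s * (2 * r) * ‖x - y‖ := by
  have h := norm_conv_sub_le hs (by linarith : s ≤ σ)
    (inH_unlift σ ((1 / 2 : ℂ) • (x.fst + x.snd))) (inH_unlift σ ((1 / 2 : ℂ) • (y.fst + y.snd)))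
  rw [lift_unlift, lift_unlift] at h
  have h1 := norm_half_le (x - y)
  have e : (1 / 2 : ℂ) • ((x - y).fst + (x - y).snd) =
      (1 / 2 : ℂ) • (x.fst + x.snd) - (1 / 2 : ℂ) • (y.fst + y.snd) := by
    rw [← smul_sub, WithLp.sub_fst, WithLp.sub_snd]; congr 1; abel
  rw [e] at h1
  have h2 := norm_half_le x
  have h3 := norm_half_le y
  have h4 := norm_add_le ((1 / 2 : ℂ) • (x.fst + x.snd)) ((1 / 2 : ℂ) • (y.fst + y.snd))
  have emb := embC_nonneg s
  refine h.trans ?_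
  have h5 : ‖(1 / 2 : ℂ) • (x.fst + x.snd) + (1 / 2 : ℂ) • (y.fst + y.snd)‖ ≤ 2 * r := by linarith
  have hr : 0 ≤ r := (norm_nonneg x).trans hx
  gcongr

include hε hεδ in
-- The role of `ε ≤ δ`: since `ε |ω| ≤ ε/δ ≤ 1`, the nonlinearity loses no derivative, uniformly in
-- both parameters.
lemma norm_smul_ibD_le (f : E) : ‖(ε : ℂ) • ibD δ hδ f‖ ≤ ‖f‖ := by
  rw [norm_smul, Complex.norm_real, Real.norm_of_nonneg hε]
  have h := norm_ibD_le hδ f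
  calc _ ≤ δ * (δ⁻¹ * ‖f‖) := by gcongr
    _ = ‖f‖ := by field_simp

include hs hσ hε hεδ in
lemma ibV_lipschitz {r : ℝ} (x y : WithLp 2 (E × E)) (hx : ‖x‖ ≤ r) (hy : ‖y‖ ≤ r) :
    ‖ibV ε δ hδ σ x - ibV ε δ hδ σ y‖ ≤
      2 * (δ⁻¹ + 2 * 2 ^ σ * embC s * (2 * r)) * ‖x - y‖ := by
  have hq := norm_ibSq_sub_le hs hσ x y hx hy
  have key : ∀ a b : E, ‖a - b‖ ≤ ‖x - y‖ →
      ‖ibD δ hδ (a + (ε : ℂ) • ibSq σ x) - ibD δ hδ (b + (ε : ℂ) • ibSq σ y)‖ ≤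
      (δ⁻¹ + 2 * 2 ^ σ * embC s * (2 * r)) * ‖x - y‖ := by
    intro a b hab
    have e : ibD δ hδ (a + (ε : ℂ) • ibSq σ x) - ibD δ hδ (b + (ε : ℂ) • ibSq σ y) =
        ibD δ hδ (a - b) + (ε : ℂ) • ibD δ hδ (ibSq σ x - ibSq σ y) := by
      simp only [map_add, map_sub, map_smul, smul_sub]; abel
    rw [e, add_mul]
    refine (norm_add_le _ _).trans (add_le_add ((norm_ibD_le hδ _).trans ?_)
      ((norm_smul_ibD_le hε hεδ hδ _).trans hq))
    gcongr
  refine (norm_le_fst_add_snd _).trans ?_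
  have h1 := key x.fst y.fst (by rw [← WithLp.sub_fst]; exact norm_fst_le _)
  have h2 := key x.snd y.snd (by rw [← WithLp.sub_snd]; exact norm_snd_le _)
  rw [← norm_neg] at h2
  have e1 : (ibV ε δ hδ σ x - ibV ε δ hδ σ y).fst =
    ibD δ hδ (x.fst + (ε : ℂ) • ibSq σ x) - ibD δ hδ (y.fst + (ε : ℂ) • ibSq σ y) := rfl
  have e2 : (ibV ε δ hδ σ x - ibV ε δ hδ σ y).snd =
    -(ibD δ hδ (x.snd + (ε : ℂ) • ibSq σ x) - ibD δ hδ (y.snd + (ε : ℂ) • ibSq σ y)) := by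
    change -ibD δ hδ (x.snd + (ε : ℂ) • ibSq σ x) - -ibD δ hδ (y.snd + (ε : ℂ) • ibSq σ y) = _
    abel
  rw [e1, e2]
  linarith

/-- The pairs of Hermitian functions. -/
def hermSub₂ : Submodule ℝ (WithLp 2 (E × E)) where
  carrier := {x | x.fst ∈ hermSub ∧ x.snd ∈ hermSub}
  zero_mem' := ⟨hermSub.zero_mem, hermSub.zero_mem⟩
  add_mem' h1 h2 := ⟨hermSub.add_mem h1.1 h2.1, hermSub.add_mem h1.2 h2.2⟩
  smul_mem' c _ h := ⟨hermSub.smul_mem c h.1, hermSub.smul_mem c h.2⟩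

lemma isClosed_hermSub₂ : IsClosed (hermSub₂ : Set (WithLp 2 (E × E))) :=
  (isClosed_hermSub.preimage (WithLp.prod_continuous_ofLp 2 E E).fst).inter
    (isClosed_hermSub.preimage (WithLp.prod_continuous_ofLp 2 E E).snd)

lemma real_smul_mem {f : E} (hf : f ∈ hermSub) (r : ℝ) : (r : ℂ) • f ∈ hermSub := by
  rw [Complex.coe_smul]; exact hermSub.smul_mem r hf

lemma hermAE_half {x : WithLp 2 (E × E)} (hx : x ∈ hermSub₂) :
    HermAE ((1 / 2 : ℂ) • (x.fst + x.snd) : E) := by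
  have := real_smul_mem (hermSub.add_mem hx.1 hx.2) (1 / 2)
  push_cast at this
  exact this

include hs hσ in
lemma ibV_mem {x : WithLp 2 (E × E)} (hx : x ∈ hermSub₂) : ibV ε δ hδ σ x ∈ hermSub₂ := by
  have h0 := hermAE_unlift (σ := σ) (hermAE_half hx)
  have hq : ibSq σ x ∈ hermSub := hermAE_lift (norm_conv_le hs (by linarith) (inH_unlift σ _)).1
    (hermAE_bil conj_oneKer h0 h0)
  exact ⟨hermAE_ibD hδ (hermSub.add_mem hx.1 (real_smul_mem hq ε)),
    hermSub.neg_mem (hermAE_ibD hδ (hermSub.add_mem hx.2 (real_smul_mem hq ε)))⟩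

/-- Skew-adjointness of `iω` removes the linear terms, and the same nonlinear term enters the two
coordinates with opposite signs. -/
lemma inner_ibV (x : WithLp 2 (E × E)) : inner ℝ x (ibV ε δ hδ σ x) =
    inner ℝ (x.fst - x.snd) ((ε : ℂ) • ibD δ hδ (ibSq σ x)) := by
  rw [WithLp.prod_inner_apply]
  change inner ℝ x.fst (ibD δ hδ (x.fst + (ε : ℂ) • ibSq σ x)) +
    inner ℝ x.snd (-ibD δ hδ (x.snd + (ε : ℂ) • ibSq σ x)) = _
  rw [map_add, map_add, map_smul, inner_add_right, inner_neg_right, inner_add_right, inner_ibD,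
    inner_ibD, inner_sub_left]
  ring

lemma norm_fst_sub_snd_le (x : WithLp 2 (E × E)) : ‖x.fst - x.snd‖ ≤ 2 * ‖x‖ :=
  (norm_sub_le _ _).trans (by linarith [norm_fst_le x, norm_snd_le x])

include hs hσ hε hεδ in
lemma inner_ibV_le (x : WithLp 2 (E × E)) : inner ℝ x (ibV ε δ hδ σ x) ≤
    ibC s σ * ‖lower₂ (σ - 1) σ (by linarith) x‖ * ‖x‖ ^ 2 := by
  rw [inner_ibV]
  refine (real_inner_le_norm _ _).trans ?_
  have h1 := (norm_smul_ibD_le hε hεδ hδ _).trans (norm_ibSq_le hs hσ x)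
  calc _ ≤ 2 * ‖x‖ * (2 * 2 ^ σ * embC s * ‖lower₂ (σ - 1) σ (by linarith) x‖ * ‖x‖) :=
        mul_le_mul (norm_fst_sub_snd_le x) h1 (norm_nonneg _) (by positivity)
    _ = _ := by rw [ibC]; ring

include hs hσ hε in
-- In contrast to `inner_ibV_le` the factor `ε` is kept: the descent to `H^{σ-1}` pays for the
-- derivative in `iω`, so `ε` need not be spent on it.
lemma inner_lower_ibV_le (x : WithLp 2 (E × E)) :
    inner ℝ (lower₂ (σ - 1) σ (by linarith) x)
      (lower₂ (σ - 1) σ (by linarith) (ibV ε δ hδ σ x)) ≤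
      ε * ibC s σ * ‖lower₂ (σ - 1) σ (by linarith) x‖ * ‖x‖ ^ 2 := by
  have hl : σ - 1 ≤ σ := by linarith
  set y := lower₂ (σ - 1) σ hl x with hy
  have e : inner ℝ y (lower₂ (σ - 1) σ hl (ibV ε δ hδ σ x)) =
      inner ℝ (y.fst - y.snd) ((ε : ℂ) • lower (σ - 1) σ hl (ibD δ hδ (ibSq σ x))) := by
    rw [WithLp.prod_inner_apply]
    change inner ℝ y.fst (lower (σ - 1) σ hl (ibD δ hδ (x.fst + (ε : ℂ) • ibSq σ x))) +
      inner ℝ y.snd (lower (σ - 1) σ hl (-ibD δ hδ (x.snd + (ε : ℂ) • ibSq σ x))) = _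
    rw [map_add, map_add, map_neg, map_add, map_add, map_smul, map_smul, lower_ibD hδ hl x.fst,
      lower_ibD hδ hl x.snd, lower_ibD hδ hl (ibSq σ x),
      inner_neg_right, inner_add_right, inner_add_right, ← lower₂_fst, ← lower₂_snd, ← hy,
      inner_ibD, inner_ibD, inner_sub_left]
    ring
  rw [e]
  refine (real_inner_le_norm _ _).trans ?_
  rw [norm_smul, Complex.norm_real, Real.norm_of_nonneg hε]
  have h1 := (norm_lower_ibD_le hδ (by linarith : σ - 1 + 1 ≤ σ) (ibSq σ x)).trans
    (norm_ibSq_le' hs hσ x)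
  calc _ ≤ 2 * ‖y‖ * (ε * (2 * 2 ^ σ * embC s * ‖x‖ ^ 2)) :=
        mul_le_mul (norm_fst_sub_snd_le y) (mul_le_mul_of_nonneg_left h1 hε)
          (mul_nonneg hε (norm_nonneg _)) (by positivity)
    _ = _ := by rw [ibC]; ring

/-- The right hand side of the improved Boussinesq equation, solved for `û_tt`. -/
def ibAcc (ε δ : ℝ) (U : ℝ → ℂ) (η : ℝ) : ℂ :=
  ibSym δ η * (ibSym δ η * (U η + (ε : ℂ) * bil oneKer U U η))

/-- The right hand side of the equation for the Riemann coordinate `P`. -/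
def ibRhs (ε δ : ℝ) (U P : ℝ → ℂ) (η : ℝ) : ℂ :=
  ibSym δ η * (P η + (ε : ℂ) * bil oneKer U U η)

/-- The mean value of two functions. -/
def mid (P M : ℝ → ℂ) (η : ℝ) : ℂ := (P η + M η) / 2

include hs hσ hε hεδ hδ in
/-- Existence of solutions of the improved Boussinesq equation, in Riemann coordinates. -/
theorem exists_ib {T N₀ M₀ R : ℝ} (hT : 0 ≤ T)
    (hR : R = (N₀ + 1) * Real.exp (ibC s σ * (M₀ + 1) * T))
    (hsmall : ε * ibC s σ * (2 * R) ^ 2 * T ≤ 1) {P₀ Q₀ : ℝ → ℂ} (hP₀ : InH σ P₀)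
    (hPH : HermAE P₀) (hQ₀ : InH σ Q₀) (hQH : HermAE Q₀)
    (hN : ‖lift σ P₀‖ + ‖lift σ Q₀‖ ≤ N₀)
    (hM : ‖lift (σ - 1) P₀‖ + ‖lift (σ - 1) Q₀‖ ≤ M₀) :
    ∃ P Q : ℝ → ℝ → ℂ, P 0 =ᵐ[volume] P₀ ∧ Q 0 =ᵐ[volume] Q₀ ∧ ∀ t ∈ Icc 0 T,
      InH σ (P t) ∧ InH σ (Q t) ∧ HermAE (P t) ∧ HermAE (Q t) ∧
      ‖lift (σ - 1) (P t)‖ ≤ M₀ + 1 ∧ ‖lift (σ - 1) (Q t)‖ ≤ M₀ + 1 ∧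
      HasDerivWithinAt (fun τ => lift σ (P τ)) (lift σ (ibRhs ε δ (mid (P t) (Q t)) (P t)))
        (Icc 0 T) t ∧
      HasDerivWithinAt (fun τ => lift σ (Q τ))
        (lift σ fun η => -ibRhs ε δ (mid (P t) (Q t)) (Q t) η) (Icc 0 T) t := by
  have hl : σ - 1 ≤ σ := by linarith
  have hM₀ : 0 ≤ M₀ := (add_nonneg (norm_nonneg _) (norm_nonneg _)).trans hM
  have hN₀ : 0 ≤ N₀ := (add_nonneg (norm_nonneg _) (norm_nonneg _)).trans hN
  have emb := embC_nonneg s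
  have hR0 : 0 ≤ R := by rw [hR]; positivity
  obtain ⟨x, hx0, hx⟩ := exists_solution_of_tame (lower₂ (σ - 1) σ hl) hermSub₂ isClosed_hermSub₂
    (V := ibV ε δ hδ σ) (fun x hx => ibV_mem hs hσ hδ hx) (ibC_nonneg s σ) hε hT hM₀
    (L := 2 * (δ⁻¹ + 2 * 2 ^ σ * embC s * (2 * (2 * R)))) (by positivity) hR
    (fun x y hx hy => ibV_lipschitz hs hσ hε hεδ hδ x y hx hy)
    (fun x _ => inner_ibV_le hs hσ hε hεδ hδ x) (fun x _ => inner_lower_ibV_le hs hσ hε hδ x)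
    hsmall (x₀ := WithLp.toLp 2 (lift σ P₀, lift σ Q₀))
    ⟨hermAE_lift hP₀ hPH, hermAE_lift hQ₀ hQH⟩ ((norm_le_fst_add_snd _).trans hN)
    ((norm_le_fst_add_snd _).trans (by
      rw [lower₂_fst, lower₂_snd]
      change ‖lower (σ - 1) σ hl (lift σ P₀)‖ + ‖lower (σ - 1) σ hl (lift σ Q₀)‖ ≤ M₀
      rwa [lower_lift hl hP₀, lower_lift hl hQ₀]))
  refine ⟨fun t => unlift σ (x t).fst, fun t => unlift σ (x t).snd, ?_, ?_, fun t ht => ?_⟩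
  · dsimp only
    rw [hx0]; exact unlift_lift hP₀
  · dsimp only
    rw [hx0]; exact unlift_lift hQ₀
  obtain ⟨hK, hd, -, hb⟩ := hx t ht
  have hmid : mid (unlift σ (x t).fst) (unlift σ (x t).snd) =ᵐ[volume]
      unlift σ ((1 / 2 : ℂ) • ((x t).fst + (x t).snd)) := by
    filter_upwards [Lp.coeFn_smul (1 / 2 : ℂ) ((x t).fst + (x t).snd),
      Lp.coeFn_add (x t).fst (x t).snd] with η h1 h2
    rw [mid, unlift, unlift, unlift, h1, Pi.smul_apply, h2, Pi.add_apply, smul_eq_mul]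
    ring
  have hsq : ibSq σ (x t) = lift σ (bil oneKer (mid (unlift σ (x t).fst) (unlift σ (x t).snd))
      (mid (unlift σ (x t).fst) (unlift σ (x t).snd))) := by
    rw [ibSq, bil_congr hmid hmid]
  have hB : InH σ (bil oneKer (mid (unlift σ (x t).fst) (unlift σ (x t).snd))
      (mid (unlift σ (x t).fst) (unlift σ (x t).snd))) := by
    rw [bil_congr hmid hmid]; exact (norm_conv_le hs (by linarith) (inH_unlift σ _)).1
  have hrhs : ∀ f : E, lift σ (ibRhs ε δ (mid (unlift σ (x t).fst) (unlift σ (x t).snd))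
      (unlift σ f)) = ibD δ hδ (f + (ε : ℂ) • ibSq σ (x t)) := by
    intro f
    have h2 : lift σ (fun η => unlift σ f η + (ε : ℂ) *
        bil oneKer (mid (unlift σ (x t).fst) (unlift σ (x t).snd))
          (mid (unlift σ (x t).fst) (unlift σ (x t).snd)) η) = f + (ε : ℂ) • ibSq σ (x t) := by
      rw [lift_add (inH_unlift σ f) (hB.const_mul _), lift_const_mul _ hB, lift_unlift, hsq]
    rw [← h2, ibD_lift hδ ((inH_unlift σ f).add (hB.const_mul _))]
    rfl
  have hd' := ((WithLp.prodContinuousLinearEquiv 2 ℝ E E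
    ).toContinuousLinearMap.hasFDerivAt.comp_hasDerivWithinAt t hd)
  have hd1 := (hasFDerivAt_fst (𝕜 := ℝ)).comp_hasDerivWithinAt t hd'
  have hd2 := (hasFDerivAt_snd (𝕜 := ℝ)).comp_hasDerivWithinAt t hd'
  refine ⟨inH_unlift σ _, inH_unlift σ _, hermAE_unlift hK.1, hermAE_unlift hK.2, ?_, ?_, ?_, ?_⟩
  · rw [← lower_eq_lift_unlift hl, ← lower₂_fst]
    exact (norm_fst_le _).trans hb
  · rw [← lower_eq_lift_unlift hl, ← lower₂_snd]
    exact (norm_snd_le _).trans hb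
  · simp only [lift_unlift, hrhs]
    exact hd1
  · have e : (lift σ fun η => -ibRhs ε δ (mid (unlift σ (x t).fst) (unlift σ (x t).snd))
        (unlift σ (x t).snd) η) = -ibD δ hδ ((x t).snd + (ε : ℂ) • ibSq σ (x t)) := by
      rw [← hrhs, ← neg_one_smul ℂ (lift σ _), ← lift_const_mul]
      · simp only [neg_one_mul]
      · exact ((inH_unlift σ _).add (hB.const_mul _)).ibSym_mul hδ
    simp only [lift_unlift, e]
    exact hd2

end Ib

/-! ### The second order form of the improved Boussinesq equation -/

/-- The time derivative in terms of the Riemann coordinates. -/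
def ibVel (δ : ℝ) (P Q : ℝ → ℂ) (η : ℝ) : ℂ := ibSym δ η * ((P η - Q η) / 2)

section Ib

variable {s σ ε δ : ℝ} (hs : 1 / 2 < s) (hσ : s ≤ σ) (hε : 0 ≤ ε) (hεδ : ε ≤ δ) (hδ : 0 < δ)

lemma InH.half {F : ℝ → ℂ} (hF : InH σ F) : InH σ fun η => F η / 2 :=
  (hF.const_mul (1 / 2)).congr (Eventually.of_forall fun η => by ring)

lemma lift_half {F : ℝ → ℂ} (hF : InH σ F) : lift σ (fun η => F η / 2) = (1 / 2 : ℂ) • lift σ F := by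
  rw [← lift_const_mul _ hF]; congr 1; ext η; ring

lemma lift_mid {P Q : ℝ → ℂ} (hP : InH σ P) (hQ : InH σ Q) :
    lift σ (mid P Q) = (1 / 2 : ℂ) • (lift σ P + lift σ Q) := by
  rw [← lift_add hP hQ, ← lift_half (hP.add hQ)]; rfl

lemma lift_neg {F : ℝ → ℂ} (hF : InH σ F) : lift σ (fun η => -F η) = -lift σ F := by
  rw [← neg_one_smul ℂ (lift σ F), ← lift_const_mul _ hF]; simp only [neg_one_mul]

include hs hσ hδ in
lemma lift_ibRhs {U P : ℝ → ℂ} (hU : InH σ U) (hP : InH σ P) : InH σ (ibRhs ε δ U P) ∧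
    lift σ (ibRhs ε δ U P) = ibD δ hδ (lift σ P + (ε : ℂ) • lift σ (bil oneKer U U)) := by
  have hB := (norm_conv_le hs hσ hU).1
  refine ⟨(hP.add (hB.const_mul _)).ibSym_mul hδ, ?_⟩
  rw [← lift_const_mul _ hB, ← lift_add hP (hB.const_mul _), ibD_lift hδ (hP.add (hB.const_mul _))]
  rfl

include hs hσ hδ in
lemma lift_ibAcc {U : ℝ → ℂ} (hU : InH σ U) : InH σ (ibAcc ε δ U) ∧ lift σ (ibAcc ε δ U) =
    ibD δ hδ (ibD δ hδ (lift σ U + (ε : ℂ) • lift σ (bil oneKer U U))) := by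
  obtain ⟨h1, h2⟩ := lift_ibRhs (ε := ε) hs hσ hδ hU hU
  refine ⟨h1.ibSym_mul hδ, ?_⟩
  rw [← h2, ibD_lift hδ h1]
  rfl

lemma hasDerivWithinAt_clm (A : E →L[ℂ] E) {f : ℝ → E} {f' : E} {S : Set ℝ} {t : ℝ}
    (h : HasDerivWithinAt f f' S t) : HasDerivWithinAt (fun r => A (f r)) (A f') S t :=
  (A.restrictScalars ℝ).hasFDerivAt.comp_hasDerivWithinAt t h

include hs hσ hδ in
/-- The solutions in Riemann coordinates satisfy the second order equation. -/
theorem ib_second_order {T : ℝ} {P Q : ℝ → ℝ → ℂ} (h : ∀ t ∈ Icc 0 T,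
      InH σ (P t) ∧ InH σ (Q t) ∧
      HasDerivWithinAt (fun τ => lift σ (P τ)) (lift σ (ibRhs ε δ (mid (P t) (Q t)) (P t)))
        (Icc 0 T) t ∧
      HasDerivWithinAt (fun τ => lift σ (Q τ))
        (lift σ fun η => -ibRhs ε δ (mid (P t) (Q t)) (Q t) η) (Icc 0 T) t) :
    ∀ t ∈ Icc 0 T, InH σ (mid (P t) (Q t)) ∧ InH σ (ibVel δ (P t) (Q t)) ∧
      HasDerivWithinAt (fun τ => lift σ (mid (P τ) (Q τ))) (lift σ (ibVel δ (P t) (Q t)))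
        (Icc 0 T) t ∧
      HasDerivWithinAt (fun τ => lift σ (ibVel δ (P τ) (Q τ)))
        (lift σ (ibAcc ε δ (mid (P t) (Q t)))) (Icc 0 T) t := by
  intro t ht
  obtain ⟨hP, hQ, dP, dQ⟩ := h t ht
  have hU : InH σ (mid (P t) (Q t)) := (hP.add hQ).half
  have hvel : ∀ r ∈ Icc 0 T, InH σ (ibVel δ (P r) (Q r)) ∧ lift σ (ibVel δ (P r) (Q r)) =
      (1 / 2 : ℂ) • ibD δ hδ (lift σ (P r) - lift σ (Q r)) := by
    intro r hr
    have h1 := (h r hr).1.sub (h r hr).2.1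
    refine ⟨h1.half.ibSym_mul hδ, ?_⟩
    rw [← lift_sub (h r hr).1 (h r hr).2.1, ← map_smul, ← lift_half h1, ibD_lift hδ h1.half]
    rfl
  have hmid : ∀ r ∈ Icc 0 T, lift σ (mid (P r) (Q r)) =
      (1 / 2 : ℂ) • (lift σ (P r) + lift σ (Q r)) := fun r hr =>
    lift_mid (h r hr).1 (h r hr).2.1
  obtain ⟨iP, lP⟩ := lift_ibRhs (ε := ε) hs hσ hδ hU hP
  obtain ⟨iQ, lQ⟩ := lift_ibRhs (ε := ε) hs hσ hδ hU hQ
  rw [lP] at dP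
  rw [lift_neg iQ, lQ] at dQ
  refine ⟨hU, (hvel t ht).1, ?_, ?_⟩
  -- In the sum of the two equations the nonlinear terms cancel; in the difference, used below, they
  -- add up.
  · have d := (dP.add dQ).const_smul (1 / 2 : ℂ)
    refine (d.congr (fun r hr => hmid r hr) (hmid t ht)).congr_deriv ?_
    rw [(hvel t ht).2]
    simp only [map_add, map_sub]
    congr 1
    abel
  · have d := (hasDerivWithinAt_clm (ibD δ hδ) (dP.sub dQ)).const_smul (1 / 2 : ℂ)
    refine (d.congr (fun r hr => (hvel r hr).2) (hvel t ht).2).congr_deriv ?_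
    rw [(lift_ibAcc hs hσ hδ hU).2, hmid t ht, ← map_smul]
    congr 1
    simp only [map_add, map_smul, smul_add, smul_sub, smul_neg]
    module

include hs hσ hε hεδ hδ in
lemma norm_lift_ibAcc_sub_le {F G : ℝ → ℂ} (hF : InH σ F) (hG : InH σ G) :
    ‖lift σ (ibAcc ε δ F) - lift σ (ibAcc ε δ G)‖ ≤
      δ⁻¹ * (δ⁻¹ + 2 * 2 ^ σ * embC s * ‖lift σ F + lift σ G‖) * ‖lift σ F - lift σ G‖ := by
  rw [(lift_ibAcc hs hσ hδ hF).2, (lift_ibAcc hs hσ hδ hG).2, ← map_sub]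
  have e : ibD δ hδ (lift σ F + (ε : ℂ) • lift σ (bil oneKer F F)) -
      ibD δ hδ (lift σ G + (ε : ℂ) • lift σ (bil oneKer G G)) =
      ibD δ hδ (lift σ F - lift σ G) +
        (ε : ℂ) • ibD δ hδ (lift σ (bil oneKer F F) - lift σ (bil oneKer G G)) := by
    simp only [map_add, map_sub, map_smul, smul_sub]; abel
  rw [e, mul_assoc]
  refine (norm_ibD_le hδ _).trans (mul_le_mul_of_nonneg_left ?_ (by positivity))
  rw [add_mul]
  exact (norm_add_le _ _).trans (add_le_add (norm_ibD_le hδ _)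
    ((norm_smul_ibD_le hε hεδ hδ _).trans (norm_conv_sub_le hs hσ hF hG)))

include hs hσ hε hεδ hδ in
lemma continuousOn_lift_ibAcc {S : Set ℝ} {U : ℝ → ℝ → ℂ} (hU : ∀ t ∈ S, InH σ (U t))
    (hc : ContinuousOn (fun t => lift σ (U t)) S) :
    ContinuousOn (fun t => lift σ (ibAcc ε δ (U t))) S := by
  intro t ht
  have h1 := hc t ht
  rw [ContinuousWithinAt, tendsto_iff_norm_sub_tendsto_zero]
  have h2 : Tendsto (fun r => δ⁻¹ * (δ⁻¹ + 2 * 2 ^ σ * embC s * ‖lift σ (U r) + lift σ (U t)‖) *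
      ‖lift σ (U r) - lift σ (U t)‖) (𝓝[S] t) (𝓝 0) := by
    have h3 := (h1.sub (continuousWithinAt_const (b := lift σ (U t)))).norm
    have h4 := (((h1.add (continuousWithinAt_const (b := lift σ (U t)))).norm.const_mul
      (2 * 2 ^ σ * embC s)).const_add δ⁻¹).const_mul δ⁻¹
    have h5 := Filter.Tendsto.mul h4 h3
    simpa using h5
  refine squeeze_zero' (Eventually.of_forall fun r => norm_nonneg _) ?_ h2
  filter_upwards [self_mem_nhdsWithin] with r hr
  exact norm_lift_ibAcc_sub_le hs hσ hε hεδ hδ (hU r hr) (hU t ht)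

include hs hσ hε hεδ hδ in
/-- Uniqueness of the solutions of the improved Boussinesq equation. -/
theorem ib_unique {T : ℝ} {U₁ D₁ U₂ D₂ : ℝ → ℝ → ℂ} (hU : U₁ 0 =ᵐ[volume] U₂ 0)
    (hD : D₁ 0 =ᵐ[volume] D₂ 0)
    (h₁ : ∀ t ∈ Icc 0 T, InH σ (U₁ t) ∧
      HasDerivWithinAt (fun τ => lift σ (U₁ τ)) (lift σ (D₁ t)) (Icc 0 T) t ∧
      HasDerivWithinAt (fun τ => lift σ (D₁ τ)) (lift σ (ibAcc ε δ (U₁ t))) (Icc 0 T) t)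
    (h₂ : ∀ t ∈ Icc 0 T, InH σ (U₂ t) ∧
      HasDerivWithinAt (fun τ => lift σ (U₂ τ)) (lift σ (D₂ t)) (Icc 0 T) t ∧
      HasDerivWithinAt (fun τ => lift σ (D₂ τ)) (lift σ (ibAcc ε δ (U₂ t))) (Icc 0 T) t) :
    ∀ t ∈ Icc 0 T, U₁ t =ᵐ[volume] U₂ t := by
  have hc : ContinuousOn (fun t => lift σ (U₁ t) + lift σ (U₂ t)) (Icc 0 T) := fun t ht =>
    (h₁ t ht).2.1.continuousWithinAt.add (h₂ t ht).2.1.continuousWithinAt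
  obtain ⟨R, hR⟩ := isCompact_Icc.exists_bound_of_continuousOn hc
  have emb := embC_nonneg s
  -- As a first order system for the pair with the maximum norm: the rate is `1` in the first
  -- component and the Lipschitz constant of `ibAcc` in the second.
  set K : ℝ := max 1 (δ⁻¹ * (δ⁻¹ + 2 * 2 ^ σ * embC s * R)) with hK
  have hd : ∀ t ∈ Icc 0 T, HasDerivWithinAt
      (fun τ => (lift σ (U₁ τ) - lift σ (U₂ τ), lift σ (D₁ τ) - lift σ (D₂ τ)))
      (lift σ (D₁ t) - lift σ (D₂ t), lift σ (ibAcc ε δ (U₁ t)) - lift σ (ibAcc ε δ (U₂ t)))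
      (Icc 0 T) t := fun t ht =>
    ((h₁ t ht).2.1.sub (h₂ t ht).2.1).prodMk ((h₁ t ht).2.2.sub (h₂ t ht).2.2)
  have key := norm_le_gronwallBound_of_norm_deriv_right_le (δ := 0) (K := K) (ε := 0)
    (fun t ht => (hd t ht).continuousWithinAt)
    (fun t ht => HasDerivWithinAt.Ici_of_Icc (hd t (Ico_subset_Icc_self ht)) ht)
    (by rw [lift_congr hU, lift_congr hD, sub_self, sub_self]; simp)
    (fun t ht => by
      have ht' := Ico_subset_Icc_self ht
      rw [add_zero]
      set z := lift σ (U₁ t) - lift σ (U₂ t)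
      set y := lift σ (D₁ t) - lift σ (D₂ t)
      have hz : ‖z‖ ≤ ‖(z, y)‖ := _root_.norm_fst_le (z, y)
      have hy : ‖y‖ ≤ ‖(z, y)‖ := _root_.norm_snd_le (z, y)
      have hn := norm_nonneg (z, y)
      refine (Prod.norm_mk _ _).le.trans (max_le ?_ ?_)
      · calc ‖y‖ ≤ 1 * ‖(z, y)‖ := by rw [one_mul]; exact hy
          _ ≤ _ := mul_le_mul_of_nonneg_right (le_max_left _ _) hn
      · have h3 := norm_lift_ibAcc_sub_le hs hσ hε hεδ hδ (h₁ t ht').1 (h₂ t ht').1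
        have h4 := hR t ht'
        have hR0 : 0 ≤ R := (norm_nonneg _).trans h4
        calc _ ≤ δ⁻¹ * (δ⁻¹ + 2 * 2 ^ σ * embC s * R) * ‖(z, y)‖ := h3.trans (by gcongr)
          _ ≤ _ := mul_le_mul_of_nonneg_right (le_max_right _ _) hn)
  intro t ht
  have h5 := key t ht
  rw [gronwallBound_ε0_δ0] at h5
  have h6 := (_root_.norm_fst_le _).trans h5
  exact lift_inj (h₁ t ht).1 (h₂ t ht).1 (sub_eq_zero.1 (norm_le_zero_iff.1 h6))

end Ib

/-! ### The comparison of the two equations -/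

/-- With `x = δ²ξ²`, both `(1 + x)^{-1/2}` and `(1 + 3/4 x)/(1 + 5/4 x)` are `1 - x/2 + O(x²)`; this
is what the coefficients of the CH equations achieve. The factors `ξ` and `x²` explain the five
derivatives. -/
lemma abs_ibOm_sub_chOm_le (δ ξ : ℝ) : |ibOm δ ξ - chOm δ ξ| ≤ 1 / 2 * δ ^ 4 * |ξ| ^ 5 := by
  set x : ℝ := δ ^ 2 * ξ ^ 2 with hx
  have hx0 : 0 ≤ x := by positivity
  set r := ibRt δ ξ with hr
  have hr1 : 1 ≤ r := one_le_ibRt δ ξ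
  have hr2 : r ^ 2 = 1 + x := ibRt_sq δ ξ
  have hd : 0 < 1 + 5 / 4 * x := by positivity
  have e : ibOm δ ξ - chOm δ ξ =
      ξ * ((1 + 5 / 4 * x - r * (1 + 3 / 4 * x)) / (r * (1 + 5 / 4 * x))) := by
    have : chOm δ ξ = ξ * (1 + 3 / 4 * x) / (1 + 5 / 4 * x) := by
      rw [chOm, hx, ← mul_assoc, ← mul_assoc]
    rw [this, ibOm, ← hr]
    field_simp
  have h1 : |1 + 5 / 4 * x - r * (1 + 3 / 4 * x)| ≤ 1 / 2 * x ^ 2 * (1 + 5 / 4 * x) := by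
    have hp : 1 ≤ 1 + 5 / 4 * x + r * (1 + 3 / 4 * x) := by
      have : 0 ≤ r * (1 + 3 / 4 * x) := by positivity
      linarith
    -- The conjugate factor removes the square root; the terms of order `0` and `1` in `x` cancel.
    have e2 : (1 + 5 / 4 * x - r * (1 + 3 / 4 * x)) * (1 + 5 / 4 * x + r * (1 + 3 / 4 * x)) =
        -(1 / 2 * x ^ 2 + 9 / 16 * x ^ 3) := by
      linear_combination (-(1 + 3 / 4 * x) ^ 2) * hr2
    calc _ ≤ |1 + 5 / 4 * x - r * (1 + 3 / 4 * x)| * (1 + 5 / 4 * x + r * (1 + 3 / 4 * x)) :=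
          le_mul_of_one_le_right (abs_nonneg _) hp
      _ = |(1 + 5 / 4 * x - r * (1 + 3 / 4 * x)) * (1 + 5 / 4 * x + r * (1 + 3 / 4 * x))| := by
          rw [abs_mul, abs_of_pos (one_pos.trans_le hp)]
      _ = 1 / 2 * x ^ 2 + 9 / 16 * x ^ 3 := by rw [e2, abs_neg, abs_of_nonneg (by positivity)]
      _ ≤ _ := by nlinarith [pow_nonneg hx0 3]
  rw [e, abs_mul, abs_div, abs_of_pos (by positivity : 0 < r * (1 + 5 / 4 * x))]
  have h2 : |1 + 5 / 4 * x - r * (1 + 3 / 4 * x)| / (r * (1 + 5 / 4 * x)) ≤ 1 / 2 * x ^ 2 := by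
    rw [div_le_iff₀ (by positivity)]
    refine h1.trans ?_
    have : 1 + 5 / 4 * x ≤ r * (1 + 5 / 4 * x) := le_mul_of_one_le_left hd.le hr1
    gcongr
  calc _ ≤ |ξ| * (1 / 2 * x ^ 2) := by gcongr
    _ = 1 / 2 * δ ^ 4 * (ξ ^ 2) ^ 2 * |ξ| := by rw [hx]; ring
    _ = _ := by rw [← sq_abs ξ]; ring

lemma inner_coe_smul (f g : E) (r : ℝ) : inner ℝ f ((r : ℂ) • g) = r * inner ℝ f g := by
  rw [real_inner_eq_re, real_inner_eq_re, inner_smul_right, Complex.re_ofReal_mul]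

/-- The difference of the linear parts of the two equations. -/
def dispDiff (δ : ℝ) (W : ℝ → ℂ) (η : ℝ) : ℂ :=
  Complex.I * ((ibOm δ (freq η) - chOm δ (freq η) : ℝ) : ℂ) * W η

lemma norm_lift_dispDiff_le {s : ℝ} (δ : ℝ) {W : ℝ → ℂ} (hW : InH (s + 5) W) :
    InH s (dispDiff δ W) ∧ ‖lift s (dispDiff δ W)‖ ≤ 1 / 2 * δ ^ 4 * ‖lift (s + 5) W‖ := by
  have hb : ∀ η, wt s η * ‖dispDiff δ W η‖ ≤ 1 / 2 * δ ^ 4 * (wt (s + 5) η * ‖W η‖) := fun η => by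
    rw [dispDiff, norm_mul, norm_mul, Complex.norm_I, one_mul, Complex.norm_real,
      Real.norm_eq_abs]
    have h1 := abs_ibOm_sub_chOm_le δ (freq η)
    have h2 : |freq η| ^ 5 ≤ wt 5 η := by
      refine (pow_le_pow_left₀ (abs_nonneg _) (abs_freq_le η) 5).trans (le_of_eq ?_)
      rw [show (5 : ℝ) = 1 + 1 + 1 + 1 + 1 by norm_num, wt_add, wt_add, wt_add, wt_add]; ring
    have h3 : |ibOm δ (freq η) - chOm δ (freq η)| ≤ 1 / 2 * δ ^ 4 * wt 5 η :=
      h1.trans (by gcongr)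
    rw [wt_add]
    have := wt_nonneg s η
    calc _ ≤ wt s η * (1 / 2 * δ ^ 4 * wt 5 η * ‖W η‖) := by gcongr
      _ = _ := by ring
  exact ⟨hW.of_le (((by fun_prop : Continuous fun η => Complex.I *
    ((ibOm δ (freq η) - chOm δ (freq η) : ℝ) : ℂ))).aestronglyMeasurable.mul hW.aesm)
    (Eventually.of_forall hb), norm_lift_le (by positivity) hW (Eventually.of_forall hb)⟩

section Comparison

variable {s κ ε δ : ℝ} (hs : 1 / 2 < s) (hκ : |κ| = 1) (hε : 0 ≤ ε) (hεδ : ε ≤ δ) (hδ : 0 < δ)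
  (hδ1 : δ ≤ 1)

include hs hκ hε hδ hδ1 in
lemma inner_comparison_le {M : ℝ} {U X W : ℝ → ℂ} (hU : InH (s + 5) U) (hX : InH (s + 5) X)
    (hW : InH (s + 5) W) (bU : ‖lift (s + 5) U‖ ≤ M) (bW : ‖lift (s + 5) W‖ ≤ M) :
    inner ℝ ((1 / 2 : ℂ) • lift s X - lift s W)
      ((1 / 2 : ℂ) • (lift s fun η => ((-κ : ℝ) : ℂ) * ibRhs ε δ U X η) -
        lift s (chRhs κ ε δ W)) ≤
      ‖(1 / 2 : ℂ) • lift s X - lift s W‖ *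
        (1 / 2 * δ ^ 4 * M + ε * (6 * 2 ^ s * embC s * M ^ 2)) := by
  have hM : 0 ≤ M := (norm_nonneg _).trans bU
  have emb := embC_nonneg s
  have hXs := hX.mono (show s ≤ s + 5 by linarith)
  have hWs := hW.mono (show s ≤ s + 5 by linarith)
  have hUs := hU.mono (show s ≤ s + 5 by linarith)
  obtain ⟨iR, lR⟩ := lift_ibRhs (ε := ε) hs le_rfl hδ hUs hXs
  obtain ⟨iL, nL⟩ := norm_lift_dispDiff_le δ hW
  obtain ⟨hBU, nBU⟩ := norm_conv_le hs (show s ≤ s + 1 by linarith) (hU.mono (by linarith))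
  -- A derivative is spent on `iω`, since the bound `ε |ω| ≤ 1` would consume the factor `ε` that
  -- the final estimate needs.
  have nBU' : ‖ibD δ hδ (lift s (bil oneKer U U))‖ ≤ 4 * 2 ^ s * embC s * M ^ 2 := by
    have h1 := norm_lower_ibD_le hδ (le_refl (s + 1)) (lift (s + 1) (bil oneKer U U))
    rw [lower_ibD, lower_lift _ hBU] at h1
    have h2 := (norm_lift_mono hU (show s + 1 ≤ s + 5 by linarith)).trans bU
    rw [Real.rpow_add_one two_ne_zero] at nBU
    calc _ ≤ 2 * (2 ^ s * 2) * embC s * M ^ 2 := (h1.trans nBU).trans (by gcongr)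
      _ = _ := by ring
  have nBW : ‖lift s (bil (chKer δ) W W)‖ ≤ 4 * 2 ^ s * embC s * M ^ 2 := by
    have h2 := (norm_lift_mono hW (show s + 1 ≤ s + 5 by linarith)).trans bW
    have nBW := (norm_bil_chKer_le hs hδ.le hδ1 (τ := s) (by linarith) (le_refl (s + 1))
      le_rfl (hW.mono (by linarith))).2
    calc _ ≤ 2 * (2 * 2 ^ s) * embC s * M ^ 2 := nBW.trans (by gcongr)
      _ = _ := by ring
  have hchL : lift s (chLin κ δ W) =
      ((-κ : ℝ) : ℂ) • (ibD δ hδ (lift s W) - lift s (dispDiff δ W)) := by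
    rw [ibD_lift hδ hWs, ← lift_sub (hWs.ibSym_mul hδ) iL,
      ← lift_const_mul _ ((hWs.ibSym_mul hδ).sub iL)]
    congr 1; ext η
    simp only [chLin, ibSym, dispDiff]; push_cast; ring
  rw [lift_const_mul _ iR, lR, lift_chRhs hs hκ hδ.le hδ1 (by linarith) (le_refl (s + 1))
    le_rfl (hW.mono (by linarith)), hchL]
  generalize lift s (dispDiff δ W) = L at *
  generalize lift s (bil oneKer U U) = A at *
  generalize lift s (bil (chKer δ) W W) = B at *
  generalize lift s X = x at *
  generalize lift s W = w at *
  -- The difference solves an equation with the skew-adjoint operator `-κ iω`, forced by the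
  -- dispersion error `L` and by both quadratic terms.
  have hf' : (1 / 2 : ℂ) • (((-κ : ℝ) : ℂ) • ibD δ hδ (x + (ε : ℂ) • A)) -
      (((-κ : ℝ) : ℂ) • (ibD δ hδ w - L) - ((κ * ε : ℝ) : ℂ) • B) =
      ((-κ : ℝ) : ℂ) • ibD δ hδ ((1 / 2 : ℂ) • x - w) +
        ((-κ : ℝ) : ℂ) • (L + (ε : ℂ) • ((1 / 2 : ℂ) • ibD δ hδ A - B)) := by
    simp only [map_add, map_sub, map_smul]
    push_cast
    module
  rw [hf', inner_add_right, inner_coe_smul, inner_ibD, mul_zero, zero_add]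
  refine (real_inner_le_norm _ _).trans (mul_le_mul_of_nonneg_left ?_ (norm_nonneg _))
  rw [norm_smul, Complex.norm_real, Real.norm_eq_abs, abs_neg, hκ, one_mul]
  refine (norm_add_le _ _).trans (add_le_add (nL.trans (by gcongr)) ?_)
  rw [norm_smul, Complex.norm_real, Real.norm_of_nonneg hε]
  refine mul_le_mul_of_nonneg_left ((norm_sub_le _ _).trans ?_) hε
  rw [norm_smul]
  norm_num
  linarith

include hs hκ hε hδ hδ1 in
/-- The distance between a Riemann coordinate of the improved Boussinesq equation and a solution
of the Camassa-Holm equation. -/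
theorem comparison {T M : ℝ} {U X W : ℝ → ℝ → ℂ} (h : ∀ t ∈ Icc 0 T,
      InH (s + 5) (U t) ∧ InH (s + 5) (X t) ∧ InH (s + 5) (W t) ∧
      ‖lift (s + 5) (U t)‖ ≤ M ∧ ‖lift (s + 5) (W t)‖ ≤ M ∧
      HasDerivWithinAt (fun τ => lift s (X τ))
        (lift s fun η => ((-κ : ℝ) : ℂ) * ibRhs ε δ (U t) (X t) η) (Icc 0 T) t ∧
      HasDerivWithinAt (fun τ => lift s (W τ)) (lift s (chRhs κ ε δ (W t))) (Icc 0 T) t) :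
    ∀ t ∈ Icc 0 T, ‖(1 / 2 : ℂ) • lift s (X t) - lift s (W t)‖ ≤
      ‖(1 / 2 : ℂ) • lift s (X 0) - lift s (W 0)‖ +
        (1 / 2 * δ ^ 4 * M + ε * (6 * 2 ^ s * embC s * M ^ 2)) * t := by
  intro t ht
  have hM : 0 ≤ M := (norm_nonneg _).trans (h t ht).2.2.2.1
  have emb := embC_nonneg s
  -- With `K = 0` the forcing integrates to linear growth in `t`, without an exponential.
  have key := norm_le_of_inner_deriv_le (K := 0) (T := T)
    (a := 1 / 2 * δ ^ 4 * M + ε * (6 * 2 ^ s * embC s * M ^ 2))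
    (f := fun τ => (1 / 2 : ℂ) • lift s (X τ) - lift s (W τ))
    (f' := fun τ => (1 / 2 : ℂ) • (lift s fun η => ((-κ : ℝ) : ℂ) * ibRhs ε δ (U τ) (X τ) η) -
      lift s (chRhs κ ε δ (W τ))) le_rfl (by positivity)
    (fun τ hτ => ((h τ hτ).2.2.2.2.2.1.const_smul (1 / 2 : ℂ)).sub (h τ hτ).2.2.2.2.2.2)
    (fun τ hτ => by
      obtain ⟨hU, hX, hW, bU, bW, -, -⟩ := h τ hτ
      have := inner_comparison_le hs hκ hε hδ hδ1 hU hX hW bU bW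
      rw [zero_mul, zero_add, mul_comm (_ + _)]
      exact this) t ht
  simpa using key

end Comparison

/-! ### Long waves on the Fourier side -/

/-- The Fourier transform of a solution of the Camassa-Holm equation in `H^σ`. -/
structure FourierCh (κ σ ε δ T : ℝ) (w₀ : ℝ → ℂ) (W : ℝ → ℝ → ℂ) : Prop where
  init : W 0 =ᵐ[volume] w₀
  cont : ContinuousOn (fun t => lift σ (W t)) (Icc 0 T)
  mem : ∀ t ∈ Icc 0 T, InH σ (W t)
  herm : ∀ t ∈ Icc 0 T, HermAE (W t)
  deriv : ∀ t ∈ Icc 0 T, HasDerivWithinAt (fun τ => lift (σ - 1) (W τ))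
    (lift (σ - 1) (chRhs κ ε δ (W t))) (Icc 0 T) t

/-- The Fourier transform of a solution of the improved Boussinesq equation in `H^σ`, and of its
time derivative. -/
structure FourierIb (σ ε δ T : ℝ) (u₀ v₀ : ℝ → ℂ) (U D : ℝ → ℝ → ℂ) : Prop where
  init : U 0 =ᵐ[volume] u₀
  initD : D 0 =ᵐ[volume] fun η => Complex.I * (freq η : ℂ) * v₀ η
  mem : ∀ t ∈ Icc 0 T, InH σ (U t)
  memD : ∀ t ∈ Icc 0 T, InH σ (D t)
  herm : ∀ t ∈ Icc 0 T, HermAE (U t)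
  hermD : ∀ t ∈ Icc 0 T, HermAE (D t)
  deriv : ∀ t ∈ Icc 0 T,
    HasDerivWithinAt (fun τ => lift σ (U τ)) (lift σ (D t)) (Icc 0 T) t
  derivD : ∀ t ∈ Icc 0 T,
    HasDerivWithinAt (fun τ => lift σ (D τ)) (lift σ (ibAcc ε δ (U t))) (Icc 0 T) t

lemma HermAE.half {F : ℝ → ℂ} (hF : HermAE F) : HermAE fun η => F η / 2 := by
  filter_upwards [hF] with η h
  rw [h, map_div₀, map_ofNat]

/-- The data `û₀ ± √(1 + δ²ξ²) v̂₀` of the Riemann coordinates need one more derivative of `v₀` than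
of `u₀`. -/
lemma inH_ibRt_mul {δ σ : ℝ} (hδ : 0 ≤ δ) (hδ1 : δ ≤ 1) {v : ℝ → ℂ} (hv : InH (σ + 1) v) :
    InH σ (fun η => (ibRt δ (freq η) : ℂ) * v η) ∧
      ‖lift σ (fun η => (ibRt δ (freq η) : ℂ) * v η)‖ ≤ ‖lift (σ + 1) v‖ := by
  have hb : ∀ η, wt σ η * ‖(ibRt δ (freq η) : ℂ) * v η‖ ≤ 1 * (wt (σ + 1) η * ‖v η‖) := fun η => by
    have h1 : ibRt δ (freq η) ≤ wt 1 η := by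
      refine abs_le_of_sq_le_sq' ?_ (wt_nonneg 1 η) |>.2
      rw [ibRt_sq, wt_one_sq]
      have : δ ^ 2 ≤ 1 := pow_le_one₀ hδ hδ1
      nlinarith [sq_nonneg (freq η)]
    rw [norm_mul, Complex.norm_real, Real.norm_of_nonneg (ibRt_pos _ _).le, wt_add, one_mul,
      mul_assoc]
    have := wt_nonneg σ η
    gcongr
  refine ⟨hv.of_le ((by fun_prop : Continuous fun η => (ibRt δ (freq η) : ℂ)
    ).aestronglyMeasurable.mul hv.aesm) (Eventually.of_forall hb), ?_⟩
  simpa using norm_lift_le zero_le_one hv (Eventually.of_forall hb)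

/-- The source of the term `δ²` in the final estimate, through `√(1 + x) - 1 ≤ x`. -/
lemma norm_lift_ibRt_sub_one_le {δ s : ℝ} {v : ℝ → ℂ} (hv : InH (s + 2) v) :
    ‖lift s (fun η => ((ibRt δ (freq η) - 1 : ℝ) : ℂ) * v η)‖ ≤ δ ^ 2 * ‖lift (s + 2) v‖ := by
  refine norm_lift_le (by positivity) hv (Eventually.of_forall fun η => ?_)
  rw [norm_mul, Complex.norm_real, Real.norm_eq_abs, wt_add, wt_two]
  have h := ibRt_sub_one_le δ (freq η)
  have := wt_nonneg s η
  calc _ ≤ wt s η * (δ ^ 2 * (1 + freq η ^ 2) * ‖v η‖) := by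
        gcongr
        exact h.trans (by nlinarith [sq_nonneg δ])
    _ = _ := by ring

lemma le_total_bound {N X ε d t : ℝ} (hN : 0 ≤ N) (hX : 0 ≤ X) (hε : 0 ≤ ε) (ht : 0 ≤ t) :
    2 * (d ^ 2 * (N / 4) + (1 / 2 * d ^ 4 * (N + 1) + ε * (6 * X)) * t) ≤
      (1 + N + (N + 1) + 12 * X) * ((ε + d ^ 2) + (ε + d ^ 4) * t) := by
  have h2 : 0 ≤ d ^ 2 := by positivity
  have h4 : 0 ≤ d ^ 4 := by positivity
  have g1 : 2 * (d ^ 2 * (N / 4)) ≤ (1 + N + (N + 1) + 12 * X) * (ε + d ^ 2) := by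
    nlinarith [mul_nonneg hN h2, mul_nonneg hX h2, mul_nonneg hN hε, mul_nonneg hX hε]
  have g2 : d ^ 4 * (N + 1) + 12 * (ε * X) ≤ (1 + N + (N + 1) + 12 * X) * (ε + d ^ 4) := by
    nlinarith [mul_nonneg hN h4, mul_nonneg hX h4, mul_nonneg hN hε, mul_nonneg hX hε]
  linarith [mul_le_mul_of_nonneg_right g2 ht]

set_option maxHeartbeats 1000000 in
/-- Existence for both equations and the comparison of their solutions. -/
theorem exists_waves {s : ℝ} (hs : 1 / 2 < s) {u v : ℝ → ℂ} (hu : InH (s + 6) u) (huH : HermAE u)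
    (hv : InH (s + 7) v) (hvH : HermAE v) :
    ∃ C : ℝ, 0 < C ∧ ∀ T : ℝ, 0 < T → ∃ δs : ℝ, 0 < δs ∧ δs ≤ 1 ∧
      ∀ ε δ : ℝ, 0 < ε → ε ≤ δ → δ ≤ δs → ∃ U D Wp Wm : ℝ → ℝ → ℂ,
        FourierIb (s + 6) ε δ T u v U D ∧
        FourierCh 1 (s + 5) ε δ T (fun η => (u η - v η) / 2) Wp ∧
        FourierCh (-1) (s + 5) ε δ T (fun η => (u η + v η) / 2) Wm ∧
        ∀ t ∈ Icc 0 T, ‖lift s (fun η => U t η - Wp t η - Wm t η)‖ ≤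
          C * ((ε + δ ^ 2) + (ε + δ ^ 4) * t) := by
  set N : ℝ := 2 * (‖lift (s + 6) u‖ + ‖lift (s + 7) v‖) with hN
  have hN0 : 0 ≤ N := by positivity
  have emb := embC_nonneg s
  refine ⟨1 + N + (N + 1) + 12 * (2 ^ s * embC s * (N + 1) ^ 2), by positivity, fun T hT => ?_⟩
  -- The radii grow exponentially with `T`, but they enter only the threshold `A⁻¹` for `δ`. The
  -- constant of the estimate depends on `N`, the bound for the data, and on `s`.
  set R₁ := (N + 1) * Real.exp (ibC s (s + 6) * (N + 1) * T) with hR₁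
  set R₂ := (N + 1) * Real.exp (chC s (s + 6) * (N + 1) * T) with hR₂
  have c1 := ibC_nonneg s (s + 6)
  have c2 : 0 ≤ chC s (s + 6) := chC_nonneg (by linarith)
  set A := 1 + ibC s (s + 6) * (2 * R₁) ^ 2 * T + chC s (s + 6) * (2 * R₂) ^ 2 * T with hA
  have b1 : 0 ≤ ibC s (s + 6) * (2 * R₁) ^ 2 * T := by positivity
  have b2 : 0 ≤ chC s (s + 6) * (2 * R₂) ^ 2 * T := by positivity
  have hA1 : 1 ≤ A := by linarith
  have hA0 : 0 < A := by linarith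
  refine ⟨A⁻¹, inv_pos.2 hA0, inv_le_one_of_one_le₀ hA1, fun ε δ hε hεδ hδA => ?_⟩
  have hδ : 0 < δ := hε.trans_le hεδ
  have hδ1 : δ ≤ 1 := hδA.trans (inv_le_one_of_one_le₀ hA1)
  have hε1 : ε ≤ 1 := hεδ.trans hδ1
  have hεA : ε * A ≤ 1 := by
    calc ε * A ≤ A⁻¹ * A := by have := hεδ.trans hδA; gcongr
      _ = 1 := inv_mul_cancel₀ hA0.ne'
  have small1 : ε * ibC s (s + 6) * (2 * R₁) ^ 2 * T ≤ 1 := by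
    calc _ = ε * (ibC s (s + 6) * (2 * R₁) ^ 2 * T) := by ring
      _ ≤ ε * A := by gcongr; linarith
      _ ≤ 1 := hεA
  have small2 : ε * chC s (s + 6) * (2 * R₂) ^ 2 * T ≤ 1 := by
    calc _ = ε * (chC s (s + 6) * (2 * R₂) ^ 2 * T) := by ring
      _ ≤ ε * A := by gcongr; linarith
      _ ≤ 1 := hεA
  have hv6 : InH (s + 6) v := hv.mono (by linarith)
  have nv6 : ‖lift (s + 6) v‖ ≤ ‖lift (s + 7) v‖ := norm_lift_mono hv (by linarith)
  have e7 : s + 7 = s + 6 + 1 := by ring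
  have e5 : s + 6 - 1 = s + 5 := by ring
  have e4 : s + 6 - 2 = s + 5 - 1 := by ring
  obtain ⟨hrv, nrv⟩ := inH_ibRt_mul hδ.le hδ1 (e7 ▸ hv)
  rw [← e7] at nrv
  have hrvH : HermAE fun η => (ibRt δ (freq η) : ℂ) * v η :=
    (hermAE_of_even (r := fun η => ibRt δ (freq η)) fun η => by rw [freq_neg, ibRt_neg]).mul hvH
  have hP₀ := hu.add hrv
  have hQ₀ := hu.sub hrv
  have nP : ‖lift (s + 6) fun η => u η + (ibRt δ (freq η) : ℂ) * v η‖ ≤ N / 2 := by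
    rw [lift_add hu hrv]
    exact (norm_add_le _ _).trans (by linarith)
  have nQ : ‖lift (s + 6) fun η => u η - (ibRt δ (freq η) : ℂ) * v η‖ ≤ N / 2 := by
    rw [lift_sub hu hrv]
    exact (norm_sub_le _ _).trans (by linarith)
  have low : s + 6 - 1 ≤ s + 6 := by linarith
  obtain ⟨P, Q, hP0, hQ0, hPQ⟩ := exists_ib (T := T) (N₀ := N) (M₀ := N) hs
    (by linarith : s + 1 ≤ s + 6) hε.le hεδ hδ hT.le hR₁ small1 hP₀ (huH.add hrvH) hQ₀
    (huH.sub hrvH) (by linarith)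
    (by have := norm_lift_mono hP₀ low; have := norm_lift_mono hQ₀ low; linarith)
  have hch : ∀ (κ : ℝ) (w : ℝ → ℂ), |κ| = 1 → InH (s + 6) w → HermAE w → ‖lift (s + 6) w‖ ≤ N →
      ∃ W : ℝ → ℝ → ℂ, FourierCh κ (s + 5) ε δ T w W ∧
        ∀ t ∈ Icc 0 T, ‖lift (s + 5) (W t)‖ ≤ N + 1 := by
    intro κ w hκ hw hwH nw
    obtain ⟨W, h1, h2, h3⟩ := exists_ch hs hκ hε.le hε1 hδ.le hδ1 (by linarith : s + 2 ≤ s + 6)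
      hT.le hR₂ small2 hw hwH nw ((norm_lift_mono hw low).trans nw)
    rw [e5] at h2
    rw [e5, e4] at h3
    exact ⟨W, ⟨h1, h2, fun t ht => (h3 t ht).1, fun t ht => (h3 t ht).2.1,
      fun t ht => (h3 t ht).2.2.2⟩, fun t ht => (h3 t ht).2.2.1⟩
  obtain ⟨Wp, hWp, nWp⟩ := hch 1 (fun η => (u η - v η) / 2) (by norm_num) (hu.sub hv6).half
    (huH.sub hvH).half (by
      rw [lift_half (hu.sub hv6), lift_sub hu hv6, norm_smul]
      have := norm_sub_le (lift (s + 6) u) (lift (s + 6) v)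
      norm_num
      linarith)
  obtain ⟨Wm, hWm, nWm⟩ := hch (-1) (fun η => (u η + v η) / 2) (by norm_num) (hu.add hv6).half
    (huH.add hvH).half (by
      rw [lift_half (hu.add hv6), lift_add hu hv6, norm_smul]
      have := norm_add_le (lift (s + 6) u) (lift (s + 6) v)
      norm_num
      linarith)
  have second := ib_second_order (ε := ε) hs (by linarith : s ≤ s + 6) hδ
    (fun t ht => ⟨(hPQ t ht).1, (hPQ t ht).2.1, (hPQ t ht).2.2.2.2.2.2.1,
      (hPQ t ht).2.2.2.2.2.2.2⟩)
  refine ⟨fun t => mid (P t) (Q t), fun t => ibVel δ (P t) (Q t), Wp, Wm,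
    ⟨?_, ?_, fun t ht => (second t ht).1, fun t ht => (second t ht).2.1, fun t ht => ?_,
      fun t ht => ?_, fun t ht => (second t ht).2.2.1, fun t ht => (second t ht).2.2.2⟩,
    hWp, hWm, fun t ht => ?_⟩
  · filter_upwards [hP0, hQ0] with η h1 h2
    rw [mid, h1, h2]; ring
  · filter_upwards [hP0, hQ0] with η h1 h2
    have : (ibOm δ (freq η) : ℂ) * ibRt δ (freq η) = freq η := by
      rw [← Complex.ofReal_mul, ibOm_mul_ibRt]
    rw [ibVel, h1, h2, ibSym, ← this]; ring
  · exact ((hPQ t ht).2.2.1.add (hPQ t ht).2.2.2.1).half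
  · exact (hermAE_ibSym δ).mul ((hPQ t ht).2.2.1.sub (hPQ t ht).2.2.2.1).half
  have h0 : (0 : ℝ) ∈ Icc 0 T := left_mem_Icc.2 hT.le
  have hlow : s ≤ s + 6 := by linarith
  have hlow5 : s ≤ s + 5 := by linarith
  have dLow : ∀ {σ : ℝ} (h : s ≤ σ) {X : ℝ → ℝ → ℂ} {F : ℝ → ℂ} {r : ℝ}, r ∈ Icc 0 T →
      (∀ r ∈ Icc 0 T, InH σ (X r)) → InH σ F →
      HasDerivWithinAt (fun τ => lift σ (X τ)) (lift σ F) (Icc 0 T) r →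
      HasDerivWithinAt (fun τ => lift s (X τ)) (lift s F) (Icc 0 T) r := by
    intro σ h X F r hr hX hF hd
    have := hasDerivWithinAt_clm (lower s σ h) hd
    rw [lower_lift h hF] at this
    exact this.congr (fun x hx => (lower_lift h (hX x hx)).symm) (lower_lift h (hX r hr)).symm
  have iR : ∀ r ∈ Icc 0 T, InH (s + 6) (ibRhs ε δ (mid (P r) (Q r)) (P r)) ∧
      InH (s + 6) (ibRhs ε δ (mid (P r) (Q r)) (Q r)) := fun r hr =>
    ⟨(lift_ibRhs hs hlow hδ (second r hr).1 (hPQ r hr).1).1,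
      (lift_ibRhs hs hlow hδ (second r hr).1 (hPQ r hr).2.1).1⟩
  have nU : ∀ r ∈ Icc 0 T, ‖lift (s + 5) (mid (P r) (Q r))‖ ≤ N + 1 := by
    intro r hr
    obtain ⟨a1, a2, -, -, a3, a4, -, -⟩ := hPQ r hr
    rw [e5] at a3 a4
    rw [lift_mid (a1.mono (by linarith)) (a2.mono (by linarith)), norm_smul]
    have := norm_add_le (lift (s + 5) (P r)) (lift (s + 5) (Q r))
    norm_num
    linarith
  have chd : ∀ {κ : ℝ} (hκ : |κ| = 1) {w : ℝ → ℂ} {W : ℝ → ℝ → ℂ},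
      FourierCh κ (s + 5) ε δ T w W → ∀ r ∈ Icc 0 T,
      HasDerivWithinAt (fun τ => lift s (W τ)) (lift s (chRhs κ ε δ (W r))) (Icc 0 T) r := by
    intro κ hκ w W hW r hr
    exact dLow (σ := s + 5 - 1) (by linarith) hr (fun x hx => (hW.mem x hx).mono (by linarith))
      (inH_chRhs hs hκ hδ.le hδ1 (by linarith) (by linarith) (by linarith) (hW.mem r hr))
      (hW.deriv r hr)
  -- `P` has the symbol `iω` and moves to the left, `Q` moves to the right. All norms are taken in
  -- `H^{s+5}`, where they are at most `N + 1` on the whole interval.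
  have cm := comparison (κ := -1) (M := N + 1) (U := fun t => mid (P t) (Q t)) (X := P) (W := Wm)
    hs (by norm_num) hε.le hδ hδ1 (fun r hr => by
      refine ⟨(second r hr).1.mono (by linarith), (hPQ r hr).1.mono (by linarith),
        hWm.mem r hr, nU r hr, nWm r hr, ?_, chd (by norm_num) hWm r hr⟩
      simpa using dLow hlow hr (fun x hx => (hPQ x hx).1) (iR r hr).1
        (hPQ r hr).2.2.2.2.2.2.1) t ht
  have cp := comparison (κ := 1) (M := N + 1) (U := fun t => mid (P t) (Q t)) (X := Q) (W := Wp)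
    hs (by norm_num) hε.le hδ hδ1 (fun r hr => by
      refine ⟨(second r hr).1.mono (by linarith), (hPQ r hr).2.1.mono (by linarith),
        hWp.mem r hr, nU r hr, nWp r hr, ?_, chd (by norm_num) hWp r hr⟩
      have := dLow hlow hr (fun x hx => (hPQ x hx).2.1)
        (((iR r hr).2.const_mul (-1)).congr (Eventually.of_forall fun η => neg_one_mul _))
        (hPQ r hr).2.2.2.2.2.2.2
      simpa using this) t ht
  have hvs : InH s v := hv.mono (by linarith)
  have hus : InH s u := hu.mono (by linarith)
  have hrvs := hrv.mono hlow
  have hrs : InH s fun η => ((ibRt δ (freq η) - 1 : ℝ) : ℂ) * v η :=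
    (hrvs.sub hvs).congr (Eventually.of_forall fun η => by push_cast; ring)
  have nr : ‖lift s (fun η => ((ibRt δ (freq η) - 1 : ℝ) : ℂ) * v η)‖ ≤ δ ^ 2 * (N / 2) := by
    refine (norm_lift_ibRt_sub_one_le (hv.mono (by linarith))).trans ?_
    have := norm_lift_mono hv (show s + 2 ≤ s + 7 by linarith)
    have := norm_nonneg (lift (s + 6) u)
    gcongr
    linarith
  have im : ‖(1 / 2 : ℂ) • lift s (P 0) - lift s (Wm 0)‖ ≤ δ ^ 2 * (N / 4) := by
    have : (1 / 2 : ℂ) • lift s (P 0) - lift s (Wm 0) =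
        (1 / 2 : ℂ) • lift s (fun η => ((ibRt δ (freq η) - 1 : ℝ) : ℂ) * v η) := by
      rw [lift_congr hP0, lift_congr hWm.init, ← lift_half (hP₀.mono hlow),
        ← lift_sub (hP₀.mono hlow).half (hus.add hvs).half, ← lift_half hrs]
      congr 1; ext η; push_cast; ring
    rw [this, norm_smul, show ‖(1 / 2 : ℂ)‖ = 1 / 2 by norm_num]
    linarith
  have ip : ‖(1 / 2 : ℂ) • lift s (Q 0) - lift s (Wp 0)‖ ≤ δ ^ 2 * (N / 4) := by
    have : (1 / 2 : ℂ) • lift s (Q 0) - lift s (Wp 0) =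
        (-1 / 2 : ℂ) • lift s (fun η => ((ibRt δ (freq η) - 1 : ℝ) : ℂ) * v η) := by
      rw [lift_congr hQ0, lift_congr hWp.init, ← lift_half (hQ₀.mono hlow),
        ← lift_sub (hQ₀.mono hlow).half (hus.sub hvs).half, ← lift_const_mul _ hrs]
      congr 1; ext η; push_cast; ring
    rw [this, norm_smul, show ‖(-1 / 2 : ℂ)‖ = 1 / 2 by norm_num]
    linarith
  have hfin : lift s (fun η => mid (P t) (Q t) η - Wp t η - Wm t η) =
      ((1 / 2 : ℂ) • lift s (Q t) - lift s (Wp t)) + ((1 / 2 : ℂ) • lift s (P t) - lift s (Wm t)) := by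
    have a1 := (hPQ t ht).1.mono hlow
    have a2 := (hPQ t ht).2.1.mono hlow
    have a3 := (hWp.mem t ht).mono hlow5
    have a4 := (hWm.mem t ht).mono hlow5
    have a5 : InH s (mid (P t) (Q t)) := (a1.add a2).half
    rw [lift_sub (a5.sub a3) a4, lift_sub a5 a3, lift_mid a1 a2, smul_add]
    abel
  dsimp only
  rw [hfin]
  refine (norm_add_le _ _).trans ?_
  have ht0 := ht.1
  have g := le_total_bound hN0 (by positivity : 0 ≤ 2 ^ s * embC s * (N + 1) ^ 2) hε.le
    (d := δ) ht0
  calc _ ≤ 2 * (δ ^ 2 * (N / 4) + (1 / 2 * δ ^ 4 * (N + 1) +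
        ε * (6 * 2 ^ s * embC s * (N + 1) ^ 2)) * t) := by linarith
    _ = 2 * (δ ^ 2 * (N / 4) + (1 / 2 * δ ^ 4 * (N + 1) +
        ε * (6 * (2 ^ s * embC s * (N + 1) ^ 2))) * t) := by ring
    _ ≤ _ := g

/-! ### The Fourier transform of real functions -/

/-- The complex valued function with the same values as `f`. -/
def cE (f : ℝ → ℝ) (x : ℝ) : ℂ := (f x : ℂ)

/-- The `L²` Fourier transform of a real function, as an element of `L²`. -/
def FT (f : ℝ → ℝ) : E := 𝓕 (toE (cE f))

/-- The `L²` Fourier transform of a real function. -/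
def ftr (f : ℝ → ℝ) (η : ℝ) : ℂ := FT f η

lemma memLp_cE {f : ℝ → ℝ} : MemLp (cE f) 2 volume ↔ MemLp f 2 volume :=
  ⟨fun h => by simpa [cE] using h.re, fun h => h.ofReal⟩

lemma memLp_ftr (f : ℝ → ℝ) : MemLp (ftr f) 2 volume := Lp.memLp (FT f)

lemma toE_ftr (f : ℝ → ℝ) : toE (ftr f) = FT f := toE_coe (FT f)

lemma inH_zero_iff {F : ℝ → ℂ} : InH 0 F ↔ MemLp F 2 volume := by
  simp only [InH, wt_zero, Complex.ofReal_one, one_mul]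

lemma FT_inj {f g : ℝ → ℝ} (hf : MemLp f 2 volume) (hg : MemLp g 2 volume) (h : FT f = FT g) :
    f =ᵐ[volume] g := by
  have h1 : toE (cE f) = toE (cE g) := (Lp.fourierTransformₗᵢ ℝ ℂ).injective h
  filter_upwards [coeFn_toE (memLp_cE.2 hf), coeFn_toE (memLp_cE.2 hg)] with x h2 h3
  rw [h1, h3] at h2
  exact (Complex.ofReal_inj.1 h2).symm

lemma ftr_eq_iff {f g : ℝ → ℝ} : ftr f =ᵐ[volume] ftr g ↔ FT f = FT g :=
  ⟨fun h => Lp.ext h, fun h => by unfold ftr; rw [h]⟩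

lemma ftr_inj {f g : ℝ → ℝ} (hf : MemLp f 2 volume) (hg : MemLp g 2 volume)
    (h : ftr f =ᵐ[volume] ftr g) : f =ᵐ[volume] g := FT_inj hf hg (ftr_eq_iff.1 h)

lemma FT_congr {f g : ℝ → ℝ} (h : f =ᵐ[volume] g) : FT f = FT g := by
  rw [FT, FT, toE_congr]
  filter_upwards [h] with x hx
  rw [cE, cE, hx]

lemma ftr_congr {f g : ℝ → ℝ} (h : f =ᵐ[volume] g) : ftr f = ftr g := by
  unfold ftr; rw [FT_congr h]

lemma FT_add {f g : ℝ → ℝ} (hf : MemLp f 2 volume) (hg : MemLp g 2 volume) :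
    FT (fun x => f x + g x) = FT f + FT g := by
  rw [FT, FT, FT, ← FourierTransform.fourier_add,
    ← toE_add (memLp_cE.2 hf) (memLp_cE.2 hg)]
  congr 2; ext x; simp [cE]

lemma FT_const_mul {f : ℝ → ℝ} (c : ℝ) (hf : MemLp f 2 volume) :
    FT (fun x => c * f x) = (c : ℂ) • FT f := by
  rw [FT, FT, ← FourierTransform.fourier_smul, ← toE_const_mul _ (memLp_cE.2 hf)]
  congr 2; ext x; simp [cE]

lemma ftr_add {f g : ℝ → ℝ} (hf : MemLp f 2 volume) (hg : MemLp g 2 volume) :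
    ftr (fun x => f x + g x) =ᵐ[volume] fun η => ftr f η + ftr g η := by
  unfold ftr
  rw [FT_add hf hg]
  exact Lp.coeFn_add _ _

lemma ftr_const_mul {f : ℝ → ℝ} (c : ℝ) (hf : MemLp f 2 volume) :
    ftr (fun x => c * f x) =ᵐ[volume] fun η => (c : ℂ) * ftr f η := by
  unfold ftr
  rw [FT_const_mul c hf]
  exact Lp.coeFn_smul _ _

lemma ftr_sub {f g : ℝ → ℝ} (hf : MemLp f 2 volume) (hg : MemLp g 2 volume) :
    ftr (fun x => f x - g x) =ᵐ[volume] fun η => ftr f η - ftr g η := by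
  have h1 := ftr_add hf (hg.const_mul (-1))
  have e : (fun x => f x - g x) = fun x => f x + -1 * g x := by ext x; ring
  rw [e]
  filter_upwards [h1, ftr_const_mul (-1) hg] with η h2 h3
  rw [h2, h3]; push_cast; ring

lemma hsENorm_eq {σ : ℝ} {f : ℝ → ℝ} (hf : MemLp f 2 volume) :
    hsENorm σ f = eLpNorm (fun η => (wt σ η : ℂ) * ftr f η) 2 volume := by
  have hf' : MemLp (fun x => (f x : ℂ)) 2 volume := memLp_cE.2 hf
  rw [hsENorm, iInf_pos hf',
    eLpNorm_eq_lintegral_rpow_enorm_toReal (by norm_num) (by norm_num)]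
  simp only [ENNReal.toReal_ofNat, ENNReal.rpow_two]
  congr 1
  refine lintegral_congr fun η => ?_
  have e : (𝓕 (hf'.toLp fun x => (f x : ℂ)) : Lp ℂ 2 (volume : Measure ℝ)) η = ftr f η := by
    rw [ftr, FT, toE, dif_pos (memLp_cE.2 hf)]; rfl
  rw [e, enorm_mul, mul_pow ‖((wt σ η : ℝ) : ℂ)‖ₑ, ← ofReal_norm ((wt σ η : ℝ) : ℂ),
    Complex.norm_real, Real.norm_of_nonneg (wt_nonneg σ η),
    ← ENNReal.ofReal_pow (wt_nonneg σ η), wt_sq, freq]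

lemma hsENorm_eq_top {σ : ℝ} {f : ℝ → ℝ} (hf : ¬MemLp f 2 volume) : hsENorm σ f = ∞ := by
  rw [hsENorm, iInf_neg]
  exact fun h => hf (memLp_cE.1 h)

lemma memHs_iff {σ : ℝ} {f : ℝ → ℝ} : MemHs σ f ↔ MemLp f 2 volume ∧ InH σ (ftr f) := by
  rw [MemHs]
  constructor
  · intro h
    have hf : MemLp f 2 volume := by
      by_contra hf
      rw [hsENorm_eq_top hf] at h
      exact lt_irrefl _ h
    rw [hsENorm_eq hf] at h
    exact ⟨hf, aesm_wt_mul σ (memLp_ftr f).1, h⟩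
  · rintro ⟨hf, h⟩
    rw [hsENorm_eq hf]
    exact h.2

lemma _root_.MemHs.memLp {σ : ℝ} {f : ℝ → ℝ} (h : MemHs σ f) : MemLp f 2 volume := (memHs_iff.1 h).1

lemma _root_.MemHs.inH {σ : ℝ} {f : ℝ → ℝ} (h : MemHs σ f) : InH σ (ftr f) := (memHs_iff.1 h).2

lemma _root_.MemHs.of_le {σ τ : ℝ} {f : ℝ → ℝ} (h : MemHs τ f) (hl : σ ≤ τ) : MemHs σ f :=
  memHs_iff.2 ⟨h.memLp, h.inH.mono hl⟩

lemma hsENorm_eq_lift {σ : ℝ} {f : ℝ → ℝ} (h : MemHs σ f) :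
    hsENorm σ f = ‖lift σ (ftr f)‖ₑ := by
  rw [hsENorm_eq h.memLp, lift, enorm_toE h.inH]

lemma _root_.MemHs.sub {σ : ℝ} {f g : ℝ → ℝ} (hf : MemHs σ f) (hg : MemHs σ g) :
    MemHs σ (fun x => f x - g x) ∧
      lift σ (ftr fun x => f x - g x) = lift σ (ftr f) - lift σ (ftr g) := by
  have h := ftr_sub hf.memLp hg.memLp
  exact ⟨memHs_iff.2 ⟨hf.memLp.sub hg.memLp, (hf.inH.sub hg.inH).congr h.symm⟩,
    by rw [lift_congr h, lift_sub hf.inH hg.inH]⟩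

lemma _root_.MemHs.const_mul {σ : ℝ} {f : ℝ → ℝ} (c : ℝ) (hf : MemHs σ f) :
    MemHs σ (fun x => c * f x) ∧ lift σ (ftr fun x => c * f x) = (c : ℂ) • lift σ (ftr f) := by
  have h := ftr_const_mul c hf.memLp
  exact ⟨memHs_iff.2 ⟨hf.memLp.const_mul c, (hf.inH.const_mul _).congr h.symm⟩,
    by rw [lift_congr h, lift_const_mul _ hf.inH]⟩

lemma tendsto_enorm_zero_iff {X : Type*} {l : Filter X} {f : X → E} :
    Tendsto (fun x => ‖f x‖ₑ) l (𝓝 0) ↔ Tendsto f l (𝓝 0) := by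
  rw [tendsto_zero_iff_norm_tendsto_zero, ← ENNReal.tendsto_toReal_iff (fun x => enorm_ne_top)
    ENNReal.zero_ne_top]
  simp only [toReal_enorm, ENNReal.toReal_zero]

/-- On `H^σ` the map `f ↦ lift σ (ftr f)` is additive and carries the Sobolev norm to the norm of
`L²`. -/
lemma contInHs_iff {σ T : ℝ} {w : ℝ → ℝ → ℝ} : ContInHs σ T w ↔ (∀ t ∈ Icc 0 T, MemHs σ (w t)) ∧
    ContinuousOn (fun t => lift σ (ftr (w t))) (Icc 0 T) := by
  have key : (∀ t ∈ Icc 0 T, MemHs σ (w t)) → ∀ t ∈ Icc 0 T,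
      (Tendsto (fun τ => hsENorm σ (fun x => w τ x - w t x)) (𝓝[Icc 0 T] t) (𝓝 0) ↔
        ContinuousWithinAt (fun t => lift σ (ftr (w t))) (Icc 0 T) t) := by
    intro h t ht
    refine Iff.trans ?_ (tendsto_sub_nhds_zero_iff (u := fun t => lift σ (ftr (w t))))
    rw [← tendsto_enorm_zero_iff]
    refine tendsto_congr' ?_
    filter_upwards [self_mem_nhdsWithin] with τ hτ
    obtain ⟨h1, h2⟩ := (h τ hτ).sub (h t ht)
    rw [hsENorm_eq_lift h1, h2]
  constructor
  · intro h
    have hm : ∀ t ∈ Icc 0 T, MemHs σ (w t) := fun t ht => (h t ht).1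
    exact ⟨hm, fun t ht => (key hm t ht).1 (h t ht).2⟩
  · rintro ⟨hm, hc⟩ t ht
    exact ⟨hm t ht, (key hm t ht).2 (hc t ht)⟩

lemma hasDerivInHs_iff {σ T : ℝ} {w w' : ℝ → ℝ → ℝ} (hw : ∀ t ∈ Icc 0 T, MemHs σ (w t))
    (hw' : ∀ t ∈ Icc 0 T, MemHs σ (w' t)) : HasDerivInHs σ T w w' ↔ ∀ t ∈ Icc 0 T,
      HasDerivWithinAt (fun τ => lift σ (ftr (w τ))) (lift σ (ftr (w' t))) (Icc 0 T) t := by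
  refine forall₂_congr fun t ht => ?_
  rw [hasDerivWithinAt_iff_tendsto_slope]
  refine Iff.trans ?_ tendsto_sub_nhds_zero_iff
  rw [← tendsto_enorm_zero_iff]
  refine tendsto_congr' ?_
  filter_upwards [self_mem_nhdsWithin] with τ hτ
  obtain ⟨h1, h2⟩ := (hw τ hτ.1).sub (hw t ht)
  obtain ⟨h3, h4⟩ := h1.const_mul (τ - t)⁻¹
  obtain ⟨h5, h6⟩ := h3.sub (hw' t ht)
  have e : (fun x => (w τ x - w t x) / (τ - t) - w' t x) =
      fun x => (τ - t)⁻¹ * (w τ x - w t x) - w' t x := by ext x; rw [div_eq_inv_mul]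
  rw [e, hsENorm_eq_lift h5, h6, h4, h2, slope_def_module, Complex.coe_smul]
  rfl

/-! ### Pairing with test functions -/

lemma integral_fourier_mul (g : E) (ψ : 𝓢(ℝ, ℂ)) :
    ∫ x, (𝓕 ψ) x * g x = ∫ η, ψ η * (𝓕 g : E) η := by
  have h := congrArg (fun d => d ψ) (Lp.fourier_toTemperedDistribution_eq g)
  simpa using h

/-- Multiplication of a test function with `-2πiη`. -/
def mulFreq (ψ : 𝓢(ℝ, ℂ)) : 𝓢(ℝ, ℂ) :=
  SchwartzMap.smulLeftCLM ℂ (fun η : ℝ => -(Complex.I * (freq η : ℂ))) ψ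

lemma mulFreq_apply (ψ : 𝓢(ℝ, ℂ)) (η : ℝ) : mulFreq ψ η = -(Complex.I * (freq η : ℂ)) * ψ η := by
  have h : Function.HasTemperateGrowth fun η : ℝ => -(Complex.I * (freq η : ℂ)) := by
    have e : (fun η : ℝ => -(Complex.I * (freq η : ℂ))) =
        (-(Complex.I * (2 * Real.pi)) : ℂ) • ⇑Complex.ofRealCLM := by
      ext η; simp [freq]; ring
    rw [e]
    have := ((-(Complex.I * (2 * Real.pi)) : ℂ) • Complex.ofRealCLM).hasTemperateGrowth
    exact this
  rw [mulFreq, SchwartzMap.smulLeftCLM_apply_apply h, smul_eq_mul]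

lemma deriv_fourier_schwartz (ψ : 𝓢(ℝ, ℂ)) :
    SchwartzMap.derivCLM ℂ ℂ (𝓕 ψ) = 𝓕 (mulFreq ψ) := by
  ext x
  rw [SchwartzMap.derivCLM_apply, SchwartzMap.fourier_coe, SchwartzMap.fourier_coe,
    Real.deriv_fourier ψ.integrable]
  · refine congrFun (congrArg 𝓕 (funext fun η => ?_)) x
    rw [mulFreq_apply, smul_eq_mul, freq]; push_cast; ring
  · have := ψ.integrable_pow_mul volume 1
    refine (integrable_norm_iff ?_).1 (this.congr (Eventually.of_forall fun x => ?_))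
    · exact (by fun_prop : Continuous fun x : ℝ => x • ψ x).aestronglyMeasurable
    · simp

/-- The real part of a test function. -/
def reS (φ : 𝓢(ℝ, ℂ)) : 𝓢(ℝ, ℝ) := SchwartzMap.postcompCLM Complex.reCLM φ

/-- The imaginary part of a test function. -/
def imS (φ : 𝓢(ℝ, ℂ)) : 𝓢(ℝ, ℝ) := SchwartzMap.postcompCLM Complex.imCLM φ

/-- A real test function as a complex one. -/
def cS (φ : 𝓢(ℝ, ℝ)) : 𝓢(ℝ, ℂ) := SchwartzMap.postcompCLM Complex.ofRealCLM φ

lemma reS_apply (φ : 𝓢(ℝ, ℂ)) (x : ℝ) : reS φ x = (φ x).re := rfl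

lemma imS_apply (φ : 𝓢(ℝ, ℂ)) (x : ℝ) : imS φ x = (φ x).im := rfl

lemma cS_apply (φ : 𝓢(ℝ, ℝ)) (x : ℝ) : cS φ x = (φ x : ℂ) := rfl

lemma deriv_reS (φ : 𝓢(ℝ, ℂ)) :
    SchwartzMap.derivCLM ℝ ℝ (reS φ) = reS (SchwartzMap.derivCLM ℂ ℂ φ) := by
  ext x
  exact (Complex.reCLM.hasFDerivAt.comp_hasDerivAt x (φ.hasDerivAt x)).deriv

lemma deriv_imS (φ : 𝓢(ℝ, ℂ)) :
    SchwartzMap.derivCLM ℝ ℝ (imS φ) = imS (SchwartzMap.derivCLM ℂ ℂ φ) := by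
  ext x
  exact (Complex.imCLM.hasFDerivAt.comp_hasDerivAt x (φ.hasDerivAt x)).deriv

lemma deriv_cS (φ : 𝓢(ℝ, ℝ)) :
    SchwartzMap.derivCLM ℂ ℂ (cS φ) = cS (SchwartzMap.derivCLM ℝ ℝ φ) := by
  ext x
  exact (Complex.ofRealCLM.hasFDerivAt.comp_hasDerivAt x (φ.hasDerivAt x)).deriv

lemma integrable_mul_schwartz {f : ℝ → ℝ} (hf : MemLp f 2 volume) (φ : 𝓢(ℝ, ℂ)) :
    Integrable fun x => (φ x) * (f x : ℂ) :=
  MemLp.integrable_mul (φ.memLp 2 volume) (memLp_cE.2 hf)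

lemma integral_reS {f : ℝ → ℝ} (hf : MemLp f 2 volume) (φ : 𝓢(ℝ, ℂ)) :
    ∫ x, f x * reS φ x = (∫ x, φ x * (f x : ℂ)).re := by
  have := integral_re (integrable_mul_schwartz hf φ)
  simp only [RCLike.re_to_complex] at this
  rw [← this]
  refine integral_congr_ae (Eventually.of_forall fun x => ?_)
  simp [reS_apply, mul_comm]

lemma integral_imS {f : ℝ → ℝ} (hf : MemLp f 2 volume) (φ : 𝓢(ℝ, ℂ)) :
    ∫ x, f x * imS φ x = (∫ x, φ x * (f x : ℂ)).im := by
  have := integral_im (integrable_mul_schwartz hf φ)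
  simp only [RCLike.im_to_complex] at this
  rw [← this]
  refine integral_congr_ae (Eventually.of_forall fun x => ?_)
  simp [imS_apply, mul_comm]

lemma integral_cS (f : ℝ → ℝ) (φ : 𝓢(ℝ, ℝ)) :
    ∫ x, cS φ x * (f x : ℂ) = ((∫ x, f x * φ x : ℝ) : ℂ) := by
  rw [← integral_complex_ofReal]
  refine integral_congr_ae (Eventually.of_forall fun x => ?_)
  simp [cS_apply, mul_comm]

/-- The pairing of a real function with a test function, on the Fourier side. -/
lemma integral_fourier_mul_real {f : ℝ → ℝ} (hf : MemLp f 2 volume) (ψ : 𝓢(ℝ, ℂ)) :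
    ∫ x, (𝓕 ψ) x * (f x : ℂ) = ∫ η, ψ η * ftr f η := by
  have := integral_fourier_mul (toE (cE f)) ψ
  rw [← FT] at this
  refine Eq.trans (integral_congr_ae ?_) this
  filter_upwards [coeFn_toE (memLp_cE.2 hf)] with x hx
  rw [hx, cE]

lemma ae_eq_zero_of_forall_integral {F : ℝ → ℂ} (hF : LocallyIntegrable F)
    (h : ∀ ψ : 𝓢(ℝ, ℂ), ∫ η, ψ η * F η = 0) : F =ᵐ[volume] 0 := by
  refine ae_eq_zero_of_integral_contDiff_smul_eq_zero hF fun g hg hc => ?_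
  have hg₁ : HasCompactSupport (Complex.ofRealCLM ∘ g) := hc.comp_left rfl
  have hg₂ : ContDiff ℝ ((⊤ : ℕ∞) : WithTop ℕ∞) (Complex.ofRealCLM ∘ g) := by fun_prop
  have := h (hg₁.toSchwartzMap hg₂)
  simpa using this

/-! ### Hermitian functions and real functions -/

/-- The reflection `ψ(η) ↦ conj ψ(-η)` of test functions. -/
def reflS (ψ : 𝓢(ℝ, ℂ)) : 𝓢(ℝ, ℂ) :=
  SchwartzMap.compCLMOfContinuousLinearEquiv ℝ (ContinuousLinearEquiv.neg ℝ)
    (SchwartzMap.postcompCLM (Complex.conjCLE : ℂ →L[ℝ] ℂ) ψ)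

lemma reflS_apply (ψ : 𝓢(ℝ, ℂ)) (η : ℝ) : reflS ψ η = starRingEnd ℂ (ψ (-η)) := rfl

lemma fourier_reflS (ψ : 𝓢(ℝ, ℂ)) (x : ℝ) : (𝓕 (reflS ψ)) x = starRingEnd ℂ ((𝓕 ψ) x) := by
  rw [SchwartzMap.fourier_coe, SchwartzMap.fourier_coe, Real.fourier_eq', Real.fourier_eq',
    ← integral_conj, ← integral_neg_eq_self]
  refine integral_congr_ae (Eventually.of_forall fun η => ?_)
  simp only [reflS_apply, neg_neg, smul_eq_mul, map_mul, ← Complex.exp_conj]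
  congr 2
  simp [Complex.conj_ofNat]

lemma locallyIntegrable_of_memLp {F : ℝ → ℂ} (hF : MemLp F 2 volume) : LocallyIntegrable F :=
  hF.locallyIntegrable (by norm_num)

lemma integrable_schwartz_mul {F : ℝ → ℂ} (hF : MemLp F 2 volume) (ψ : 𝓢(ℝ, ℂ)) :
    Integrable fun x => ψ x * F x := MemLp.integrable_mul (ψ.memLp 2 volume) hF

/-- By duality: the transform of `reflS ψ` is the conjugate of that of `ψ`, and `f` is real. -/
lemma hermAE_ftr {f : ℝ → ℝ} (hf : MemLp f 2 volume) : HermAE (ftr f) := by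
  have hm := memLp_refl (memLp_ftr f)
  have h : (fun η => starRingEnd ℂ (ftr f (-η)) - ftr f η) =ᵐ[volume] 0 := by
    refine ae_eq_zero_of_forall_integral
      (locallyIntegrable_of_memLp (hm.sub (memLp_ftr f))) fun ψ => ?_
    simp only [mul_sub]
    rw [integral_sub (integrable_schwartz_mul hm ψ) (integrable_schwartz_mul (memLp_ftr f) ψ),
      ← integral_fourier_mul_real hf, sub_eq_zero,
      ← integral_neg_eq_self fun η => ψ η * starRingEnd ℂ (ftr f (-η))]
    have h1 := congrArg (starRingEnd ℂ) (integral_fourier_mul_real hf (reflS ψ))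
    rw [← integral_conj, ← integral_conj] at h1
    simp only [fourier_reflS, reflS_apply, map_mul, Complex.conj_conj, Complex.conj_ofReal] at h1
    simp only [neg_neg]
    exact h1.symm
  filter_upwards [ae_neg h] with η h1
  have := sub_eq_zero.1 h1
  rw [neg_neg] at this
  exact this.symm

/-- The real function with the Fourier transform `F`. -/
def inv (F : ℝ → ℂ) (x : ℝ) : ℝ := ((𝓕⁻ (toE F) : E) x).re

lemma memLp_inv (F : ℝ → ℂ) : MemLp (inv F) 2 volume := (Lp.memLp (𝓕⁻ (toE F) : E)).re

/-- The real and imaginary parts of the inverse transform both have Hermitian transforms. If `F` is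
Hermitian, then so is `i` times the transform of the imaginary part, which must therefore vanish. -/
lemma ftr_inv {F : ℝ → ℂ} (hF : MemLp F 2 volume) (h : HermAE F) : ftr (inv F) =ᵐ[volume] F := by
  set g : E := 𝓕⁻ (toE F) with hg
  have hi : MemLp (fun x => (g x).im) 2 volume := (Lp.memLp g).im
  have h1 : g = toE (cE (inv F)) + Complex.I • toE (cE fun x => (g x).im) := by
    rw [← toE_const_mul _ (memLp_cE.2 hi),
      ← toE_add (memLp_cE.2 (memLp_inv F)) ((memLp_cE.2 hi).const_mul _)]
    conv_lhs => rw [← toE_coe g]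
    congr 1; ext x
    simp only [cE, inv, ← hg]
    rw [mul_comm, Complex.re_add_im]
  have h2 : toE F = FT (inv F) + Complex.I • FT fun x => (g x).im := by
    rw [FT, FT, ← FourierTransform.fourier_smul, ← FourierTransform.fourier_add, ← h1, hg]
    simp
  have h3 : F =ᵐ[volume] fun η => ftr (inv F) η + Complex.I * ftr (fun x => (g x).im) η := by
    refine ((toE_eq_iff hF).1 h2).trans ?_
    filter_upwards [Lp.coeFn_add (FT (inv F)) (Complex.I • FT fun x => (g x).im),
      Lp.coeFn_smul Complex.I (FT fun x => (g x).im)] with η h4 h5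
    rw [h4, Pi.add_apply, h5]; rfl
  filter_upwards [h, h3, ae_neg h3, hermAE_ftr (memLp_inv F), hermAE_ftr hi] with η a1 a2 a3 a4 a5
  rw [a2, a3, a4, a5, map_add, map_mul, Complex.conj_I] at a1
  have : Complex.I * starRingEnd ℂ (ftr (fun x => (g x).im) η) = 0 := by linear_combination a1 / 2
  rw [mul_eq_zero, or_iff_right Complex.I_ne_zero, map_eq_zero] at this
  rw [a2, this, mul_zero, add_zero]

/-! ### Distributional equations -/

lemma iteratedDeriv_two_schwartz (φ : 𝓢(ℝ, ℝ)) : iteratedDeriv 2 φ =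
    SchwartzMap.derivCLM ℝ ℝ (SchwartzMap.derivCLM ℝ ℝ φ) := by
  rw [iteratedDeriv_succ, iteratedDeriv_one]
  ext x
  rw [SchwartzMap.derivCLM_apply]; rfl

lemma forall_real_iff {f₀ f₁ f₂ : ℝ → ℝ} (h₀ : MemLp f₀ 2 volume) (h₁ : MemLp f₁ 2 volume)
    (h₂ : MemLp f₂ 2 volume) :
    (∀ φ : 𝓢(ℝ, ℝ), (∫ x, f₀ x * φ x) + (∫ x, f₁ x * deriv φ x) +
        (∫ x, f₂ x * iteratedDeriv 2 φ x) = 0) ↔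
      ∀ φ : 𝓢(ℝ, ℂ), (∫ x, φ x * (f₀ x : ℂ)) +
        (∫ x, SchwartzMap.derivCLM ℂ ℂ φ x * (f₁ x : ℂ)) +
        (∫ x, SchwartzMap.derivCLM ℂ ℂ (SchwartzMap.derivCLM ℂ ℂ φ) x * (f₂ x : ℂ)) = 0 := by
  simp only [iteratedDeriv_two_schwartz, ← SchwartzMap.derivCLM_apply ℝ]
  constructor
  · intro h φ
    have hr := h (reS φ)
    have hi := h (imS φ)
    simp only [deriv_reS, deriv_imS, integral_reS h₀, integral_reS h₁, integral_reS h₂,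
      integral_imS h₀, integral_imS h₁, integral_imS h₂] at hr hi
    exact Complex.ext (by simpa using hr) (by simpa using hi)
  · intro h φ
    have := h (cS φ)
    simp only [deriv_cS, integral_cS] at this
    exact_mod_cast this

/-- A distributional equation of second order on the Fourier side. -/
lemma forall_test_iff {f₀ f₁ f₂ : ℝ → ℝ} (h₀ : MemLp f₀ 2 volume) (h₁ : MemLp f₁ 2 volume)
    (h₂ : MemLp f₂ 2 volume) :
    (∀ φ : 𝓢(ℝ, ℝ), (∫ x, f₀ x * φ x) + (∫ x, f₁ x * deriv φ x) +
        (∫ x, f₂ x * iteratedDeriv 2 φ x) = 0) ↔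
      ∀ᵐ η, ftr f₀ η - Complex.I * (freq η : ℂ) * ftr f₁ η - (freq η : ℂ) ^ 2 * ftr f₂ η = 0 := by
  -- Test functions are written as `𝓕 ψ`; each derivative then becomes the factor `-iξ` on `ψ`.
  have hc : ∀ ψ : 𝓢(ℝ, ℂ), (∫ x, (𝓕 ψ) x * (f₀ x : ℂ)) +
        (∫ x, SchwartzMap.derivCLM ℂ ℂ (𝓕 ψ) x * (f₁ x : ℂ)) +
        (∫ x, SchwartzMap.derivCLM ℂ ℂ (SchwartzMap.derivCLM ℂ ℂ (𝓕 ψ)) x * (f₂ x : ℂ)) =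
      ∫ η, ψ η * (ftr f₀ η - Complex.I * (freq η : ℂ) * ftr f₁ η -
        (freq η : ℂ) ^ 2 * ftr f₂ η) := by
    intro ψ
    have i₀ := integrable_schwartz_mul (memLp_ftr f₀) ψ
    have i₁ := integrable_schwartz_mul (memLp_ftr f₁) (mulFreq ψ)
    have i₂ := integrable_schwartz_mul (memLp_ftr f₂) (mulFreq (mulFreq ψ))
    rw [deriv_fourier_schwartz, deriv_fourier_schwartz, integral_fourier_mul_real h₀,
      integral_fourier_mul_real h₁, integral_fourier_mul_real h₂, ← integral_add i₀ i₁,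
      ← integral_add (by exact i₀.add i₁) i₂]
    refine integral_congr_ae (Eventually.of_forall fun η => ?_)
    simp only [mulFreq_apply]
    linear_combination (freq η : ℂ) ^ 2 * ψ η * ftr f₂ η * Complex.I_sq
  rw [forall_real_iff h₀ h₁ h₂]
  constructor
  · intro h
    refine ae_eq_zero_of_forall_integral ?_ fun ψ => by rw [← hc]; exact h _
    have c₁ : Continuous fun η : ℝ => Complex.I * (freq η : ℂ) := by unfold freq; fun_prop
    have c₂ : Continuous fun η : ℝ => (freq η : ℂ) ^ 2 := by unfold freq; fun_prop
    have l := fun f => locallyIntegrable_of_memLp (memLp_ftr f)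
    refine ((l f₀).sub ?_).sub ?_
    · exact (l f₁).continuous_mul c₁
    · exact (l f₂).continuous_mul c₂
  · intro h φ
    have := hc (𝓕⁻ φ)
    rw [FourierTransform.fourier_fourierInv_eq] at this
    rw [this]
    refine integral_eq_zero_of_ae ?_
    filter_upwards [h] with η h1
    rw [h1, mul_zero]; rfl

lemma isWeakDeriv_iff {f g : ℝ → ℝ} : IsWeakDeriv f g ↔ MemLp f 2 volume ∧ MemLp g 2 volume ∧
    ftr g =ᵐ[volume] fun η => Complex.I * (freq η : ℂ) * ftr f η := by
  refine and_congr_right fun hf => and_congr_right fun hg => ?_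
  have := forall_test_iff hg hf (f₂ := 0) MemLp.zero
  have h0 : ftr (0 : ℝ → ℝ) =ᵐ[volume] 0 := by
    have := ftr_const_mul 0 hf
    have e : (0 : ℝ → ℝ) = fun x => 0 * f x := by ext x; simp
    rw [e]
    filter_upwards [this] with η h1
    rw [h1]; simp
  simp only [Pi.zero_apply, zero_mul, integral_zero, add_zero] at this
  refine Iff.trans (forall_congr' fun φ => ?_) (this.trans ?_)
  · rw [eq_neg_iff_add_eq_zero, add_comm]
  · refine eventually_congr ?_
    filter_upwards [h0] with η h1
    rw [h1, Pi.zero_apply, mul_zero, sub_zero, sub_eq_zero]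

/-! ### Products of real functions -/

lemma continuous_fourier_of_integrable {F : ℝ → ℂ} (hF : Integrable F) : Continuous (𝓕 F) :=
  VectorFourier.fourierIntegral_continuous Real.continuous_fourierChar
    (L := innerₗ ℝ) continuous_inner hF

lemma integral_fourier_mul_of_integrable {F : ℝ → ℂ} (hF : Integrable F) (ψ : 𝓢(ℝ, ℂ)) :
    ∫ x, (𝓕 ψ) x * F x = ∫ η, ψ η * (𝓕 F) η := by
  simpa using! VectorFourier.integral_bilin_fourierIntegral_eq_flip (ContinuousLinearMap.mul ℂ ℂ)
    (L := innerₗ ℝ) Real.continuous_fourierChar continuous_inner (ψ.integrable (μ := volume)) hF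

/-- The two Fourier transforms agree on `L¹ ∩ L²`. -/
lemma fourier_toE_ae {F : ℝ → ℂ} (hF : Integrable F) (hF₂ : MemLp F 2 volume) :
    (𝓕 (toE F) : E) =ᵐ[volume] 𝓕 F := by
  have hc := continuous_fourier_of_integrable hF
  have h : (fun η => (𝓕 (toE F) : E) η - (𝓕 F) η) =ᵐ[volume] 0 := by
    refine ae_eq_zero_of_forall_integral
      ((locallyIntegrable_of_memLp (Lp.memLp _)).sub hc.locallyIntegrable) fun ψ => ?_
    have hb : Integrable fun η => ψ η * (𝓕 F) η := by
      refine (ψ.integrable (μ := volume)).mul_bdd (c := ∫ v, ‖F v‖) hc.aestronglyMeasurable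
        (Eventually.of_forall fun η => ?_)
      exact VectorFourier.norm_fourierIntegral_le_integral_norm _ _ _ F η
    simp only [mul_sub]
    rw [integral_sub (integrable_schwartz_mul (Lp.memLp _) ψ) hb, ← integral_fourier_mul,
      ← integral_fourier_mul_of_integrable hF, sub_eq_zero]
    refine integral_congr_ae ?_
    filter_upwards [coeFn_toE hF₂] with η h1
    rw [h1]
  filter_upwards [h] with η h1
  exact sub_eq_zero.1 h1

lemma fourier_fourier_ae (f : E) : (𝓕 (𝓕 f) : E) =ᵐ[volume] fun x => f (-x) := by
  have hm : MemLp (fun x => f (-x)) 2 volume :=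
    (Lp.memLp f).comp_measurePreserving (Measure.measurePreserving_neg volume)
  have h : (fun x => (𝓕 (𝓕 f) : E) x - f (-x)) =ᵐ[volume] 0 := by
    refine ae_eq_zero_of_forall_integral
      (locallyIntegrable_of_memLp ((Lp.memLp _).sub hm)) fun ψ => ?_
    simp only [mul_sub]
    rw [integral_sub (integrable_schwartz_mul (Lp.memLp _) ψ) (integrable_schwartz_mul hm ψ),
      ← integral_fourier_mul, ← integral_fourier_mul, sub_eq_zero,
      ← integral_neg_eq_self fun x => ψ x * f (-x)]
    refine integral_congr_ae (Eventually.of_forall fun x => ?_)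
    have e : (𝓕 (𝓕 ψ)) x = ψ (-x) := by
      have h1 : (𝓕⁻ (𝓕 ψ)) (-x) = ψ (-x) := by rw [FourierTransform.fourierInv_fourier_eq]
      rw [SchwartzMap.fourierInv_coe, Real.fourierInv_eq_fourier_neg, neg_neg] at h1
      exact h1
    simp only [e, neg_neg]
  filter_upwards [h] with η h1
  exact sub_eq_zero.1 h1

lemma fourier_ftr_ae {f : ℝ → ℝ} (hf : MemLp f 2 volume) (h1 : Integrable (ftr f)) :
    ∀ᵐ x, (𝓕 (ftr f)) x = (f (-x) : ℂ) := by
  have h := fourier_toE_ae h1 (memLp_ftr f)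
  rw [toE_ftr, FT] at h
  filter_upwards [h, fourier_fourier_ae (toE (cE f)), ae_neg (coeFn_toE (memLp_cE.2 hf))]
    with x a1 a2 a3
  rw [← a1, a2, a3, cE]

lemma bil_oneKer_eq_convolution (F G : ℝ → ℂ) :
    bil oneKer F G = convolution F G (ContinuousLinearMap.mul ℂ ℂ) volume := by
  ext ξ
  rw [convolution_eq_swap, bil]
  simp [oneKer]

/-- The Fourier transform maps products to convolutions. -/
lemma ftr_mul {f g : ℝ → ℝ} (hf : MemLp f 2 volume) (hg : MemLp g 2 volume)
    (hf₁ : Integrable (ftr f)) (hg₁ : Integrable (ftr g)) :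
    MemLp (fun x => f x * g x) 2 volume ∧
      ftr (fun x => f x * g x) =ᵐ[volume] bil oneKer (ftr f) (ftr g) := by
  have hF : InH 0 (ftr f) := inH_zero_iff.2 (memLp_ftr f)
  have hG : InH 0 (ftr g) := inH_zero_iff.2 (memLp_ftr g)
  have hB : MemLp (bil oneKer (ftr f) (ftr g)) 2 volume :=
    inH_zero_iff.1 (bilBound_left (j := 0) (σ := 0) (τ := 0) (A := 1) measurable_oneKer zero_le_one
      (fun x y => by simp [oneKer, wt_zero]) (by simpa [InL1, wt_zero] using hf₁) hG hF.aesm).mem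
  have hB₁ : Integrable (bil oneKer (ftr f) (ftr g)) := by
    rw [bil_oneKer_eq_convolution]
    exact hf₁.integrable_convolution _ hg₁
  set b : E := toE (bil oneKer (ftr f) (ftr g)) with hb
  -- The convolution lies in `L¹ ∩ L²`, so its transform is given by the integral and equals the
  -- reflected product; injectivity of the transform on `L²` then identifies it.
  have h1 : ∀ᵐ x, (𝓕 b : E) x = ((f (-x) * g (-x) : ℝ) : ℂ) := by
    filter_upwards [fourier_toE_ae hB₁ hB, fourier_ftr_ae hf hf₁, fourier_ftr_ae hg hg₁]
      with x a1 a2 a3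
    rw [a1, bil_oneKer_eq_convolution, Real.fourier_mul_convolution_eq hf₁ hg₁, a2, a3]
    push_cast; rfl
  have h2 : ∀ᵐ x, (𝓕 b : E) (-x) = ((f x * g x : ℝ) : ℂ) := by
    filter_upwards [ae_neg h1] with x hx
    rw [hx, neg_neg]
  have hm : MemLp (fun x => f x * g x) 2 volume := by
    refine memLp_cE.1 (MemLp.ae_eq h2 ?_)
    exact (Lp.memLp (𝓕 b : E)).comp_measurePreserving (Measure.measurePreserving_neg volume)
  refine ⟨hm, ?_⟩
  have h3 : (𝓕 (FT fun x => f x * g x) : E) = 𝓕 b := by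
    refine Lp.ext ?_
    filter_upwards [h1, fourier_fourier_ae (toE (cE fun x => f x * g x)),
      ae_neg (coeFn_toE (memLp_cE.2 hm))] with x a1 a2 a3
    rw [FT, a1, a2, a3, cE]
  have h4 : FT (fun x => f x * g x) = b := (Lp.fourierTransformₗᵢ ℝ ℂ).injective h3
  rw [← toE_ftr, hb] at h4
  exact (coeFn_toE (memLp_ftr _)).symm.trans (h4 ▸ coeFn_toE hB)

/-! ### Equations in terms of Fourier transforms -/

/-- `f ∈ L²` is a real function with the Fourier transform `F`. -/
structure HasFT (f : ℝ → ℝ) (F : ℝ → ℂ) : Prop where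
  memLp : MemLp f 2 volume
  ae : ftr f =ᵐ[volume] F

lemma hasFT_ftr {f : ℝ → ℝ} (hf : MemLp f 2 volume) : HasFT f (ftr f) := ⟨hf, ae_eq_rfl⟩

lemma hasFT_inv {F : ℝ → ℂ} (hF : MemLp F 2 volume) (h : HermAE F) : HasFT (inv F) F :=
  ⟨memLp_inv F, ftr_inv hF h⟩

variable {f g : ℝ → ℝ} {F G : ℝ → ℂ}

lemma HasFT.congr (h : HasFT f F) (hFG : F =ᵐ[volume] G) : HasFT f G := ⟨h.1, h.2.trans hFG⟩

lemma HasFT.add (hf : HasFT f F) (hg : HasFT g G) :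
    HasFT (fun x => f x + g x) (fun η => F η + G η) :=
  ⟨hf.1.add hg.1, (ftr_add hf.1 hg.1).trans (hf.2.add hg.2)⟩

lemma HasFT.sub (hf : HasFT f F) (hg : HasFT g G) :
    HasFT (fun x => f x - g x) (fun η => F η - G η) :=
  ⟨hf.1.sub hg.1, (ftr_sub hf.1 hg.1).trans (hf.2.sub hg.2)⟩

lemma HasFT.const_mul (hf : HasFT f F) (c : ℝ) :
    HasFT (fun x => c * f x) (fun η => (c : ℂ) * F η) :=
  ⟨hf.1.const_mul c, (ftr_const_mul c hf.1).trans (by filter_upwards [hf.2] with η h; rw [h])⟩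

lemma HasFT.mul (hf : HasFT f F) (hg : HasFT g G) (hF : Integrable F) (hG : Integrable G) :
    HasFT (fun x => f x * g x) (bil oneKer F G) := by
  obtain ⟨h1, h2⟩ := ftr_mul hf.1 hg.1 (hF.congr hf.2.symm) (hG.congr hg.2.symm)
  exact ⟨h1, by rw [← bil_congr hf.2 hg.2]; exact h2⟩

lemma hasFT_zero : HasFT (fun _ => 0) fun _ => 0 := by
  simpa using (hasFT_ftr (MemLp.zero (α := ℝ) (ε := ℝ) (p := 2) (μ := volume))).const_mul 0

lemma HasFT.ae_eq_zero_iff (hf : HasFT f F) : f =ᵐ[volume] (fun _ => 0) ↔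
    F =ᵐ[volume] fun _ => 0 := by
  constructor
  · intro h
    have := hf.2
    rw [ftr_congr h] at this
    exact this.symm.trans hasFT_zero.2
  · intro h
    exact ftr_inj hf.1 hasFT_zero.1 ((hf.2.trans h).trans hasFT_zero.2.symm)

/-- The Fourier transform of the derivative. -/
def dF (F : ℝ → ℂ) (η : ℝ) : ℂ := Complex.I * (freq η : ℂ) * F η

lemma dF_congr (h : F =ᵐ[volume] G) : dF F =ᵐ[volume] dF G := by
  filter_upwards [h] with η h1
  rw [dF, dF, h1]

lemma HermAE.dF (h : HermAE F) : HermAE (dF F) := (hermAE_of_odd freq_neg).mul h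

lemma InH.dF {σ : ℝ} (hF : InH (σ + 1) F) : InH σ (dF F) := by
  refine hF.of_le (C := 1) ?_ (Eventually.of_forall fun η => ?_)
  · exact (by unfold freq; fun_prop : Continuous fun η : ℝ => Complex.I * (freq η : ℂ)
      ).aestronglyMeasurable.mul hF.aesm
  · have h : |freq η| ≤ wt 1 η := by
      refine abs_le_of_sq_le_sq ?_ (wt_nonneg 1 η)
      rw [wt_one_sq]
      linarith
    rw [LongWave.dF, norm_mul, norm_mul, Complex.norm_I, one_mul, one_mul, Complex.norm_real,
      Real.norm_eq_abs, wt_add, mul_assoc]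
    have := wt_nonneg σ η
    gcongr

lemma HasFT.isWeakDeriv_iff (hf : HasFT f F) : IsWeakDeriv f g ↔ HasFT g (dF F) := by
  rw [LongWave.isWeakDeriv_iff]
  have h := dF_congr hf.2
  constructor
  · rintro ⟨-, h1, h2⟩
    exact ⟨h1, EventuallyEq.trans h2 h⟩
  · rintro ⟨h1, h2⟩
    exact ⟨hf.1, h1, EventuallyEq.trans h2 h.symm⟩

lemma integrable_mul_test (hf : MemLp f 2 volume) (φ : 𝓢(ℝ, ℝ)) : Integrable fun x => f x * φ x :=
  MemLp.integrable_mul hf (φ.memLp 2 volume)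

/-- The improved Boussinesq equation on the Fourier side. -/
lemma ib_equation_iff {ε δ : ℝ} {u a : ℝ → ℝ} {U A : ℝ → ℂ} (hu : HasFT u U) (hU : Integrable U)
    (ha : HasFT a A) : (∀ φ : 𝓢(ℝ, ℝ), (∫ x, a x * φ x) - (∫ x, u x * iteratedDeriv 2 φ x)
        - δ ^ 2 * (∫ x, a x * iteratedDeriv 2 φ x)
        - ε * (∫ x, u x ^ 2 * iteratedDeriv 2 φ x) = 0) ↔ A =ᵐ[volume] ibAcc ε δ U := by
  have h2 := hu.mul hu hU hU
  have h3 := ((hu.const_mul (-1)).sub (ha.const_mul (δ ^ 2))).sub (h2.const_mul ε)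
  refine Iff.trans (forall_congr' fun φ => ?_)
    ((forall_test_iff ha.1 hasFT_zero.1 h3.1).trans (eventually_congr ?_))
  · have e : ∫ x, (-1 * u x - δ ^ 2 * a x - ε * (u x * u x)) * iteratedDeriv 2 φ x =
        -(∫ x, u x * iteratedDeriv 2 φ x) - δ ^ 2 * (∫ x, a x * iteratedDeriv 2 φ x)
        - ε * (∫ x, u x ^ 2 * iteratedDeriv 2 φ x) := by
      rw [iteratedDeriv_two_schwartz]
      set ψ := SchwartzMap.derivCLM ℝ ℝ (SchwartzMap.derivCLM ℝ ℝ φ)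
      have i₁ := integrable_mul_test hu.1 ψ
      have i₂ := integrable_mul_test ha.1 ψ
      have i₃ := integrable_mul_test h2.1 ψ
      rw [← integral_neg, ← integral_const_mul, ← integral_const_mul,
        ← integral_sub (by exact i₁.neg) (by exact i₂.const_mul _)]
      simp only [sq (u _)]
      rw [← integral_sub (by exact i₁.neg.sub (i₂.const_mul _)) (i₃.const_mul _)]
      refine integral_congr_ae (Eventually.of_forall fun x => ?_)
      ring
    rw [e]
    simp only [zero_mul, integral_zero]
    constructor <;> intro h <;> linear_combination h
  · filter_upwards [ha.2, h3.2, hasFT_zero.2] with η a1 a2 a3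
    rw [a1, a2, a3, ibAcc, ibSym]
    -- The equation is solved for `û_tt` by dividing by `1 + δ²ξ²`, which never vanishes.
    have h4 : (1 + (δ : ℂ) ^ 2 * (freq η : ℂ) ^ 2) * (ibOm δ (freq η) : ℂ) ^ 2 =
        (freq η : ℂ) ^ 2 := by exact_mod_cast ibOm_sq_mul δ (freq η)
    have h5 : (1 + (δ : ℂ) ^ 2 * (freq η : ℂ) ^ 2) ≠ 0 := by
      exact_mod_cast (by positivity : (0 : ℝ) < 1 + δ ^ 2 * freq η ^ 2).ne'
    have h6 : (1 + (δ : ℂ) ^ 2 * (freq η : ℂ) ^ 2) * (Complex.I * (ibOm δ (freq η) : ℂ) *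
        (Complex.I * (ibOm δ (freq η) : ℂ) * (U η + ε * bil oneKer U U η))) =
        -(freq η : ℂ) ^ 2 * (U η + ε * bil oneKer U U η) := by
      linear_combination -(U η + ε * bil oneKer U U η) * h4 + (1 + (δ : ℂ) ^ 2 * (freq η : ℂ) ^ 2) * (ibOm δ (freq η) : ℂ) ^ 2 *
        (U η + ε * bil oneKer U U η) * Complex.I_sq
    push_cast
    constructor <;> intro h
    · refine mul_left_cancel₀ h5 ?_
      rw [h6]
      linear_combination h
    · rw [← h] at h6
      linear_combination h6

lemma integrable_oneKer (hF : Integrable F) (hF₂ : MemLp F 2 volume) (hG : MemLp G 2 volume) :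
    ∀ᵐ ξ, Integrable fun η => F (ξ - η) * G η := by
  have := (bilBound_left (F := F) (j := 0) (σ := 0) (τ := 0) (A := 1) measurable_oneKer zero_le_one
      (fun x y => by simp [oneKer, wt_zero]) (by simpa [InL1, wt_zero] using hF)
      (inH_zero_iff.2 hG) hF₂.1).integrable
  simpa [oneKer] using this

/-- The quadratic terms of the Camassa-Holm equation on the Fourier side. -/
lemma den_mul_bil_chKer (δ : ℝ) {W : ℝ → ℂ} (h₀ : Integrable W) (h₁ : Integrable (dF W))
    (m₀ : MemLp W 2 volume) (m₁ : MemLp (dF W) 2 volume)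
    (m₂ : MemLp (dF (dF W)) 2 volume) (m₃ : MemLp (dF (dF (dF W))) 2 volume) :
    ∀ᵐ ξ, (1 + 5 / 4 * (δ : ℂ) ^ 2 * (freq ξ : ℂ) ^ 2) * bil (chKer δ) W W ξ =
      bil oneKer W (dF W) ξ - 3 / 4 * (δ : ℂ) ^ 2 *
        (2 * bil oneKer (dF W) (dF (dF W)) ξ + bil oneKer W (dF (dF (dF W))) ξ) := by
  have flip : ∀ {F G : ℝ → ℂ} {ξ : ℝ}, (Integrable fun η => F (ξ - η) * G η) →
      Integrable fun η => G (ξ - η) * F η := fun {F G ξ} h => by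
    have := h.comp_sub_left ξ
    simpa [mul_comm] using this
  filter_upwards [integrable_oneKer h₀ m₀ m₁, integrable_oneKer h₁ m₁ m₂,
    integrable_oneKer h₀ m₀ m₃] with ξ i₁ i₂ i₃
  -- `chKer` is symmetric in the two frequencies, so the convolutions are symmetrized before the
  -- integrands are compared.
  have sym : ∀ F G : ℝ → ℂ, (Integrable fun η => F (ξ - η) * G η) →
      bil oneKer F G ξ = ∫ η, 1 / 2 * (F (ξ - η) * G η + G (ξ - η) * F η) := fun F G h => by
    rw [integral_const_mul, integral_add h (flip h)]
    have e := congrFun (bil_comm oneKer_symm F G) ξ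
    simp only [bil, oneKer, one_mul] at e ⊢
    rw [← e]; ring
  have j₁ := ((i₁.add (flip i₁)).const_mul (1 / 2 : ℂ))
  have j₂ := ((i₂.add (flip i₂)).const_mul (1 / 2 : ℂ))
  have j₃ := ((i₃.add (flip i₃)).const_mul (1 / 2 : ℂ))
  rw [sym _ _ i₁, sym _ _ i₂, sym _ _ i₃, ← integral_const_mul,
    ← integral_add (by exact j₂.const_mul 2) (by exact j₃), ← integral_const_mul,
    ← integral_sub (by exact j₁) (by exact ((j₂.const_mul 2).add j₃).const_mul _), bil,
    ← integral_const_mul]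
  refine integral_congr_ae (Eventually.of_forall fun η => ?_)
  have hd := ch_den_pos δ (freq ξ)
  -- The symbol of `w w_x - 3/4 δ² (2 w_x w_xx + w w_xxx) = 1/2 ∂_x (1 - 3/4 δ² ∂_x²) w² + 3/8 δ²
  -- ∂_x (w_x²)`.
  have e₁ : (1 + 5 / 4 * (δ : ℂ) ^ 2 * (freq ξ : ℂ) ^ 2) * chKer δ (ξ - η) η = Complex.I * (1 / 2) *
      ((freq ξ : ℂ) * (1 + 3 / 4 * (δ : ℂ) ^ 2 * (freq ξ : ℂ) ^ 2) -
        3 / 4 * (δ : ℂ) ^ 2 * (freq ξ : ℂ) * (freq (ξ - η) : ℂ) * (freq η : ℂ)) := by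
    have h : (1 + 5 / 4 * δ ^ 2 * freq ξ ^ 2) * (1 / 2 * (chOm δ (freq ξ) -
        chLo δ (freq ξ) * freq (ξ - η) * freq η)) = 1 / 2 * (freq ξ * (1 + 3 / 4 * δ ^ 2 *
        freq ξ ^ 2) - 3 / 4 * δ ^ 2 * freq ξ * freq (ξ - η) * freq η) := by
      rw [chOm, chLo]; field_simp
    have h' := congrArg (fun r : ℝ => (r : ℂ)) h
    push_cast at h'
    rw [chKer, sub_add_cancel]
    push_cast
    linear_combination Complex.I * h'
  have e₂ : (freq ξ : ℂ) = freq (ξ - η) + freq η := by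
    rw [← Complex.ofReal_add, ← freq_add, sub_add_cancel]
  simp only [dF]
  rw [← mul_assoc, ← mul_assoc, e₁, e₂]
  have h3 : Complex.I ^ 3 = -Complex.I := Complex.I_pow_three
  ring_nf
  simp only [h3]
  ring

/-- The Camassa-Holm equation on the Fourier side. -/
lemma ch_equation_iff {κ ε δ : ℝ} {w wx wxx wxxx wt wtxx : ℝ → ℝ} {W V : ℝ → ℂ}
    (h₀ : HasFT w W) (h₁ : HasFT wx (dF W)) (h₂ : HasFT wxx (dF (dF W)))
    (h₃ : HasFT wxxx (dF (dF (dF W)))) (ht : HasFT wt V) (ht₂ : HasFT wtxx (dF (dF V)))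
    (m₀ : MemLp W 2 volume) (m₁ : MemLp (dF W) 2 volume) (m₂ : MemLp (dF (dF W)) 2 volume)
    (m₃ : MemLp (dF (dF (dF W))) 2 volume) (i₀ : Integrable W) (i₁ : Integrable (dF W))
    (i₂ : Integrable (dF (dF W))) (i₃ : Integrable (dF (dF (dF W)))) :
    (∀ᵐ x, wt x + κ * wx x + κ * ε * (w x * wx x) - κ * (3 / 4) * δ ^ 2 * wxxx x
        - (5 / 4) * δ ^ 2 * wtxx x
        - κ * (3 / 4) * ε * δ ^ 2 * (2 * wx x * wxx x + w x * wxxx x) = 0) ↔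
      V =ᵐ[volume] chRhs κ ε δ W := by
  have h := ((((ht.add (h₁.const_mul κ)).add ((h₀.mul h₁ i₀ i₁).const_mul (κ * ε))).sub
    (h₃.const_mul (κ * (3 / 4) * δ ^ 2))).sub (ht₂.const_mul ((5 / 4) * δ ^ 2))).sub
    ((((h₁.mul h₂ i₁ i₂).const_mul 2).add (h₀.mul h₃ i₀ i₃)).const_mul (κ * (3 / 4) * ε * δ ^ 2))
  refine Iff.trans (eventually_congr (Eventually.of_forall fun x => ?_))
    (h.ae_eq_zero_iff.trans (eventually_congr ?_))
  · simp only [mul_assoc 2 (wx x)]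
  · filter_upwards [den_mul_bil_chKer δ i₀ i₁ m₀ m₁ m₂ m₃] with η hb
    have hd : (1 + 5 / 4 * (δ : ℂ) ^ 2 * (freq η : ℂ) ^ 2) ≠ 0 := by
      have h1 := Complex.ofReal_ne_zero.2 (ch_den_pos δ (freq η)).ne'
      push_cast at h1
      exact h1
    have hl : (1 + 5 / 4 * (δ : ℂ) ^ 2 * (freq η : ℂ) ^ 2) * (chOm δ (freq η) : ℂ) =
        (freq η : ℂ) * (1 + 3 / 4 * (δ : ℂ) ^ 2 * (freq η : ℂ) ^ 2) := by
      have h1 : (1 + 5 / 4 * δ ^ 2 * freq η ^ 2) * chOm δ (freq η) =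
          freq η * (1 + 3 / 4 * δ ^ 2 * freq η ^ 2) := by
        have := ch_den_pos δ (freq η)
        rw [chOm]; field_simp
      have h2 := congrArg (fun r : ℝ => (r : ℂ)) h1
      push_cast at h2
      exact h2
    refine Iff.trans (b := (1 + 5 / 4 * (δ : ℂ) ^ 2 * (freq η : ℂ) ^ 2) *
      (V η - chRhs κ ε δ W η) = 0) (iff_of_eq ?_) (by rw [mul_eq_zero, or_iff_right hd, sub_eq_zero])
    congr 1
    rw [chRhs, chLin]
    simp only [dF]
    push_cast
    linear_combination -(κ * ε : ℂ) * hb - Complex.I * κ * W η * hl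
      - (5 / 4 * (δ : ℂ) ^ 2 * (freq η : ℂ) ^ 2 * V η +
        3 / 4 * κ * (δ : ℂ) ^ 2 * Complex.I * (freq η : ℂ) ^ 3 * W η) * Complex.I_sq

/-! ### Solutions and their Fourier transforms -/

lemma InH.memLp {σ : ℝ} {F : ℝ → ℂ} (h : InH σ F) (hσ : 0 ≤ σ) : MemLp F 2 volume :=
  inH_zero_iff.1 (h.mono hσ)

lemma InH.integrable_of_le {s σ : ℝ} (hs : 1 / 2 < s) (hl : s ≤ σ) {F : ℝ → ℂ} (h : InH σ F) :
    Integrable F := by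
  have : InH (s + 0) F := h.mono (by linarith)
  simpa [wt_zero] using this.integrable hs

lemma HasFT.memHs {σ : ℝ} {f : ℝ → ℝ} {F : ℝ → ℂ} (h : HasFT f F) (hF : InH σ F) : MemHs σ f :=
  memHs_iff.2 ⟨h.1, hF.congr h.2.symm⟩

lemma HasFT.hsENorm_eq {σ : ℝ} {f : ℝ → ℝ} {F : ℝ → ℂ} (h : HasFT f F) (hF : InH σ F) :
    hsENorm σ f = ‖lift σ F‖ₑ := by
  rw [hsENorm_eq_lift (h.memHs hF), lift_congr h.2]

section

variable {σ T : ℝ} {w w' : ℝ → ℝ → ℝ} {W W' : ℝ → ℝ → ℂ}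

lemma contInHs_of_hasFT (h : ∀ t ∈ Icc 0 T, HasFT (w t) (W t)) (hm : ∀ t ∈ Icc 0 T, InH σ (W t))
    (hc : ContinuousOn (fun t => lift σ (W t)) (Icc 0 T)) : ContInHs σ T w :=
  contInHs_iff.2 ⟨fun t ht => (h t ht).memHs (hm t ht),
    hc.congr fun t ht => lift_congr (h t ht).2⟩

lemma hasDerivInHs_of_hasFT (h : ∀ t ∈ Icc 0 T, HasFT (w t) (W t))
    (h' : ∀ t ∈ Icc 0 T, HasFT (w' t) (W' t)) (hm : ∀ t ∈ Icc 0 T, InH σ (W t))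
    (hm' : ∀ t ∈ Icc 0 T, InH σ (W' t))
    (hd : ∀ t ∈ Icc 0 T, HasDerivWithinAt (fun τ => lift σ (W τ)) (lift σ (W' t)) (Icc 0 T) t) :
    HasDerivInHs σ T w w' := by
  refine (hasDerivInHs_iff (fun t ht => (h t ht).memHs (hm t ht))
    fun t ht => (h' t ht).memHs (hm' t ht)).2 fun t ht => ?_
  rw [lift_congr (h' t ht).2]
  exact (hd t ht).congr (fun r hr => lift_congr (h r hr).2) (lift_congr (h t ht).2)

end

section

variable {s σ ε δ T : ℝ} {u₀ v₀ : ℝ → ℝ} {U₀ V₀ : ℝ → ℂ}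

lemma fourierIb_of_isIBSolution (hs : 1 / 2 < s) (hσ : s ≤ σ) (hu₀ : HasFT u₀ U₀)
    (hv₀ : HasFT v₀ V₀) {u : ℝ → ℝ → ℝ} (h : IsIBSolution σ ε δ T u₀ v₀ u) :
    ∃ D, FourierIb σ ε δ T U₀ V₀ (fun t => ftr (u t)) D := by
  obtain ⟨ut, utt, hu, hut, hutt, hd, hdd, h0, h1, heq⟩ := h
  rw [contInHs_iff] at hu hut hutt
  rw [hasDerivInHs_iff hu.1 hut.1] at hd
  rw [hasDerivInHs_iff hut.1 hutt.1] at hdd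
  refine ⟨fun t => ftr (ut t), ?_, ?_, fun t ht => (hu.1 t ht).inH, fun t ht => (hut.1 t ht).inH,
    fun t ht => hermAE_ftr (hu.1 t ht).memLp, fun t ht => hermAE_ftr (hut.1 t ht).memLp, hd,
    fun t ht => ?_⟩
  · rw [ftr_congr h0]; exact hu₀.2
  · exact (hv₀.isWeakDeriv_iff.1 h1).2
  · have := (ib_equation_iff (hasFT_ftr (hu.1 t ht).memLp)
      ((hu.1 t ht).inH.integrable_of_le hs hσ) (hasFT_ftr (hutt.1 t ht).memLp)).1 (heq t ht)
    rw [← lift_congr this]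
    exact hdd t ht

lemma FourierIb.isIBSolution (hs : 1 / 2 < s) (hσ : s ≤ σ) (hε : 0 ≤ ε) (hεδ : ε ≤ δ) (hδ : 0 < δ)
    (hT : 0 ≤ T) (hu₀ : HasFT u₀ U₀) (hv₀ : HasFT v₀ V₀) {U D : ℝ → ℝ → ℂ}
    (h : FourierIb σ ε δ T U₀ V₀ U D) : IsIBSolution σ ε δ T u₀ v₀ fun t => inv (U t) := by
  have hσ0 : 0 ≤ σ := by linarith
  have h00 : (0 : ℝ) ∈ Icc 0 T := ⟨le_rfl, hT⟩
  have hU := fun t ht => hasFT_inv ((h.mem t ht).memLp hσ0) (h.herm t ht)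
  have hD := fun t ht => hasFT_inv ((h.memD t ht).memLp hσ0) (h.hermD t ht)
  have hcU : ContinuousOn (fun t => lift σ (U t)) (Icc 0 T) :=
    fun t ht => (h.deriv t ht).continuousWithinAt
  have mA := fun t ht => (lift_ibAcc (ε := ε) hs hσ hδ (h.mem t ht)).1
  have hA := fun t ht => hasFT_inv ((mA t ht).memLp hσ0) ((hermAE_ibSym δ).mul
    ((hermAE_ibSym δ).mul ((h.herm t ht).add ((hermAE_of_even (r := fun _ => ε) fun _ => rfl).mul
      (hermAE_bil conj_oneKer (h.herm t ht) (h.herm t ht))))))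
  refine ⟨fun t => inv (D t), fun t => inv (ibAcc ε δ (U t)), contInHs_of_hasFT hU h.mem hcU,
    contInHs_of_hasFT hD h.memD fun t ht => (h.derivD t ht).continuousWithinAt,
    contInHs_of_hasFT hA mA (continuousOn_lift_ibAcc hs hσ hε hεδ hδ h.mem hcU),
    hasDerivInHs_of_hasFT hU hD h.mem h.memD h.deriv,
    hasDerivInHs_of_hasFT hD hA h.memD mA h.derivD, ?_, ?_, fun t ht => ?_⟩
  · exact ftr_inj (hU 0 h00).1 hu₀.1 (((hU 0 h00).2.trans h.init).trans hu₀.2.symm)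
  · exact hv₀.isWeakDeriv_iff.2 ((hD 0 h00).congr h.initD)
  · exact (ib_equation_iff (hU t ht) ((h.mem t ht).integrable_of_le hs hσ) (hA t ht)).2 ae_eq_rfl

end

/-- An arbitrary IB solution is only in `H^s`, so the comparison with the constructed one by
uniqueness takes place at that level. -/
lemma FourierIb.lower {σ τ ε δ T : ℝ} {U₀ V₀ : ℝ → ℂ} {U D : ℝ → ℝ → ℂ} {s : ℝ} (hs : 1 / 2 < s)
    (hσ : s ≤ σ) (hδ : 0 < δ) (hl : τ ≤ σ) (h : FourierIb σ ε δ T U₀ V₀ U D) :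
    FourierIb τ ε δ T U₀ V₀ U D := by
  refine ⟨h.init, h.initD, fun t ht => (h.mem t ht).mono hl, fun t ht => (h.memD t ht).mono hl,
    h.herm, h.hermD, fun t ht => ?_, fun t ht => ?_⟩
  · have h1 := hasDerivWithinAt_clm (LongWave.lower τ σ hl) (h.deriv t ht)
    rw [lower_lift hl (h.memD t ht)] at h1
    exact h1.congr (fun r hr => (lower_lift hl (h.mem r hr)).symm) (lower_lift hl (h.mem t ht)).symm
  · have h1 := hasDerivWithinAt_clm (LongWave.lower τ σ hl) (h.derivD t ht)
    rw [lower_lift hl (lift_ibAcc hs hσ hδ (h.mem t ht)).1] at h1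
    exact h1.congr (fun r hr => (lower_lift hl (h.memD r hr)).symm)
      (lower_lift hl (h.memD t ht)).symm

section

variable {s σ κ ε δ T : ℝ} {w₀ : ℝ → ℝ} {W₀ : ℝ → ℂ}

lemma fourierCh_of_isCHSolution (hs : 1 / 2 < s) (hσ : s + 3 ≤ σ) (hw₀ : HasFT w₀ W₀)
    {w : ℝ → ℝ → ℝ} (h : IsCHSolution κ σ ε δ T w₀ w) :
    FourierCh κ σ ε δ T W₀ fun t => ftr (w t) := by
  obtain ⟨wt, hw, hwt, hd, h0, heq⟩ := h
  rw [contInHs_iff] at hw hwt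
  rw [hasDerivInHs_iff (fun t ht => (hw.1 t ht).of_le (by linarith)) hwt.1] at hd
  refine ⟨by rw [ftr_congr h0]; exact hw₀.2, hw.2, fun t ht => (hw.1 t ht).inH,
    fun t ht => hermAE_ftr (hw.1 t ht).memLp, fun t ht => ?_⟩
  obtain ⟨wx, wxx, wxxx, wtx, wtxx, a1, a2, a3, b1, b2, hR⟩ := heq t ht
  have f0 := hasFT_ftr (hw.1 t ht).memLp
  have g0 := hasFT_ftr (hwt.1 t ht).memLp
  have f1 := f0.isWeakDeriv_iff.1 a1
  have f2 := f1.isWeakDeriv_iff.1 a2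
  have f3 := f2.isWeakDeriv_iff.1 a3
  -- The product rule is applied to derivatives up to order three, whose transforms must be
  -- integrable; hence `s + 3 ≤ σ`.
  have m0 : InH (s + 1 + 1 + 1) (ftr (w t)) := (hw.1 t ht).inH.mono (by linarith)
  have this := (ch_equation_iff f0 f1 f2 f3 g0 ((g0.isWeakDeriv_iff.1 b1).isWeakDeriv_iff.1 b2)
    (m0.memLp (by linarith)) (m0.dF.memLp (by linarith)) (m0.dF.dF.memLp (by linarith))
    (m0.dF.dF.dF.memLp (by linarith)) (m0.integrable_of_le hs (by linarith))
    (m0.dF.integrable_of_le hs (by linarith)) (m0.dF.dF.integrable_of_le hs (by linarith))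
    (m0.dF.dF.dF.integrable_of_le hs le_rfl)).1 hR
  rw [← lift_congr this]
  exact hd t ht

lemma FourierCh.isCHSolution (hs : 1 / 2 < s) (hσ : s + 3 ≤ σ) (hκ : |κ| = 1) (hε : 0 ≤ ε)
    (hε1 : ε ≤ 1) (hδ : 0 ≤ δ) (hδ1 : δ ≤ 1) (hT : 0 ≤ T) (hw₀ : HasFT w₀ W₀) {W : ℝ → ℝ → ℂ}
    (h : FourierCh κ σ ε δ T W₀ W) : IsCHSolution κ σ ε δ T w₀ fun t => inv (W t) := by
  have h00 : (0 : ℝ) ∈ Icc 0 T := ⟨le_rfl, hT⟩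
  have hW := fun t ht => hasFT_inv ((h.mem t ht).memLp (by linarith)) (h.herm t ht)
  have mV : ∀ t ∈ Icc 0 T, InH (σ - 1) (chRhs κ ε δ (W t)) := fun t ht =>
    inH_chRhs hs hκ hδ hδ1 (by linarith) (by linarith) (by linarith) (h.mem t ht)
  have rV : ∀ t ∈ Icc 0 T, HermAE (chRhs κ ε δ (W t)) := fun t ht =>
    (hermAE_chLin (h.herm t ht)).sub ((hermAE_of_even (r := fun _ => κ * ε) fun _ => rfl).mul
      (hermAE_bil (conj_chKer δ) (h.herm t ht) (h.herm t ht)))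
  have hV := fun t ht => hasFT_inv ((mV t ht).memLp (by linarith)) (rV t ht)
  have hcV : ContinuousOn (fun t => lift (σ - 1) (chRhs κ ε δ (W t))) (Icc 0 T) :=
    continuousOn_lift_chRhs hs hκ hε hε1 hδ hδ1 (by linarith)
      (by rw [sub_add_cancel]; exact h.mem) (by rw [sub_add_cancel]; exact h.cont)
  refine ⟨fun t => inv (chRhs κ ε δ (W t)), contInHs_of_hasFT hW h.mem h.cont,
    contInHs_of_hasFT hV mV hcV, hasDerivInHs_of_hasFT hW hV
      (fun t ht => (h.mem t ht).mono (by linarith)) mV h.deriv,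
    ftr_inj (hW 0 h00).1 hw₀.1 (((hW 0 h00).2.trans h.init).trans hw₀.2.symm), fun t ht => ?_⟩
  have m0 : InH (s + 1 + 1 + 1) (W t) := (h.mem t ht).mono (by linarith)
  have n0 : InH (0 + 1 + 1) (chRhs κ ε δ (W t)) := (mV t ht).mono (by linarith)
  have r0 := h.herm t ht
  have f1 := hasFT_inv (m0.dF.memLp (by linarith)) r0.dF
  have f2 := hasFT_inv (m0.dF.dF.memLp (by linarith)) r0.dF.dF
  have f3 := hasFT_inv (m0.dF.dF.dF.memLp (by linarith)) r0.dF.dF.dF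
  have g1 := hasFT_inv (n0.dF.memLp (by linarith)) (rV t ht).dF
  have g2 := hasFT_inv (n0.dF.dF.memLp (by linarith)) (rV t ht).dF.dF
  exact ⟨_, _, _, _, _, (hW t ht).isWeakDeriv_iff.2 f1, f1.isWeakDeriv_iff.2 f2,
    f2.isWeakDeriv_iff.2 f3, (hV t ht).isWeakDeriv_iff.2 g1, g1.isWeakDeriv_iff.2 g2,
    (ch_equation_iff (hW t ht) f1 f2 f3 (hV t ht) g2
    (m0.memLp (by linarith)) (m0.dF.memLp (by linarith)) (m0.dF.dF.memLp (by linarith))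
    (m0.dF.dF.dF.memLp (by linarith)) (m0.integrable_of_le hs (by linarith))
    (m0.dF.integrable_of_le hs (by linarith)) (m0.dF.dF.integrable_of_le hs (by linarith))
    (m0.dF.dF.dF.integrable_of_le hs le_rfl)).2 ae_eq_rfl⟩

end

end LongWave

end

/-! ### The theorem for real functions -/

open LongWave

theorem theorem4p1 (s : ℝ) (hs : 1 / 2 < s) (u₀ v₀ : ℝ → ℝ)
    (hu₀ : MemHs (s + 6) u₀) (hv₀ : MemHs (s + 7) v₀) :
    ∃ C : ℝ, 0 < C ∧ ∀ tstar : ℝ, 0 < tstar →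
      ∃ δstar : ℝ, 0 < δstar ∧ δstar ≤ 1 ∧
        ∀ ε δ : ℝ, 0 < ε → ε ≤ δ → δ ≤ δstar →
          (∃ u, IsIBSolution (s + 6) ε δ tstar u₀ v₀ u) ∧
          (∃ wp, IsCHSolution 1 (s + 5) ε δ tstar (fun x => (u₀ x - v₀ x) / 2) wp) ∧
          (∃ wm, IsCHSolution (-1) (s + 5) ε δ tstar (fun x => (u₀ x + v₀ x) / 2) wm) ∧
          ∀ u wp wm : ℝ → ℝ → ℝ,
            IsIBSolution s ε δ tstar u₀ v₀ u →
            IsCHSolution 1 (s + 5) ε δ tstar (fun x => (u₀ x - v₀ x) / 2) wp →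
            IsCHSolution (-1) (s + 5) ε δ tstar (fun x => (u₀ x + v₀ x) / 2) wm →
            ∀ t ∈ Set.Icc 0 tstar,
              hsENorm s (fun x => u t x - wp t x - wm t x) ≤
                ENNReal.ofReal (C * ((ε + δ ^ 2) + (ε + δ ^ 4) * t)) := by
  have fu := hasFT_ftr hu₀.memLp
  have fv := hasFT_ftr hv₀.memLp
  have fp : HasFT (fun x => (u₀ x - v₀ x) / 2) fun η => (ftr u₀ η - ftr v₀ η) / 2 := by
    have h := (fu.sub fv).const_mul (1 / 2)
    have e : (fun x => (u₀ x - v₀ x) / 2) = fun x => 1 / 2 * (u₀ x - v₀ x) := by ext x; ring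
    rw [e]
    exact h.congr (Eventually.of_forall fun η => by push_cast; ring)
  have fm : HasFT (fun x => (u₀ x + v₀ x) / 2) fun η => (ftr u₀ η + ftr v₀ η) / 2 := by
    have h := (fu.add fv).const_mul (1 / 2)
    have e : (fun x => (u₀ x + v₀ x) / 2) = fun x => 1 / 2 * (u₀ x + v₀ x) := by ext x; ring
    rw [e]
    exact h.congr (Eventually.of_forall fun η => by push_cast; ring)
  obtain ⟨C, hC, h⟩ := exists_waves hs hu₀.inH (hermAE_ftr hu₀.memLp) hv₀.inH
    (hermAE_ftr hv₀.memLp)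
  refine ⟨C, hC, fun T hT => ?_⟩
  obtain ⟨δs, hδs, hδs1, h⟩ := h T hT
  refine ⟨δs, hδs, hδs1, fun ε δ hε hεδ hδs' => ?_⟩
  obtain ⟨U, D, Wp, Wm, hU, hp, hm, hb⟩ := h ε δ hε hεδ hδs'
  have hδ : 0 < δ := hε.trans_le hεδ
  have hδ1 : δ ≤ 1 := hδs'.trans hδs1
  have hε1 : ε ≤ 1 := hεδ.trans hδ1
  have k1 : |(1 : ℝ)| = 1 := abs_one
  have k2 : |(-1 : ℝ)| = 1 := by rw [abs_neg, abs_one]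
  refine ⟨⟨_, hU.isIBSolution hs (by linarith) hε.le hεδ hδ hT.le fu fv⟩,
    ⟨_, hp.isCHSolution hs (by linarith) k1 hε.le hε1 hδ.le hδ1 hT.le fp⟩,
    ⟨_, hm.isCHSolution hs (by linarith) k2 hε.le hε1 hδ.le hδ1 hT.le fm⟩,
    fun u wp wm hu hwp hwm t ht => ?_⟩
  have mu : MemHs s (u t) := by
    obtain ⟨_, _, h1, _⟩ := hu
    exact (h1 t ht).1
  have mp : MemHs (s + 5) (wp t) := by
    obtain ⟨_, h1, _⟩ := hwp
    exact (h1 t ht).1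
  have mm : MemHs (s + 5) (wm t) := by
    obtain ⟨_, h1, _⟩ := hwm
    exact (h1 t ht).1
  -- By uniqueness the transforms of arbitrary solutions agree with the constructed ones, for which
  -- the estimate is known.
  obtain ⟨D', hu'⟩ := fourierIb_of_isIBSolution hs le_rfl fu fv hu
  have hU' := hU.lower hs (by linarith) hδ (τ := s) (by linarith)
  have eu := ib_unique hs le_rfl hε.le hεδ hδ (hu'.init.trans hU'.init.symm)
    (hu'.initD.trans hU'.initD.symm)
    (fun t ht => ⟨hu'.mem t ht, hu'.deriv t ht, hu'.derivD t ht⟩)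
    (fun t ht => ⟨hU'.mem t ht, hU'.deriv t ht, hU'.derivD t ht⟩) t ht
  have ech : ∀ {κ : ℝ} {F : ℝ → ℂ} {W W' : ℝ → ℝ → ℂ}, |κ| = 1 →
      FourierCh κ (s + 5) ε δ T F W → FourierCh κ (s + 5) ε δ T F W' → W t =ᵐ[volume] W' t :=
    fun hκ h₁ h₂ => ch_unique hs hκ hε.le hε1 hδ.le hδ1 (by linarith) (h₁.init.trans h₂.init.symm)
      (fun t ht => ⟨h₁.mem t ht, h₁.herm t ht, h₁.deriv t ht⟩)
      (fun t ht => ⟨h₂.mem t ht, h₂.herm t ht, h₂.deriv t ht⟩) h₁.cont h₂.cont t ht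
  have ep := ech k1 (fourierCh_of_isCHSolution hs (by linarith) fp hwp) hp
  have em := ech k2 (fourierCh_of_isCHSolution hs (by linarith) fm hwm) hm
  have hf := (((hasFT_ftr mu.memLp).congr eu).sub ((hasFT_ftr mp.memLp).congr ep)).sub
    ((hasFT_ftr mm.memLp).congr em)
  rw [hf.hsENorm_eq (((hU'.mem t ht).sub ((hp.mem t ht).mono (by linarith))).sub
    ((hm.mem t ht).mono (by linarith))), ← ofReal_norm]
  exact ENNReal.ofReal_le_ofReal (hb t ht)
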